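/- **Setting.** Let $N\ge 1$, let $\Omega\subset\mathbb R^N$ be open, bounded and convex, and let $p:\Omega\to(1,\infty)$ be measurable with $1<p^-:=\operatorname{ess\,inf}p\le\operatorname{ess\,sup}p<\infty$. Put $q(x)=p(x)/(p(x)-1)$, $q^-:=\operatorname{ess\,inf}q$, and assume $\frac1{p^-}+\frac1{q^-}\le 1$. Let $G:[0,\infty)\to\mathbb R$ be convex and $C^2$, and $E(\rho)=\int_\Omega G(\rho)\,dx$ for $\rho\in P(\Omega)$, where $P(\Omega)$ denotes the bounded probability densities on $\Omega$. For $\rho\in P(\Omega)$ let $\|u\|_{L^{r(\cdot)}_\rho}=\inf\{\lambda>0:\int_\Omega|u/\lambda|^{r(x)}\rho\,dx\le1\}$, and let $L^{r(\cdot)}_\rho$ be the space of measurable $u$ for which some such $\lambda$ exists. For $v\in L^{p(\cdot)}_\rho(\Omega;\mathbb R^N)$ let $-\operatorname{div}(\rho v)$ be the distribution $\varphi\mapsto\int_\Omega\rho\, v\cdot\nabla\varphi\,dx$, $\varphi\in C_c^\infty(\mathbb R^N)$ (so that $\operatorname{div}(\rho w)=0$ includes the no-flux condition $\rho w\cdot\eta=0$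 on $\partial\Omega$). * Tangent space: $T_\rho=\{-\operatorname{div}(\rho v): v\in L^{p(\cdot)}_\rho\}$. Finsler metric: $F_{p(\cdot)}(\rho,\nu)=\inf\{\|v\|_{L^{p(\cdot)}_\rho}:\nu=-\operatorname{div}(\rho v)\}$. $T^*_\rho$ is the space of linear forms on $T_\rho$ bounded with respect to $F_{p(\cdot)}(\rho,\cdot)$, with the dual norm. * A normalization function is a continuous, strictly increasing $\theta:[0,\infty)\to[0,\infty)$ with $\theta(0)=0$ and $\theta(t)\to\infty$ as $t\to\infty$. Define $J_\theta(0)=\{0\}$ and, for $\nu\ne0$, let $J_\theta(\nu)$ be the set of $\nu^*\in T^*_\rho$ with $\langle\nu^*,\nu\rangle=\theta(\|V\|_{L^{p(\cdot)}_\rho})\|V\|_{L^{p(\cdot)}_\rho}$ and $\|\nu^*\|=\theta(\|V\|_{L^{p(\cdot)}_\rho})=\||V|^{p(x)-1}\|_{L^{q(\cdot)}_\rho}$, where $V$ minimizes $\int_\Omega\frac{|V|^{p(x)}}{p(x)}\rho\,dx$ among the $V\in L^{p(\cdot)}_\rho$ with $\nu=-\operatorname{div}(\rho V)$. * $\ell\in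 T^*_\rho$ is a differential of $E$ at $\rho$ if $\ell(\nu)=\frac{d}{dt}E(\rho(t))|_{t=0}$ for every $\nu\in T_\rho$ and every curve $\rho:[0,1]\to P(\Omega)$, uniformly bounded on $\Omega$, with $\rho(0)=\rho$ and $\partial_t\rho|_{t=0}=\nu$, the time derivative at $0$ existing in $L^1(\Omega)$. $\nu\in T_\rho$ is a Finsler gradient of $E$ at $\rho$, written $\nu=\nabla^\theta_FE(\rho)$, if $J_\theta(\nu)=\{\ell\}$ for a differential $\ell$ of $E$ at $\rho$. **Theorem.** There is a normalization function $\theta$ with $$\theta(\|V\|_{L^{p(\cdot)}_\rho})=\||V|^{p(x)-1}\|_{L^{q(\cdot)}_\rho}\quad\text{for all }\rho\in P(\Omega),\ V\in L^{p(\cdot)}_\rho(\Omega;\mathbb R^N),$$ and for every such $\theta$ the following hold. 1. Let $\rho\in P(\Omega)$ be such that $G'(\rho)$ has a weak gradient $\nabla G'(\rho)\in L^1_{loc}(\Omega)\cap L^{q(\cdot)}_\rho(\Omega)$. Then $|\nabla G'(\rho)|^{q(x)-2}\nabla G'(\rho)\in L^{p(\cdot)}_\rho$, and $$\nabla^\theta_FE(\rho)=-\operatorname{div}\big(\rho\,|\nabla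 G'(\rho)|^{q(x)-2}\nabla G'(\rho)\big)$$ is a Finsler gradient of $E$ at $\rho$. A differential $DE(\rho)$ is given by $DE(\rho)(-\operatorname{div}(\rho v))=\int_\Omega\rho\,\nabla G'(\rho)\cdot v\,dx$, and the displayed element is the only $\nu\in T_\rho$ with $J_\theta(\nu)=\{DE(\rho)\}$. If moreover $\rho$ is lower semicontinuous on $\Omega$ (for example continuous), the differential of $E$ at $\rho$ is unique and hence so is the Finsler gradient. 2. Let $\rho:[0,\infty)\to P(\Omega)$ be such that $\nabla G'(\rho(t))\in L^1_{loc}(\Omega)\cap L^{q(\cdot)}_{\rho(t)}(\Omega)$ exists for a.e. $t>0$, and let $\rho_0\in P(\Omega)$. If $\rho$ is a weak solution of the $q(x)$-Laplacian equation $$\partial_t\rho=\operatorname{div}\big(\rho|\nabla G'(\rho)|^{q(x)-2}\nabla G'(\rho)\big)\ \text{in }(0,\infty)\times\Omega,\qquad \rho(0)=\rho_0,\qquad \rho|\nabla G'(\rho)|^{q(x)-2}\nabla G'(\rho)\cdot\eta=0\ \text{on }\partial\Omega,$$ then $\rho$ is a gradient flow of $E$ for $\theta$: $\partial_t\rho=-\nabla^\theta_FE(\rho)$,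 $\rho(0)=\rho_0$, with $\nabla^\theta_FE(\rho(t))$ a Finsler gradient for a.e. $t$. Conversely, if $\rho(t)$ is lower semicontinuous on $\Omega$ for a.e. $t$, every gradient flow $\rho$ is a weak solution of the equation. Here $\partial_t\rho=\eta$, $\rho(0)=\rho_0$ means that for all $\psi\in C_c^\infty(\mathbb R\times\mathbb R^N)$ the time integrals exist and $\int_0^\infty\!\int_\Omega\rho\,\partial_t\psi\,dx\,dt+\int_0^\infty\langle\eta(t),\psi(t,\cdot)\rangle dt=-\int_\Omega\rho_0\,\psi(0,\cdot)\,dx$. -/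

import Mathlib

open MeasureTheory Filter Topology Set TopologicalSpace
open scoped Distributions ContDiff

noncomputable section

/-! ### Variable exponent Lebesgue spaces -/

section VarLebesgue

variable {X F : Type*} [MeasurableSpace X] [NormedAddCommGroup F]

/-- Membership in the variable exponent Lebesgue space `L^{r(.)}_μ`:
`∫ |u / c|^{r(x)} dμ ≤ 1` for some `c > 0`. -/
def MemVarLp (μ : Measure X) (r : X → ℝ) (u : X → F) : Prop :=
  AEStronglyMeasurable u μ ∧
    ∃ c : ℝ, 0 < c ∧ ∫⁻ x, ENNReal.ofReal ((‖u x‖ / c) ^ r x) ∂μ ≤ 1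

/-- The (Luxemburg) norm of `L^{r(.)}_μ`. -/
def varNorm (μ : Measure X) (r : X → ℝ) (u : X → F) : ℝ :=
  sInf {c : ℝ | 0 < c ∧ ∫⁻ x, ENNReal.ofReal ((‖u x‖ / c) ^ r x) ∂μ ≤ 1}

/-- The conjugate exponent `q(x) = p(x) / (p(x) - 1)`. -/
def conjExp (p : X → Ioi (1 : ℝ)) (x : X) : ℝ := (p x : ℝ) / ((p x : ℝ) - 1)

theorem MemVarLp.add {μ : Measure X} {p : X → Ioi (1 : ℝ)} {u v : X → F}
    (hu : MemVarLp μ (fun x => (p x : ℝ)) u) (hv : MemVarLp μ (fun x => (p x : ℝ)) v)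
    (hp : Measurable p) :
    MemVarLp μ (fun x => (p x : ℝ)) (u + v) := by
  obtain ⟨hum, a, ha, hua⟩ := hu
  obtain ⟨hvm, b, hb, hvb⟩ := hv
  refine ⟨hum.add hvm, a + b, by positivity, ?_⟩
  have hab : 0 < a + b := by positivity
  have key : ∀ x, ENNReal.ofReal ((‖(u + v) x‖ / (a + b)) ^ (p x : ℝ)) ≤
      ENNReal.ofReal (a / (a + b)) * ENNReal.ofReal ((‖u x‖ / a) ^ (p x : ℝ)) +
      ENNReal.ofReal (b / (a + b)) * ENNReal.ofReal ((‖v x‖ / b) ^ (p x : ℝ)) := by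
    intro x
    have hpx : (1 : ℝ) < p x := (p x).2
    rw [← ENNReal.ofReal_mul (by positivity), ← ENNReal.ofReal_mul (by positivity),
      ← ENNReal.ofReal_add (by positivity) (by positivity)]
    apply ENNReal.ofReal_le_ofReal
    have h1 : ‖(u + v) x‖ / (a + b) ≤
        (a / (a + b)) * (‖u x‖ / a) + (b / (a + b)) * (‖v x‖ / b) := by
      have : (a / (a + b)) * (‖u x‖ / a) + (b / (a + b)) * (‖v x‖ / b) =
          (‖u x‖ + ‖v x‖) / (a + b) := by field_simp
      rw [this]
      gcongr
      exact norm_add_le _ _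
    refine (Real.rpow_le_rpow (by positivity) h1 (by linarith)).trans ?_
    have h2 := (convexOn_rpow hpx.le).2 (mem_Ici.2 (by positivity : 0 ≤ ‖u x‖ / a))
      (mem_Ici.2 (by positivity : 0 ≤ ‖v x‖ / b))
      (by positivity : 0 ≤ a / (a + b)) (by positivity : 0 ≤ b / (a + b))
      (by field_simp)
    simpa [smul_eq_mul] using h2
  have hmu : AEMeasurable (fun x => ENNReal.ofReal ((‖u x‖ / a) ^ (p x : ℝ))) μ :=
    ((hum.norm.aemeasurable.div_const a).pow
      (measurable_subtype_coe.comp hp).aemeasurable).ennreal_ofReal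
  have hmv : AEMeasurable (fun x => ENNReal.ofReal ((‖v x‖ / b) ^ (p x : ℝ))) μ :=
    ((hvm.norm.aemeasurable.div_const b).pow
      (measurable_subtype_coe.comp hp).aemeasurable).ennreal_ofReal
  calc ∫⁻ x, ENNReal.ofReal ((‖(u + v) x‖ / (a + b)) ^ (p x : ℝ)) ∂μ
      ≤ ∫⁻ x, (ENNReal.ofReal (a / (a + b)) * ENNReal.ofReal ((‖u x‖ / a) ^ (p x : ℝ)) +
        ENNReal.ofReal (b / (a + b)) * ENNReal.ofReal ((‖v x‖ / b) ^ (p x : ℝ))) ∂μ :=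
        lintegral_mono key
    _ = ENNReal.ofReal (a / (a + b)) * ∫⁻ x, ENNReal.ofReal ((‖u x‖ / a) ^ (p x : ℝ)) ∂μ +
        ENNReal.ofReal (b / (a + b)) * ∫⁻ x, ENNReal.ofReal ((‖v x‖ / b) ^ (p x : ℝ)) ∂μ := by
        rw [lintegral_add_left' (hmu.const_mul _), lintegral_const_mul'' _ hmu,
          lintegral_const_mul'' _ hmv]
    _ ≤ ENNReal.ofReal (a / (a + b)) * 1 + ENNReal.ofReal (b / (a + b)) * 1 := by gcongr
    _ = 1 := by
        rw [mul_one, mul_one, ← ENNReal.ofReal_add (by positivity) (by positivity)]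
        rw [← add_div, div_self hab.ne', ENNReal.ofReal_one]

theorem MemVarLp.zero (μ : Measure X) (p : X → Ioi (1 : ℝ)) :
    MemVarLp μ (fun x => (p x : ℝ)) (0 : X → F) := by
  refine ⟨aestronglyMeasurable_zero, 1, one_pos, ?_⟩
  have : ∀ x, (0 : ℝ) ^ (p x : ℝ) = 0 := fun x =>
    Real.zero_rpow (ne_of_gt (lt_trans one_pos (p x).2))
  simp [this]

theorem MemVarLp.const_smul [NormedSpace ℝ F] {μ : Measure X} {p : X → Ioi (1 : ℝ)} {u : X → F}
    (hu : MemVarLp μ (fun x => (p x : ℝ)) u) (k : ℝ) :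
    MemVarLp μ (fun x => (p x : ℝ)) (k • u) := by
  rcases eq_or_ne k 0 with rfl | hk
  · rw [zero_smul]; exact MemVarLp.zero μ p
  · obtain ⟨hum, a, ha, hua⟩ := hu
    refine ⟨hum.const_smul k, |k| * a, by positivity, ?_⟩
    have : ∀ x, ‖(k • u) x‖ / (|k| * a) = ‖u x‖ / a := by
      intro x
      rw [Pi.smul_apply, norm_smul, Real.norm_eq_abs]
      have : |k| ≠ 0 := abs_ne_zero.2 hk
      field_simp
    simpa only [this] using hua

theorem MemVarLp.integrable {μ : Measure X} [IsFiniteMeasure μ] {p : X → Ioi (1 : ℝ)}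
    {u : X → F} (hu : MemVarLp μ (fun x => (p x : ℝ)) u) : Integrable u μ := by
  obtain ⟨hum, a, ha, hua⟩ := hu
  refine ⟨hum, ?_⟩
  have key : ∀ x, ‖u x‖ₑ ≤
      ENNReal.ofReal a * (1 + ENNReal.ofReal ((‖u x‖ / a) ^ (p x : ℝ))) := by
    intro x
    have hpx : (1 : ℝ) < p x := (p x).2
    rw [← ENNReal.ofReal_one, ← ENNReal.ofReal_add zero_le_one (by positivity),
      ← ENNReal.ofReal_mul ha.le, ← ofReal_norm]
    apply ENNReal.ofReal_le_ofReal
    have h : ‖u x‖ / a ≤ 1 + (‖u x‖ / a) ^ (p x : ℝ) := by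
      rcases le_total (‖u x‖ / a) 1 with h | h
      · have : 0 ≤ (‖u x‖ / a) ^ (p x : ℝ) := by positivity
        linarith
      · have := Real.self_le_rpow_of_one_le h hpx.le
        linarith
    calc ‖u x‖ = a * (‖u x‖ / a) := by field_simp
      _ ≤ _ := by gcongr
  refine lt_of_le_of_lt (lintegral_mono key) ?_
  rw [lintegral_const_mul' _ _ ENNReal.ofReal_ne_top, lintegral_add_left measurable_const]
  refine ENNReal.mul_lt_top ENNReal.ofReal_lt_top (ENNReal.add_lt_top.2 ⟨?_, ?_⟩)
  · simp
  · exact lt_of_le_of_lt hua ENNReal.one_lt_top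

end VarLebesgue

/-! ### Tangent space, Finsler metric, cotangent vectors -/

section Finsler

variable {N : ℕ}

/-- The vector fields `v : ℝ^N → ℝ^N` in `L^{p(.)}_μ` (functions, not classes of functions). -/
def varLp (μ : Measure (EuclideanSpace ℝ (Fin N))) (p : EuclideanSpace ℝ (Fin N) → Ioi (1 : ℝ))
    (hp : Measurable p) :
    Submodule ℝ (EuclideanSpace ℝ (Fin N) → EuclideanSpace ℝ (Fin N)) where
  carrier := {v | MemVarLp μ (fun x => (p x : ℝ)) v}
  add_mem' hu hv := MemVarLp.add hu hv hp
  zero_mem' := MemVarLp.zero μ p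
  smul_mem' k _ hu := MemVarLp.const_smul hu k

/-- The distribution `-div(μ v)` on `ℝ^N`, `φ ↦ ∫ ∇φ · v dμ`, for a locally `μ`-integrable field
`v`. If `μ` is carried by `Ω`, the test functions `φ` are not required to vanish on `∂Ω`, so that
`-div(μ v) = -div(μ w)` encodes both the identity in `Ω` and the equality of the normal fluxes on
`∂Ω`; in particular `div(μ w) = 0` includes the no-flux condition `μ w · η = 0` on `∂Ω`. -/
def negDiv (μ : Measure (EuclideanSpace ℝ (Fin N)))
    (v : EuclideanSpace ℝ (Fin N) → EuclideanSpace ℝ (Fin N)) :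
    𝓓'((⊤ : Opens (EuclideanSpace ℝ (Fin N))), ℝ) :=
  let T : 𝓓((⊤ : Opens (EuclideanSpace ℝ (Fin N))), ℝ) →L[ℝ] ℝ :=
    (TestFunction.integralAgainstBilinCLM
      (ContinuousLinearMap.id ℝ (EuclideanSpace ℝ (Fin N) →L[ℝ] ℝ)) μ v).comp
      (TestFunction.fderivCLM ℝ ⊤ ⊤)
  { toFun := T
    map_add' := map_add T
    map_smul' := map_smul T
    cont := T.continuous }

theorem negDiv_apply {μ : Measure (EuclideanSpace ℝ (Fin N))}
    {v : EuclideanSpace ℝ (Fin N) → EuclideanSpace ℝ (Fin N)} (hv : Integrable v μ)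
    (φ : 𝓓((⊤ : Opens (EuclideanSpace ℝ (Fin N))), ℝ)) :
    negDiv μ v φ = ∫ x, fderiv ℝ φ x (v x) ∂μ := by
  change TestFunction.integralAgainstBilinCLM
      (ContinuousLinearMap.id ℝ (EuclideanSpace ℝ (Fin N) →L[ℝ] ℝ)) μ v
      (TestFunction.fderivCLM ℝ ⊤ ⊤ φ) = _
  rw [TestFunction.integralAgainstBilinCLM_eq_integral (hv.locallyIntegrable.locallyIntegrableOn _)]
  simp

theorem integrable_fderiv_apply {μ : Measure (EuclideanSpace ℝ (Fin N))}
    {v : EuclideanSpace ℝ (Fin N) → EuclideanSpace ℝ (Fin N)} (hv : Integrable v μ)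
    (φ : 𝓓((⊤ : Opens (EuclideanSpace ℝ (Fin N))), ℝ)) :
    Integrable (fun x => fderiv ℝ φ x (v x)) μ := by
  have h := TestFunction.integrable_bilin
    (ContinuousLinearMap.id ℝ (EuclideanSpace ℝ (Fin N) →L[ℝ] ℝ))
    (hv.locallyIntegrable.locallyIntegrableOn
      ((⊤ : Opens (EuclideanSpace ℝ (Fin N))) : Set (EuclideanSpace ℝ (Fin N))))
    (TestFunction.fderivCLM ℝ (⊤ : ℕ∞) (⊤ : ℕ∞) φ)
  simpa using h

variable (μ : Measure (EuclideanSpace ℝ (Fin N))) [IsFiniteMeasure μ]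
  (p : EuclideanSpace ℝ (Fin N) → Ioi (1 : ℝ)) (hp : Measurable p)

/-- The linear map `v ↦ -div(μ v)` from `L^{p(.)}_μ` to distributions. -/
def velocityMap : varLp μ p hp →ₗ[ℝ] 𝓓'((⊤ : Opens (EuclideanSpace ℝ (Fin N))), ℝ) where
  toFun v := negDiv μ v
  map_add' u v := by
    have hu := MemVarLp.integrable (p := p) u.2
    have hv := MemVarLp.integrable (p := p) v.2
    ext φ
    change negDiv μ (u.1 + v.1) φ = negDiv μ u.1 φ + negDiv μ v.1 φ
    rw [negDiv_apply hu, negDiv_apply hv, negDiv_apply (hu.add hv),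
      ← integral_add (integrable_fderiv_apply hu φ) (integrable_fderiv_apply hv φ)]
    simp
  map_smul' k v := by
    have hv := MemVarLp.integrable (p := p) v.2
    ext φ
    change negDiv μ (k • v.1) φ = k • negDiv μ v.1 φ
    rw [negDiv_apply hv, negDiv_apply (hv.smul k), ← integral_smul]
    simp

/-- The tangent space `T_μ P_{p(.)} = {-div(μ v) : v ∈ L^{p(.)}_μ}`. -/
abbrev TangentSp : Submodule ℝ (𝓓'((⊤ : Opens (EuclideanSpace ℝ (Fin N))), ℝ)) :=
  LinearMap.range (velocityMap μ p hp)

/-- The tangent vector `-div(μ v)`. -/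
def tangentOf (v : varLp μ p hp) : TangentSp μ p hp := (velocityMap μ p hp).rangeRestrict v

/-- The Finsler metric `F_{p(.)}(μ, ν) = inf {‖v‖_{L^{p(.)}_μ} : ν = -div(μ v)}`. -/
def finslerMetric (ν : TangentSp μ p hp) : ℝ :=
  sInf {r : ℝ | ∃ v : varLp μ p hp, tangentOf μ p hp v = ν ∧ r = varNorm μ (fun x => (p x : ℝ)) v.1}

/-- Boundedness of a linear form on the tangent space, i.e. membership in `T*_μ P_{p(.)}`. -/
def IsCotangent (l : TangentSp μ p hp →ₗ[ℝ] ℝ) : Prop :=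
  ∃ C : ℝ, ∀ ν, |l ν| ≤ C * finslerMetric μ p hp ν

/-- The norm of the dual of `(T_μ P_{p(.)}, F_{p(.)}(μ, .))`. -/
def cotangentNorm (l : TangentSp μ p hp →ₗ[ℝ] ℝ) : ℝ :=
  sInf {C : ℝ | 0 ≤ C ∧ ∀ ν, |l ν| ≤ C * finslerMetric μ p hp ν}

/-- Normalization functions on `[0, ∞)`. -/
structure IsNormalization (θ : ℝ → ℝ) : Prop where
  continuousOn : ContinuousOn θ (Ici 0)
  strictMonoOn : StrictMonoOn θ (Ici 0)
  map_zero : θ 0 = 0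
  tendsto : Tendsto θ atTop atTop

/-- `V` minimizes `∫ |V|^{p(x)} / p(x) dμ` among all velocity fields of the tangent vector
`ν = -div(μ V)`. -/
def IsOptimalVelocity (ν : TangentSp μ p hp) (V : varLp μ p hp) : Prop :=
  tangentOf μ p hp V = ν ∧ ∀ W : varLp μ p hp, tangentOf μ p hp W = ν →
    ∫⁻ x, ENNReal.ofReal (‖V.1 x‖ ^ (p x : ℝ) / (p x : ℝ)) ∂μ ≤
      ∫⁻ x, ENNReal.ofReal (‖W.1 x‖ ^ (p x : ℝ) / (p x : ℝ)) ∂μ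

/-- The (set-valued) duality map `J_θ : T_μ P_{p(.)} → T*_μ P_{p(.)}`, with `J_θ(0) = 0`. -/
def dualityMap (θ : ℝ → ℝ) (ν : TangentSp μ p hp) : Set (TangentSp μ p hp →ₗ[ℝ] ℝ) :=
  {l | IsCotangent μ p hp l ∧
    ((ν = 0 ∧ l = 0) ∨
      (ν ≠ 0 ∧ ∃ V : varLp μ p hp, IsOptimalVelocity μ p hp ν V ∧
        l ν = θ (varNorm μ (fun x => (p x : ℝ)) V.1) * varNorm μ (fun x => (p x : ℝ)) V.1 ∧
        cotangentNorm μ p hp l = θ (varNorm μ (fun x => (p x : ℝ)) V.1) ∧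
        θ (varNorm μ (fun x => (p x : ℝ)) V.1) =
          varNorm μ (conjExp p) (fun x => ‖V.1 x‖ ^ ((p x : ℝ) - 1))))}

end Finsler

/-! ### Probability densities, functionals, differentials, gradients -/

section Gradient

variable {N : ℕ} (Ω : Opens (EuclideanSpace ℝ (Fin N)))

/-- Bounded probability densities on `Ω` (values outside `Ω` are irrelevant). -/
structure Density where
  toFun : EuclideanSpace ℝ (Fin N) → ℝ
  measurable : Measurable toFun
  nonneg : ∀ x ∈ Ω, 0 ≤ toFun x
  bounded : ∃ M : ℝ, ∀ x ∈ Ω, toFun x ≤ M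
  integral_eq_one : ∫ x in (Ω : Set (EuclideanSpace ℝ (Fin N))), toFun x = 1

variable {Ω}

/-- The probability measure `ρ(x) dx` on `Ω`. -/
def Density.measure (ρ : Density Ω) : Measure (EuclideanSpace ℝ (Fin N)) :=
  (volume.restrict (Ω : Set (EuclideanSpace ℝ (Fin N)))).withDensity
    (fun x => ENNReal.ofReal (ρ.toFun x))

instance (ρ : Density Ω) : IsProbabilityMeasure ρ.measure := by
  constructor
  have hint : Integrable ρ.toFun
      (volume.restrict (Ω : Set (EuclideanSpace ℝ (Fin N)))) := by
    by_contra h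
    have := ρ.integral_eq_one
    rw [integral_undef h] at this
    exact zero_ne_one this
  rw [Density.measure, withDensity_apply _ MeasurableSet.univ, Measure.restrict_univ,
    ← ofReal_integral_eq_lintegral_ofReal hint, ρ.integral_eq_one, ENNReal.ofReal_one]
  exact (ae_restrict_mem Ω.isOpen.measurableSet).mono fun x hx => ρ.nonneg x hx

/-- `ξ` is the weak (distributional) gradient of `u` on `Ω`. -/
def IsWeakGradient (Ω : Opens (EuclideanSpace ℝ (Fin N))) (u : EuclideanSpace ℝ (Fin N) → ℝ)
    (ξ : EuclideanSpace ℝ (Fin N) → EuclideanSpace ℝ (Fin N)) : Prop :=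
  LocallyIntegrableOn u Ω ∧ LocallyIntegrableOn ξ Ω ∧
    ∀ (φ : 𝓓(Ω, ℝ)) (e : EuclideanSpace ℝ (Fin N)),
      ∫ x in (Ω : Set (EuclideanSpace ℝ (Fin N))), u x * fderiv ℝ φ x e =
        -∫ x in (Ω : Set (EuclideanSpace ℝ (Fin N))), φ x * inner ℝ (ξ x) e

/-- The functional `E(ρ) = ∫_Ω G(ρ) dx`. -/
def energy (G : ℝ → ℝ) (ρ : Density Ω) : ℝ :=
  ∫ x in (Ω : Set (EuclideanSpace ℝ (Fin N))), G (ρ.toFun x)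

/-- The derivative of `G` on `[0, ∞)` (one-sided at `0`). -/
def derivOnIci (G : ℝ → ℝ) (s : ℝ) : ℝ := derivWithin G (Ici 0) s

/-- The curve `γ : [0,1] → P(Ω)` starts at `ρ` with `∂_t γ(0) = ν`: the densities
are uniformly bounded, the difference quotients at `t = 0` converge in `L^1(Ω)` to some `σ`, and
`σ` is the distribution `ν`. -/
def HasInitialVelocity (γ : ℝ → Density Ω) (ρ : Density Ω)
    (ν : 𝓓'((⊤ : Opens (EuclideanSpace ℝ (Fin N))), ℝ)) : Prop :=
  γ 0 = ρ ∧
  (∃ M : ℝ, ∀ t ∈ Icc (0 : ℝ) 1, ∀ x ∈ Ω, (γ t).toFun x ≤ M) ∧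
  ∃ σ : EuclideanSpace ℝ (Fin N) → ℝ,
    IntegrableOn σ (Ω : Set (EuclideanSpace ℝ (Fin N))) ∧
    Tendsto (fun t : ℝ => ∫ x in (Ω : Set (EuclideanSpace ℝ (Fin N))),
      |((γ t).toFun x - ρ.toFun x) / t - σ x|) (𝓝[>] 0) (𝓝 0) ∧
    ∀ φ : 𝓓((⊤ : Opens (EuclideanSpace ℝ (Fin N))), ℝ),
      ν φ = ∫ x in (Ω : Set (EuclideanSpace ℝ (Fin N))), σ x * φ x

variable (p : EuclideanSpace ℝ (Fin N) → Ioi (1 : ℝ)) (hp : Measurable p)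

/-- `l` is a differential of `E` at `ρ`: a bounded linear form on `T_ρ P_{p(.)}(Ω)` with
`l(∂_t γ(0)) = d/dt E(γ(t))` at `t = 0` for all curves `γ : [0,1] → P(Ω)` starting at `ρ`. -/
def IsDifferential (E : Density Ω → ℝ) (ρ : Density Ω)
    (l : TangentSp ρ.measure p hp →ₗ[ℝ] ℝ) : Prop :=
  IsCotangent ρ.measure p hp l ∧
    ∀ (ν : TangentSp ρ.measure p hp) (γ : ℝ → Density Ω), HasInitialVelocity γ ρ ν.1 →
      HasDerivWithinAt (fun t => E (γ t)) (l ν) (Icc 0 1) 0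

/-- `ν = ∇^θ_{F_{p(.)}} E(ρ)`, i.e. `D E(ρ) = J_θ(ν)`. -/
def IsFinslerGradient (θ : ℝ → ℝ) (E : Density Ω → ℝ) (ρ : Density Ω)
    (ν : TangentSp ρ.measure p hp) : Prop :=
  ∃ l, IsDifferential p hp E ρ l ∧ dualityMap ρ.measure p hp θ ν = {l}

/-- `θ(‖V‖_{L^{p(.)}_ρ}) = ‖ |V|^{p(x)-1} ‖_{L^{q(.)}_ρ}` for all `V ∈ L^{p(.)}_ρ`. -/
def IsCompatible (θ : ℝ → ℝ) (ρ : Density Ω) : Prop :=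
  ∀ V : EuclideanSpace ℝ (Fin N) → EuclideanSpace ℝ (Fin N),
    MemVarLp ρ.measure (fun x => (p x : ℝ)) V →
      θ (varNorm ρ.measure (fun x => (p x : ℝ)) V) =
        varNorm ρ.measure (conjExp p) (fun x => ‖V x‖ ^ ((p x : ℝ) - 1))

/-- The vector field `|ξ|^{q(x)-2} ξ`. -/
def qFlux (ξ : EuclideanSpace ℝ (Fin N) → EuclideanSpace ℝ (Fin N)) :
    EuclideanSpace ℝ (Fin N) → EuclideanSpace ℝ (Fin N) :=
  fun x => (‖ξ x‖ ^ (conjExp p x - 2)) • ξ x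

/-- The time slice `ψ(t, .)` of a space-time test function. -/
def timeSlice (ψ : 𝓓((⊤ : Opens (ℝ × EuclideanSpace ℝ (Fin N))), ℝ)) (t : ℝ) :
    𝓓((⊤ : Opens (EuclideanSpace ℝ (Fin N))), ℝ) where
  toFun x := ψ (t, x)
  contDiff' := ψ.contDiff.comp (contDiff_const.prodMk contDiff_id)
  hasCompactSupport' := by
    refine HasCompactSupport.of_support_subset_isCompact
      (ψ.hasCompactSupport.isCompact.image continuous_snd) fun x hx => ?_
    exact ⟨(t, x), subset_tsupport _ hx, rfl⟩
  tsupport_subset' := fun _ _ => trivial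

/-- `∂_t ρ = η` in the sense of distributions on `[0, ∞) × Ω`, with initial datum `ρ₀`:
`∫_0^∞ ∫_Ω ρ ∂_t ψ dx dt + ∫_0^∞ ⟨η(t), ψ(t, .)⟩ dt = -∫_Ω ρ₀ ψ(0, .) dx`
for all smooth compactly supported `ψ` on `ℝ × ℝ^N`. -/
def HasTimeDerivative (ρ : ℝ → Density Ω) (ρ₀ : Density Ω)
    (η : ℝ → 𝓓'((⊤ : Opens (EuclideanSpace ℝ (Fin N))), ℝ)) : Prop :=
  ∀ ψ : 𝓓((⊤ : Opens (ℝ × EuclideanSpace ℝ (Fin N))), ℝ),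
    IntegrableOn (fun t => ∫ x in (Ω : Set (EuclideanSpace ℝ (Fin N))),
      (ρ t).toFun x * deriv (fun s => ψ (s, x)) t) (Ioi 0) ∧
    IntegrableOn (fun t => η t (timeSlice ψ t)) (Ioi 0) ∧
    (∫ t in Ioi (0 : ℝ), ∫ x in (Ω : Set (EuclideanSpace ℝ (Fin N))),
      (ρ t).toFun x * deriv (fun s => ψ (s, x)) t) +
      ∫ t in Ioi (0 : ℝ), η t (timeSlice ψ t) =
    -∫ x in (Ω : Set (EuclideanSpace ℝ (Fin N))), ρ₀.toFun x * ψ (0, x)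

/-- Weak solutions of `∂_t ρ = div(ρ |ξ|^{q(x)-2} ξ)`, `ρ(0) = ρ₀`, with no flux through `∂Ω`;
for `ξ = ∇G'(ρ)` this is the parabolic `q(x)`-Laplacian equation. -/
def IsWeakSolution (ρ : ℝ → Density Ω) (ρ₀ : Density Ω)
    (ξ : ℝ → EuclideanSpace ℝ (Fin N) → EuclideanSpace ℝ (Fin N)) : Prop :=
  HasTimeDerivative ρ ρ₀ (fun t => -negDiv (ρ t).measure (qFlux p (ξ t)))

/-- Gradient flows `∂_t ρ = -∇^θ_{F_{p(.)}} E(ρ)`, `ρ(0) = ρ₀`. -/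
def IsGradientFlow (θ : ℝ → ℝ) (E : Density Ω → ℝ) (ρ : ℝ → Density Ω) (ρ₀ : Density Ω) : Prop :=
  ∃ g : (t : ℝ) → TangentSp (ρ t).measure p hp,
    (∀ᵐ t ∂(volume.restrict (Ioi (0 : ℝ))), IsFinslerGradient p hp θ E (ρ t) (g t)) ∧
    HasTimeDerivative ρ ρ₀ (fun t => -(g t).1)

end Gradient

end

/-! ### Reduction to a constant exponent -/

section ConstantExponent

variable {X F : Type*} [MeasurableSpace X] [NormedAddCommGroup F]

/-! The exponent condition is rigid. Since `1/p + 1/q = 1` pointwise, `1/p⁻ + 1/q⁻ ≤ 1` forces `p`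
to equal a constant `P` almost everywhere (`exists_ae_eq_const_of_essInf`). With `Q` conjugate to
`P`, the Luxemburg norms are the `L^P` and `L^Q` norms of the measure `ρ dx`, and `θ(t) = t^(P-1)`
is compatible because `(P-1)Q = P`.

Write `g = G'` and `ξ = ∇g(ρ)`. The candidate differential `-div(ρv) ↦ ∫ ρ ξ·v` must depend only on
`-div(ρv)` and must compute `d/dt E`. Both follow from the integration by parts `∫ g(ρ)σ = ∫ ρ ξ·v`
for `σ = -div(ρv)` (`Density.integral_comp_mul_eq`): `σ = 0` gives well-definedness, and a general
`σ ∈ L¹` gives the derivative through the convexity estimate in `hasDerivWithinAt_energy`. Two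
obstacles arise. Nothing vanishes at the boundary, so the momentum `ρv` is mollified and then
contracted into `Ω` by a dilation, which convexity permits
(`integral_mul_eq_integral_inner_of_div`). Moreover `ξ` is controlled only with weight `ρ`, so
`g(ρ)` is truncated near its lowest value `g(0)`; the truncation is removed because a weak gradient
vanishes a.e. on the lowest level set.

The duality map is determined by convex analysis in `L^P`. For `V = |ξ|^(Q-2) ξ` Hölder's inequality
is an equality, so `V` is an optimal velocity and the form has dual norm `‖V‖^(P-1)`. Equality in
Young's inequality identifies `ν`. Conversely, a form dominated by the norm and touching it at `V`
equals the derivative of `v ↦ ‖v‖^P / P` there, so `J_θ(ν)` has one element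
(`dualityMap_eq_singleton_iff`).

If `ρ` is lower semicontinuous, `{ρ > 0}` is open in `Ω`, and fields whose momentum is smooth with
compact support there are dense. Each such field is, up to scaling, the initial velocity of a
segment of densities, so two differentials agree on a dense set and hence everywhere
(`IsDifferential.unique`). The flow statements apply these facts at almost every time. -/

theorem lintegral_rpow_norm_div_le_one_iff {μ : Measure X} {r : X → ℝ} {P : ℝ} (hP : 0 < P)
    (hr : ∀ᵐ x ∂μ, r x = P) (u : X → F) {c : ℝ} (hc : 0 < c) :
    ∫⁻ x, ENNReal.ofReal ((‖u x‖ / c) ^ r x) ∂μ ≤ 1 ↔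
      eLpNorm u (ENNReal.ofReal P) μ ≤ ENNReal.ofReal c := by
  have hP' : ENNReal.ofReal P ≠ 0 := by simpa using hP
  have h1 : ∫⁻ x, ENNReal.ofReal ((‖u x‖ / c) ^ r x) ∂μ =
      (∫⁻ x, ‖u x‖ₑ ^ P ∂μ) / ENNReal.ofReal c ^ P := by
    rw [div_eq_mul_inv, ← lintegral_mul_const' _ _
      (by simp [ENNReal.rpow_eq_zero_iff, hc, hP, hP.not_gt])]
    refine lintegral_congr_ae (hr.mono fun x hx => ?_)
    simp only [hx]
    rw [← ENNReal.ofReal_rpow_of_nonneg (by positivity) hP.le, ENNReal.ofReal_div_of_pos hc,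
      ENNReal.div_rpow_of_nonneg _ _ hP.le, ofReal_norm, div_eq_mul_inv]
  have hcP : ENNReal.ofReal c ^ P ≠ 0 := by simp [ENNReal.rpow_eq_zero_iff, hc, hP.not_gt]
  have hcP' : ENNReal.ofReal c ^ P ≠ ⊤ := by simp [ENNReal.rpow_eq_top_iff, hP.not_gt]
  rw [h1, ENNReal.div_le_iff hcP hcP', one_mul,
    eLpNorm_eq_lintegral_rpow_enorm_toReal hP' ENNReal.ofReal_ne_top,
    ENNReal.toReal_ofReal hP.le, one_div, ENNReal.rpow_inv_le_iff hP]

theorem memVarLp_iff_memLp {μ : Measure X} {r : X → ℝ} {P : ℝ} (hP : 0 < P)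
    (hr : ∀ᵐ x ∂μ, r x = P) (u : X → F) :
    MemVarLp μ r u ↔ MemLp u (ENNReal.ofReal P) μ := by
  refine and_congr_right fun _ => ⟨?_, fun h => ?_⟩
  · rintro ⟨c, hc, h⟩
    exact ((lintegral_rpow_norm_div_le_one_iff hP hr u hc).1 h).trans_lt ENNReal.ofReal_lt_top
  -- The `+ 1` keeps the scale positive when the norm is zero.
  · refine ⟨(eLpNorm u (ENNReal.ofReal P) μ).toReal + 1, by positivity,
      (lintegral_rpow_norm_div_le_one_iff hP hr u (by positivity)).2 ?_⟩
    calc eLpNorm u (ENNReal.ofReal P) μ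
        = ENNReal.ofReal (eLpNorm u (ENNReal.ofReal P) μ).toReal := (ENNReal.ofReal_toReal h.ne).symm
      _ ≤ _ := ENNReal.ofReal_le_ofReal (by linarith)

theorem varNorm_eq_toReal_eLpNorm {μ : Measure X} {r : X → ℝ} {P : ℝ} (hP : 0 < P)
    (hr : ∀ᵐ x ∂μ, r x = P) {u : X → F} (hu : MemLp u (ENNReal.ofReal P) μ) :
    varNorm μ r u = (eLpNorm u (ENNReal.ofReal P) μ).toReal := by
  set A := (eLpNorm u (ENNReal.ofReal P) μ).toReal with hA
  have hset : {c : ℝ | 0 < c ∧ ∫⁻ x, ENNReal.ofReal ((‖u x‖ / c) ^ r x) ∂μ ≤ 1} =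
      {c : ℝ | 0 < c ∧ A ≤ c} := by
    ext c
    refine and_congr_right fun hc => ?_
    rw [lintegral_rpow_norm_div_le_one_iff hP hr u hc,
      ENNReal.le_ofReal_iff_toReal_le hu.2.ne hc.le]
  have hA0 : 0 ≤ A := ENNReal.toReal_nonneg
  rw [varNorm, hset]
  -- `A` may be zero and is then not an admissible scale, so the infimum is approached through `A +
  -- ε`.
  refine le_antisymm (le_of_forall_pos_le_add fun ε hε => ?_) ?_
  · exact csInf_le ⟨0, fun c hc => hc.1.le⟩ ⟨by positivity, by linarith⟩
  · exact le_csInf ⟨A + 1, by positivity, by linarith⟩ fun c hc => hc.2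

theorem eLpNorm_toReal_rpow_eq_integral {μ : Measure X} {P : ℝ} (hP : 0 < P) {u : X → F}
    (hu : MemLp u (ENNReal.ofReal P) μ) :
    (eLpNorm u (ENNReal.ofReal P) μ).toReal ^ P = ∫ x, ‖u x‖ ^ P ∂μ := by
  have hP' : ENNReal.ofReal P ≠ 0 := by simpa using hP
  have h0 : 0 ≤ ∫ x, ‖u x‖ ^ P ∂μ := integral_nonneg fun x => by positivity
  rw [MemLp.eLpNorm_eq_integral_rpow_norm hP' ENNReal.ofReal_ne_top hu,
    ENNReal.toReal_ofReal hP.le, ENNReal.toReal_ofReal (by positivity),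
    ← Real.rpow_mul h0, inv_mul_cancel₀ hP.ne', Real.rpow_one]

theorem integrable_norm_rpow_ofReal {μ : Measure X} {P : ℝ} (hP : 0 < P) {u : X → F}
    (hu : MemLp u (ENNReal.ofReal P) μ) : Integrable (fun x => ‖u x‖ ^ P) μ := by
  have := hu.integrable_norm_rpow (by simpa using hP) ENNReal.ofReal_ne_top
  rwa [ENNReal.toReal_ofReal hP.le] at this

theorem memLp_ofReal_iff_integrable {μ : Measure X} {P : ℝ} (hP : 0 < P) {u : X → F}
    (hu : AEStronglyMeasurable u μ) :
    MemLp u (ENNReal.ofReal P) μ ↔ Integrable (fun x => ‖u x‖ ^ P) μ := by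
  rw [← integrable_norm_rpow_iff hu (by simpa using hP) ENNReal.ofReal_ne_top,
    ENNReal.toReal_ofReal hP.le]

theorem conjExp_ae_eq {μ : Measure X} {p : X → Ioi (1 : ℝ)} {P Q : ℝ} (hPQ : P.HolderConjugate Q)
    (hp : ∀ᵐ x ∂μ, (p x : ℝ) = P) : ∀ᵐ x ∂μ, conjExp p x = Q :=
  hp.mono fun x hx => by rw [conjExp, hx, hPQ.conjugate_eq]

/-- The norm of `|V|^{P-1}` in the dual space. -/
theorem varNorm_conjExp_rpow {μ : Measure X} {p : X → Ioi (1 : ℝ)} {P Q : ℝ}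
    (hPQ : P.HolderConjugate Q) (hp : ∀ᵐ x ∂μ, (p x : ℝ) = P) {V : X → F}
    (hV : MemLp V (ENNReal.ofReal P) μ) :
    varNorm μ (conjExp p) (fun x => ‖V x‖ ^ ((p x : ℝ) - 1)) =
      (eLpNorm V (ENNReal.ofReal P) μ).toReal ^ (P - 1) := by
  have hP := hPQ.pos
  have hQ := hPQ.symm.pos
  have hpow : ∀ x, ‖‖V x‖ ^ (P - 1)‖ ^ Q = ‖V x‖ ^ P := fun x => by
    rw [Real.norm_of_nonneg (by positivity), ← Real.rpow_mul (norm_nonneg _),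
      hPQ.sub_one_mul_conj]
  have hmeas : AEStronglyMeasurable (fun x => ‖V x‖ ^ (P - 1)) μ :=
    (hV.1.norm.aemeasurable.pow_const _).aestronglyMeasurable
  have hmem : MemLp (fun x => ‖V x‖ ^ (P - 1)) (ENNReal.ofReal Q) μ := by
    rw [memLp_ofReal_iff_integrable hQ hmeas]
    simpa only [hpow] using integrable_norm_rpow_ofReal hP hV
  have hae : (fun x => ‖V x‖ ^ ((p x : ℝ) - 1)) =ᵐ[μ] fun x => ‖V x‖ ^ (P - 1) :=
    hp.mono fun x hx => by simp only [hx]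
  rw [varNorm_eq_toReal_eLpNorm hQ (conjExp_ae_eq hPQ hp) (hmem.ae_eq hae.symm),
    eLpNorm_congr_ae hae]
  -- After raising to the power `Q` both sides are `∫ ‖V‖^P`, as `(P-1)Q = P`.
  refine Real.rpow_left_injOn hQ.ne' (by simp) (by simp; positivity) ?_
  simp only
  rw [eLpNorm_toReal_rpow_eq_integral hQ hmem, ← Real.rpow_mul ENNReal.toReal_nonneg,
    hPQ.sub_one_mul_conj, eLpNorm_toReal_rpow_eq_integral hP hV]
  simp only [hpow]

/-- From `1/q ≤ 1/q⁻ ≤ 1 - 1/p⁻` and `1/p + 1/q = 1` one gets `1/p ≥ 1/p⁻`, that is `p ≤ p⁻` almost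
everywhere; the opposite inequality is the definition of `p⁻`. -/
theorem exists_ae_eq_const_of_essInf {ν : Measure X} {p : X → Ioi (1 : ℝ)}
    (hp_lower : 1 < essInf (fun x => (p x : ℝ)) ν)
    (hpq : 1 / essInf (fun x => (p x : ℝ)) ν + 1 / essInf (conjExp p) ν ≤ 1) :
    ∃ P : ℝ, 1 < P ∧ ∀ᵐ x ∂ν, (p x : ℝ) = P := by
  -- For the zero measure every real is an essential lower bound, and the supremum of that unbounded
  -- set is `0` by convention, contradicting `hp_lower`.
  have hν : ν ≠ 0 := by
    rintro rfl
    have : essInf (fun x => (p x : ℝ)) (0 : Measure X) = 0 := by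
      simp [essInf, liminf_eq]
    linarith
  have : NeZero ν := ⟨hν⟩
  set a := essInf (fun x => (p x : ℝ)) ν
  set b := essInf (conjExp p) ν
  have hp1 : ∀ x, (1 : ℝ) < p x := fun x => (p x).2
  have hq1 : ∀ x, 1 ≤ conjExp p x := fun x => by
    rw [conjExp, le_div_iff₀ (by linarith [hp1 x])]; linarith
  have hbp : IsBoundedUnder (· ≥ ·) (ae ν) fun x => (p x : ℝ) :=
    isBoundedUnder_of ⟨1, fun x => (hp1 x).le⟩
  have hbq : IsBoundedUnder (· ≥ ·) (ae ν) (conjExp p) := isBoundedUnder_of ⟨1, hq1⟩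
  have ha : ∀ᵐ x ∂ν, a ≤ p x := ae_essInf_le hbp
  have hb : ∀ᵐ x ∂ν, b ≤ conjExp p x := ae_essInf_le hbq
  have hqa : ∀ᵐ x ∂ν, conjExp p x ≤ a / (a - 1) := ha.mono fun x hx => by
    rw [conjExp, div_le_div_iff₀ (by linarith [hp1 x]) (by linarith)]
    nlinarith
  -- A real `liminf` dominates its lower bounds only when it is not a default value; the upper bound
  -- `hqa` excludes that.
  have hb1 : 1 ≤ b := by
    refine le_liminf_of_le ?_ (Eventually.of_forall hq1)
    exact IsBoundedUnder.isCoboundedUnder_ge ⟨a / (a - 1), hqa⟩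
  refine ⟨a, hp_lower, ?_⟩
  filter_upwards [ha, hb] with x hxa hxb
  have h1 : 1 / (p x : ℝ) + 1 / conjExp p x = 1 := by
    have := hp1 x
    rw [conjExp]
    field_simp
    ring
  have h2 : 1 / conjExp p x ≤ 1 / b := one_div_le_one_div_of_le (by linarith) hxb
  have h3 : 1 / a ≤ 1 / (p x : ℝ) := by linarith
  exact le_antisymm ((one_div_le_one_div (by linarith) (by linarith [hp1 x])).1 h3) hxa

end ConstantExponent

/-! ### Dilations and mollifications in `L^p` -/

section Approximation

open scoped Convolution ENNReal

variable {E F : Type*} [NormedAddCommGroup E] [NormedSpace ℝ E] [FiniteDimensional ℝ E]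
  [MeasurableSpace E] [BorelSpace E] {μ : Measure E} [μ.IsAddHaarMeasure]
  [NormedAddCommGroup F]

theorem eLpNorm_comp_smul_add {a : ℝ} (ha : a ≠ 0) (b : E) {f : E → F} {p : ℝ≥0∞}
    (hf : AEStronglyMeasurable f μ) :
    AEStronglyMeasurable (fun x => f (a • x + b)) μ ∧
      (p ≠ ⊤ → eLpNorm (fun x => f (a • x + b)) p μ =
        ENNReal.ofReal |(a ^ Module.finrank ℝ E)⁻¹| ^ (1 / p).toReal • eLpNorm f p μ) := by
  have hT : Measurable fun x : E => a • x + b := by fun_prop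
  have hmap : μ.map (fun x : E => a • x + b) =
      ENNReal.ofReal |(a ^ Module.finrank ℝ E)⁻¹| • μ := by
    have h : (fun x : E => a • x + b) = (fun x => x + b) ∘ fun x => a • x := rfl
    rw [h, ← Measure.map_map (by fun_prop) (by fun_prop), Measure.map_addHaar_smul μ ha,
      Measure.map_smul, map_add_right_eq_self]
  have hf' : AEStronglyMeasurable f (μ.map fun x : E => a • x + b) := by
    rw [hmap]; exact hf.smul_measure _
  refine ⟨hf'.comp_measurable hT, fun hp => ?_⟩
  rw [← eLpNorm_smul_measure_of_ne_top hp, ← hmap, eLpNorm_map_measure hf' hT.aemeasurable]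
  rfl

theorem exists_eventually_eLpNorm_comp_smul_add_le (μ : Measure E) [μ.IsAddHaarMeasure]
    {p : ℝ≥0∞} (hp : p ≠ ⊤) :
    ∃ C : ℝ≥0∞, C ≠ ⊤ ∧ ∀ᶠ q : ℝ × E in 𝓝 (1, 0), ∀ f : E → F, AEStronglyMeasurable f μ →
      eLpNorm (fun x => f (q.1 • x + q.2)) p μ ≤ C * eLpNorm f p μ := by
  -- For a dilation factor above `1/2` the Jacobian factor of the change of variables is at most
  -- `2^d`.
  refine ⟨ENNReal.ofReal (2 ^ Module.finrank ℝ E) ^ (1 / p.toReal), ?_, ?_⟩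
  · exact ENNReal.rpow_ne_top_of_nonneg (by positivity) ENNReal.ofReal_ne_top
  have h : ∀ᶠ q : ℝ × E in 𝓝 (1, 0), (1 / 2 : ℝ) < q.1 :=
    continuous_fst.continuousAt.eventually (lt_mem_nhds (by norm_num))
  filter_upwards [h] with q hq f hf
  rw [(eLpNorm_comp_smul_add (a := q.1) (ne_of_gt (by linarith)) q.2 hf).2 hp, smul_eq_mul,
    ENNReal.toReal_div, ENNReal.toReal_one]
  gcongr
  have hq0 : 0 < q.1 := by linarith
  rw [abs_of_nonneg (by positivity), ← inv_pow]
  gcongr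
  rw [inv_le_comm₀ hq0 (by norm_num)]
  linarith

theorem tendsto_eLpNorm_comp_smul_add_sub_of_continuous {p : ℝ≥0∞} (hp1 : 1 ≤ p) (hp : p ≠ ⊤)
    {g : E → F} (hg : Continuous g) (hgc : HasCompactSupport g) :
    Tendsto (fun q : ℝ × E => eLpNorm (fun x => g (q.1 • x + q.2) - g x) p μ)
      (𝓝 (1, 0)) (𝓝 0) := by
  have hp0 : p ≠ 0 := (lt_of_lt_of_le one_pos hp1).ne'
  have hpr : 0 < p.toReal := ENNReal.toReal_pos hp0 hp
  obtain ⟨R, hR0, hR⟩ : ∃ R : ℝ, 0 < R ∧ ∀ x, R ≤ ‖x‖ → g x = 0 :=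
    hgc.exists_pos_le_norm
  obtain ⟨K, hK⟩ := hg.bounded_above_of_compact_support hgc
  have key : Tendsto (fun q : ℝ × E => ∫⁻ x, ‖g (q.1 • x + q.2) - g x‖ₑ ^ p.toReal ∂μ)
      (𝓝 (1, 0)) (𝓝 (∫⁻ _ : E, 0 ∂μ)) := by
    -- If `a > 1/2`, `‖b‖ < 1` and `‖x‖ > 2(R+1)`, then `‖a x + b‖ > R`, so both `g` terms vanish
    -- outside one fixed ball; inside it `2K` is a bound.
    refine tendsto_lintegral_filter_of_dominated_convergence
      ((Metric.closedBall (0 : E) (2 * (R + 1))).indicator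
        fun _ => ENNReal.ofReal (2 * K) ^ p.toReal) ?_ ?_ ?_ ?_
    · filter_upwards with q
      have : Continuous fun x => g (q.1 • x + q.2) - g x := by fun_prop
      exact (this.enorm.measurable.pow_const _)
    · have h : ∀ᶠ q : ℝ × E in 𝓝 (1, 0), (1 / 2 : ℝ) < q.1 :=
        continuous_fst.continuousAt.eventually (lt_mem_nhds (by norm_num))
      have h' : ∀ᶠ q : ℝ × E in 𝓝 (1, 0), ‖q.2‖ < 1 :=
        continuous_snd.norm.continuousAt.eventually (gt_mem_nhds (by simp))
      filter_upwards [h, h'] with q hq hq'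
      refine Eventually.of_forall fun x => ?_
      by_cases hx : x ∈ Metric.closedBall (0 : E) (2 * (R + 1))
      · rw [indicator_of_mem hx]
        gcongr
        rw [← ofReal_norm]
        refine ENNReal.ofReal_le_ofReal ((norm_sub_le _ _).trans ?_)
        linarith [hK (q.1 • x + q.2), hK x]
      · rw [Metric.mem_closedBall, dist_zero_right, not_le] at hx
        rw [hR x (by linarith), hR (q.1 • x + q.2) ?_]
        · simp [hpr]
        · have h1 : ‖q.1 • x‖ - ‖q.2‖ ≤ ‖q.1 • x + q.2‖ := by
            simpa using norm_sub_norm_le (q.1 • x) (-q.2)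
          rw [norm_smul, Real.norm_of_nonneg (by linarith)] at h1
          nlinarith
    · rw [lintegral_indicator Metric.isClosed_closedBall.measurableSet, setLIntegral_const]
      exact ENNReal.mul_ne_top (ENNReal.rpow_ne_top_of_nonneg hpr.le ENNReal.ofReal_ne_top)
        (isCompact_closedBall _ _).measure_lt_top.ne
    · refine Eventually.of_forall fun x => ?_
      have hc : Continuous fun q : ℝ × E => ‖g (q.1 • x + q.2) - g x‖ₑ ^ p.toReal :=
        (ENNReal.continuous_rpow_const).comp (by fun_prop)
      have := hc.tendsto (1, 0)
      simpa [hpr] using this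
  rw [lintegral_zero] at key
  have := (ENNReal.continuous_rpow_const (y := 1 / p.toReal)).tendsto 0 |>.comp key
  rw [ENNReal.zero_rpow_of_pos (by positivity)] at this
  refine this.congr fun q => ?_
  rw [eLpNorm_eq_lintegral_rpow_enorm_toReal hp0 hp]
  rfl

/-- Composition with affine maps close to the identity is continuous in `L^p`. -/
theorem tendsto_eLpNorm_comp_smul_add_sub [NormedSpace ℝ F] {p : ℝ≥0∞} (hp1 : 1 ≤ p) (hp : p ≠ ⊤)
    {f : E → F} (hf : MemLp f p μ) :
    Tendsto (fun q : ℝ × E => eLpNorm (fun x => f (q.1 • x + q.2) - f x) p μ)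
      (𝓝 (1, 0)) (𝓝 0) := by
  obtain ⟨C, hC, hCq⟩ := exists_eventually_eLpNorm_comp_smul_add_le (F := F) μ hp
  rw [ENNReal.tendsto_nhds_zero]
  intro ε hε
  -- The three terms account for `f - g` after composition, the displacement of `g`, and `f - g`
  -- itself.
  obtain ⟨δ, hδ, hδε⟩ : ∃ δ : ℝ≥0∞, 0 < δ ∧ C * δ + δ + δ ≤ ε := by
    have hcont : Tendsto (fun δ : ℝ≥0∞ => C * δ + δ + δ) (𝓝[>] 0) (𝓝 (C * 0 + 0 + 0)) := by
      refine Tendsto.mono_left ?_ nhdsWithin_le_nhds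
      exact ((ENNReal.Tendsto.const_mul tendsto_id (Or.inr hC)).add tendsto_id).add tendsto_id
    simp only [mul_zero, add_zero] at hcont
    have h1 := (hcont.eventually (gt_mem_nhds hε)).and self_mem_nhdsWithin
    obtain ⟨δ, h1, h2⟩ := h1.exists
    exact ⟨δ, h2, h1.le⟩
  obtain ⟨g, hgc, hfg, hg, hgm⟩ := hf.exists_hasCompactSupport_eLpNorm_sub_le hp hδ.ne'
  have h := ENNReal.tendsto_nhds_zero.1
    (tendsto_eLpNorm_comp_smul_add_sub_of_continuous (μ := μ) hp1 hp hg hgc) δ hδ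
  have ha : ∀ᶠ q : ℝ × E in 𝓝 (1, 0), (1 / 2 : ℝ) < q.1 :=
    continuous_fst.continuousAt.eventually (lt_mem_nhds (by norm_num))
  filter_upwards [h, hCq, ha] with q h1 h2 h3
  have hm : AEStronglyMeasurable (f - g) μ := hf.1.sub hgm.1
  have hm1 : AEStronglyMeasurable (fun x => (f - g) (q.1 • x + q.2)) μ :=
    (eLpNorm_comp_smul_add (p := p) (a := q.1) (ne_of_gt (by linarith)) q.2 hm).1
  have hm2 : AEStronglyMeasurable (fun x => g (q.1 • x + q.2) - g x) μ := by
    have : Continuous fun x => g (q.1 • x + q.2) - g x := by fun_prop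
    exact this.aestronglyMeasurable
  have heq : (fun x => f (q.1 • x + q.2) - f x) =
      ((fun x => (f - g) (q.1 • x + q.2)) + fun x => g (q.1 • x + q.2) - g x) - (f - g) := by
    ext x; simp
  rw [heq]
  refine (eLpNorm_sub_le (hm1.add hm2) hm hp1).trans ?_
  refine le_trans ?_ hδε
  gcongr
  refine (eLpNorm_add_le hm1 hm2 hp1).trans ?_
  gcongr
  exact (h2 _ hm).trans (by gcongr)

/-- The normalized bump is a probability density, so the left side is the norm of an average of the
differences `f(a x + b - t) - f(x)`. Jensen's inequality in `t` followed by Tonelli reduces it to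
the uniform bound over the support of the bump. -/
theorem eLpNorm_integral_smul_sub_le [NormedSpace ℝ F] [CompleteSpace F] {p : ℝ≥0∞} (hp1 : 1 ≤ p)
    (hp : p ≠ ⊤) (φ : ContDiffBump (0 : E)) {f : E → F} (hfs : StronglyMeasurable f)
    (hf : MemLp f p μ) (a : ℝ) (b : E) {δ : ℝ≥0∞}
    (hδ : ∀ t ∈ Metric.ball (0 : E) φ.rOut,
      eLpNorm (fun x => f (a • x + (b - t)) - f x) p μ ≤ δ) :
    eLpNorm (fun x => (φ.normed μ ⋆[ContinuousLinearMap.lsmul ℝ ℝ, μ] f) (a • x + b) - f x) p μ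
      ≤ δ := by
  have hp0 : p ≠ 0 := (lt_of_lt_of_le one_pos hp1).ne'
  have hpr : 0 < p.toReal := ENNReal.toReal_pos hp0 hp
  set ν : Measure E := μ.withDensity fun t => ENNReal.ofReal (φ.normed μ t)
  have hφm : Measurable fun t => ENNReal.ofReal (φ.normed μ t) :=
    φ.continuous_normed.measurable.ennreal_ofReal
  have hν : IsProbabilityMeasure ν := ⟨by
    rw [withDensity_apply _ MeasurableSet.univ, Measure.restrict_univ,
      ← ofReal_integral_eq_lintegral_ofReal φ.integrable_normed
        (Eventually.of_forall φ.nonneg_normed), φ.integral_normed, ENNReal.ofReal_one]⟩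
  have hloc : LocallyIntegrable f μ := hf.locallyIntegrable hp1
  have hmeas : ∀ x, StronglyMeasurable fun t => f (a • x + (b - t)) - f x := fun x =>
    (hfs.comp_measurable (by fun_prop)).sub stronglyMeasurable_const
  have hpt : ∀ x, ‖(φ.normed μ ⋆[ContinuousLinearMap.lsmul ℝ ℝ, μ] f) (a • x + b) - f x‖ₑ ^ p.toReal
      ≤ ∫⁻ t, ‖f (a • x + (b - t)) - f x‖ₑ ^ p.toReal ∂ν := by
    intro x
    have h1 : (φ.normed μ ⋆[ContinuousLinearMap.lsmul ℝ ℝ, μ] f) (a • x + b) - f x =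
        ∫ t, φ.normed μ t • (f (a • x + (b - t)) - f x) ∂μ := by
      have hi : Integrable (fun t => φ.normed μ t • f (a • x + b - t)) μ :=
        φ.hasCompactSupport_normed.convolutionExists_left (ContinuousLinearMap.lsmul ℝ ℝ)
          φ.continuous_normed hloc (a • x + b)
      have hi' : Integrable (fun t => φ.normed μ t • f x) μ := φ.integrable_normed.smul_const _
      simp only [smul_sub, ← add_sub_assoc]
      rw [integral_sub hi hi', integral_smul_const, φ.integral_normed, one_smul]
      rfl
    have h2 : ‖(φ.normed μ ⋆[ContinuousLinearMap.lsmul ℝ ℝ, μ] f) (a • x + b) - f x‖ₑ ≤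
        eLpNorm (fun t => f (a • x + (b - t)) - f x) 1 ν := by
      rw [h1, eLpNorm_one_eq_lintegral_enorm, lintegral_withDensity_eq_lintegral_mul _ hφm
        (hmeas x).enorm]
      refine (enorm_integral_le_lintegral_enorm _).trans (le_of_eq (lintegral_congr fun t => ?_))
      rw [enorm_smul, Real.enorm_of_nonneg (φ.nonneg_normed t)]
      rfl
    have h3 := eLpNorm_le_eLpNorm_of_exponent_le (μ := ν) hp1 (hmeas x).aestronglyMeasurable
    have h4 := ENNReal.rpow_le_rpow (h2.trans h3) hpr.le
    rwa [eLpNorm_eq_lintegral_rpow_enorm_toReal hp0 hp, ← ENNReal.rpow_mul,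
      one_div_mul_cancel hpr.ne', ENNReal.rpow_one] at h4
  have hswap : Measurable (Function.uncurry fun x t : E =>
      ‖f (a • x + (b - t)) - f x‖ₑ ^ p.toReal) := by
    have : StronglyMeasurable fun z : E × E => f (a • z.1 + (b - z.2)) - f z.1 :=
      (hfs.comp_measurable (by fun_prop)).sub (hfs.comp_measurable measurable_fst)
    exact this.enorm.pow_const _
  rw [eLpNorm_eq_lintegral_rpow_enorm_toReal hp0 hp, one_div, ENNReal.rpow_inv_le_iff hpr]
  calc ∫⁻ x, ‖(φ.normed μ ⋆[ContinuousLinearMap.lsmul ℝ ℝ, μ] f) (a • x + b) - f x‖ₑ ^ p.toReal ∂μ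
      ≤ ∫⁻ x, ∫⁻ t, ‖f (a • x + (b - t)) - f x‖ₑ ^ p.toReal ∂ν ∂μ := lintegral_mono hpt
    _ = ∫⁻ t, ∫⁻ x, ‖f (a • x + (b - t)) - f x‖ₑ ^ p.toReal ∂μ ∂ν :=
        lintegral_lintegral_swap hswap.aemeasurable
    _ = ∫⁻ t, ENNReal.ofReal (φ.normed μ t) *
          ∫⁻ x, ‖f (a • x + (b - t)) - f x‖ₑ ^ p.toReal ∂μ ∂μ :=
        lintegral_withDensity_eq_lintegral_mul _ hφm hswap.lintegral_prod_left'
    _ ≤ ∫⁻ t, ENNReal.ofReal (φ.normed μ t) * δ ^ p.toReal ∂μ := by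
        refine lintegral_mono fun t => ?_
        by_cases ht : t ∈ Metric.ball (0 : E) φ.rOut
        · gcongr
          have := hδ t ht
          rwa [eLpNorm_eq_lintegral_rpow_enorm_toReal hp0 hp, one_div,
            ENNReal.rpow_inv_le_iff hpr] at this
        · have : φ.normed μ t = 0 := by
            rw [← φ.support_normed_eq (μ := μ)] at ht
            exact Function.notMem_support.1 ht
          simp [this]
    _ = δ ^ p.toReal := by
        rw [lintegral_mul_const _ hφm]
        have : ∫⁻ t, ENNReal.ofReal (φ.normed μ t) ∂μ = 1 := by
          rw [← hν.measure_univ, withDensity_apply _ MeasurableSet.univ, Measure.restrict_univ]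
        rw [this, one_mul]

/-- Mollification composed with affine maps close to the identity converges in `L^p`. -/
theorem tendsto_eLpNorm_convolution_comp_sub [NormedSpace ℝ F] [CompleteSpace F] {ι : Type*}
    {l : Filter ι} {p : ℝ≥0∞} (hp1 : 1 ≤ p) (hp : p ≠ ⊤) {φ : ι → ContDiffBump (0 : E)}
    (hφ : Tendsto (fun i => (φ i).rOut) l (𝓝 0)) {a : ι → ℝ} (ha : Tendsto a l (𝓝 1))
    {b : ι → E} (hb : Tendsto b l (𝓝 0)) {f : E → F} (hf : MemLp f p μ) :
    Tendsto (fun i => eLpNorm (fun x =>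
      ((φ i).normed μ ⋆[ContinuousLinearMap.lsmul ℝ ℝ, μ] f) (a i • x + b i) - f x) p μ)
      l (𝓝 0) := by
  -- A strongly measurable representative makes `(x, t) ↦ f(a x + b - t)` jointly measurable, as
  -- Tonelli requires.
  wlog hfs : StronglyMeasurable f generalizing f
  · refine (this (f := hf.1.mk f) (hf.ae_eq hf.1.ae_eq_mk) hf.1.stronglyMeasurable_mk).congr
      fun i => eLpNorm_congr_ae (hf.1.ae_eq_mk.mono fun x hx => ?_)
    simp only [convolution_congr (ContinuousLinearMap.lsmul ℝ ℝ)
      (ae_eq_refl ((φ i).normed μ)) hf.1.ae_eq_mk, hx]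
  rw [ENNReal.tendsto_nhds_zero]
  intro ε hε
  have h := ENNReal.tendsto_nhds_zero.1
    (tendsto_eLpNorm_comp_smul_add_sub (μ := μ) hp1 hp hf) ε hε
  rw [Metric.eventually_nhds_iff] at h
  obtain ⟨r, hr, h⟩ := h
  have hr2 : 0 < r / 2 := by positivity
  filter_upwards [Metric.tendsto_nhds.1 hφ _ hr2, Metric.tendsto_nhds.1 ha _ hr2,
    Metric.tendsto_nhds.1 hb _ hr2] with i h1 h2 h3
  refine eLpNorm_integral_smul_sub_le hp1 hp (φ i) hfs hf (a i) (b i) fun t ht => ?_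
  refine @h (a i, b i - t) ?_
  rw [Prod.dist_eq, max_lt_iff]
  refine ⟨h2.trans (by linarith), ?_⟩
  rw [Real.dist_0_eq_abs, abs_of_pos (φ i).rOut_pos] at h1
  rw [mem_ball_zero_iff] at ht
  rw [dist_zero_right] at h3 ⊢
  calc ‖b i - t‖ ≤ ‖b i‖ + ‖t‖ := norm_sub_le _ _
    _ < r := by linarith

end Approximation

/-! ### Mollification and the chain rule for weak gradients -/

section Mollify

open scoped Convolution ENNReal

open scoped Pointwise

variable {N : ℕ}

/-- The mollification of a scalar function by a normalized bump function. -/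
noncomputable def mollify (η : ContDiffBump (0 : EuclideanSpace ℝ (Fin N)))
    (g : EuclideanSpace ℝ (Fin N) → ℝ) : EuclideanSpace ℝ (Fin N) → ℝ :=
  η.normed volume ⋆[ContinuousLinearMap.lsmul ℝ ℝ, volume] g

variable {η : ContDiffBump (0 : EuclideanSpace ℝ (Fin N))} {g : EuclideanSpace ℝ (Fin N) → ℝ}

theorem mollify_apply (x : EuclideanSpace ℝ (Fin N)) :
    mollify η g x = ∫ t, η.normed volume (x - t) * g t :=
  convolution_eq_swap _

theorem contDiff_mollify (hg : LocallyIntegrable g) : ContDiff ℝ ∞ (mollify η g) :=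
  η.hasCompactSupport_normed.contDiff_convolution_left _ η.contDiff_normed hg

theorem support_mollify_subset :
    Function.support (mollify η g) ⊆
      Metric.ball (0 : EuclideanSpace ℝ (Fin N)) η.rOut + Function.support g := by
  have := support_convolution_subset (μ := volume)
    (ContinuousLinearMap.lsmul ℝ ℝ) (f := η.normed volume) (g := g)
  rwa [η.support_normed_eq] at this

theorem abs_mollify_le {B : ℝ} (hg : LocallyIntegrable g) (hB : ∀ x, |g x| ≤ B)
    (x : EuclideanSpace ℝ (Fin N)) : |mollify η g x| ≤ B := by
  have h1 : mollify η g x = ∫ t, η.normed volume t * g (x - t) := rfl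
  have hi : Integrable (fun t => η.normed volume t * g (x - t)) :=
    η.hasCompactSupport_normed.convolutionExists_left (ContinuousLinearMap.lsmul ℝ ℝ)
      η.continuous_normed hg x
  calc |mollify η g x| ≤ ∫ t, |η.normed volume t * g (x - t)| := by
        rw [h1]; exact abs_integral_le_integral_abs
    _ ≤ ∫ t, η.normed volume t * B := by
        refine integral_mono hi.abs (η.integrable_normed.mul_const B) fun t => ?_
        simp only [abs_mul, abs_of_nonneg (η.nonneg_normed t)]
        exact mul_le_mul_of_nonneg_left (hB _) (η.nonneg_normed t)
    _ = B := by rw [integral_mul_const, η.integral_normed, one_mul]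

theorem fderiv_reflected_normed (x t e : EuclideanSpace ℝ (Fin N)) :
    fderiv ℝ (fun t => η.normed volume (x - t)) t e = -fderiv ℝ (η.normed volume) (x - t) e := by
  have hd : DifferentiableAt ℝ (η.normed volume) (x - t) :=
    (η.contDiff_normed (n := 1)).differentiable one_ne_zero _
  have h2 : HasFDerivAt (fun t => x - t)
      (-ContinuousLinearMap.id ℝ (EuclideanSpace ℝ (Fin N))) t :=
    (hasFDerivAt_id t).const_sub x
  have h3 := (hd.hasFDerivAt.comp t h2).fderiv
  have h4 : (η.normed volume ∘ fun t => x - t) = fun t => η.normed volume (x - t) := rfl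
  rw [← h4, h3]
  simp

/-- The derivative is put on the reflected kernel as a function of `t`, so that a weak gradient or
divergence identity can be tested against `reflectedBump`. -/
theorem fderiv_mollify_apply (hg : LocallyIntegrable g) (x e : EuclideanSpace ℝ (Fin N)) :
    fderiv ℝ (mollify η g) x e =
      -∫ t, g t * fderiv ℝ (fun t => η.normed volume (x - t)) t e := by
  have h := (η.hasCompactSupport_normed (μ := volume)).hasFDerivAt_convolution_left (μ := volume)
    (ContinuousLinearMap.lsmul ℝ ℝ) (η.contDiff_normed (n := 1)) hg x
  have hi := ((η.hasCompactSupport_normed (μ := volume)).fderiv ℝ).convolutionExists_left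
    (μ := volume)
    ((ContinuousLinearMap.lsmul ℝ ℝ).precompL (EuclideanSpace ℝ (Fin N)))
    ((η.contDiff_normed (μ := volume) (n := 1)).continuous_fderiv one_ne_zero) hg x
  have hi' := hi.integrable_swap
  rw [mollify, h.fderiv, convolution_eq_swap, ContinuousLinearMap.integral_apply hi',
    ← integral_neg]
  refine integral_congr_ae (Eventually.of_forall fun t => ?_)
  simp only [ContinuousLinearMap.precompL_apply, ContinuousLinearMap.lsmul_apply, smul_eq_mul,
    fderiv_reflected_normed]
  ring

theorem hasCompactSupport_reflected_normed (x : EuclideanSpace ℝ (Fin N)) :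
    tsupport (fun t => η.normed volume (x - t)) ⊆ Metric.closedBall x η.rOut := by
  refine closure_minimal (fun t ht => ?_) Metric.isClosed_closedBall
  have : x - t ∈ Function.support (η.normed volume) := ht
  rw [η.support_normed_eq, mem_ball_zero_iff] at this
  rw [Metric.mem_closedBall, dist_eq_norm, norm_sub_rev]
  exact this.le

/-- The test function `t ↦ η(x - t)`. -/
noncomputable def reflectedBump (η : ContDiffBump (0 : EuclideanSpace ℝ (Fin N)))
    (x : EuclideanSpace ℝ (Fin N)) (Ω : Opens (EuclideanSpace ℝ (Fin N)))
    (h : Metric.closedBall x η.rOut ⊆ Ω) : 𝓓(Ω, ℝ) where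
  toFun t := η.normed volume (x - t)
  contDiff' := η.contDiff_normed.comp (contDiff_const.sub contDiff_id)
  hasCompactSupport' := (isCompact_closedBall x η.rOut).of_isClosed_subset (isClosed_tsupport _)
    (hasCompactSupport_reflected_normed x)
  tsupport_subset' := (hasCompactSupport_reflected_normed x).trans h

/-- A sequence of bump functions with prescribed radii. -/
noncomputable def bumpOfRadius (E : Type*) [NormedAddCommGroup E] (r : ℝ) (hr : 0 < r) :
    ContDiffBump (0 : E) := ⟨r / 2, r, by positivity, by linarith⟩

end Mollify

/-! ### Weak gradients under mollification and composition. -/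

section WeakGradient

open scoped Convolution ENNReal

variable {N : ℕ} {Ω : Opens (EuclideanSpace ℝ (Fin N))}

theorem setIntegral_mul_testFunction (φ : 𝓓(Ω, ℝ)) (f : EuclideanSpace ℝ (Fin N) → ℝ) :
    ∫ x in (Ω : Set (EuclideanSpace ℝ (Fin N))), f x * φ x = ∫ x, f x * φ x :=
  setIntegral_eq_integral_of_forall_compl_eq_zero fun x hx => by
    rw [image_eq_zero_of_notMem_tsupport fun h => hx (φ.tsupport_subset h), mul_zero]

theorem setIntegral_mul_fderiv_testFunction (φ : 𝓓(Ω, ℝ)) (f : EuclideanSpace ℝ (Fin N) → ℝ)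
    (e : EuclideanSpace ℝ (Fin N)) :
    ∫ x in (Ω : Set (EuclideanSpace ℝ (Fin N))), f x * fderiv ℝ φ x e =
      ∫ x, f x * fderiv ℝ φ x e :=
  setIntegral_eq_integral_of_forall_compl_eq_zero fun x hx => by
    have : x ∉ tsupport (fderiv ℝ φ) :=
      fun h => hx (φ.tsupport_subset (tsupport_fderiv_subset ℝ h))
    rw [image_eq_zero_of_notMem_tsupport this]
    simp

/-- The weak gradient identity is tested with `t ↦ η(x - t)`. This function is supported in the ball
around `x`, hence in `K`, so cutting `u` and `ξ` off outside `K` changes neither integral. -/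
theorem fderiv_mollify_indicator {u : EuclideanSpace ℝ (Fin N) → ℝ}
    {ξ : EuclideanSpace ℝ (Fin N) → EuclideanSpace ℝ (Fin N)} (h : IsWeakGradient Ω u ξ)
    {K : Set (EuclideanSpace ℝ (Fin N))} (hK : IsCompact K) (hKΩ : K ⊆ Ω)
    {η : ContDiffBump (0 : EuclideanSpace ℝ (Fin N))} {x : EuclideanSpace ℝ (Fin N)}
    (hx : Metric.closedBall x η.rOut ⊆ K) (e : EuclideanSpace ℝ (Fin N)) :
    fderiv ℝ (mollify η (K.indicator u)) x e =
      mollify η (K.indicator fun y => inner ℝ (ξ y) e) x := by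
  have hu : Integrable (K.indicator u) :=
    (integrable_indicator_iff hK.measurableSet).2 (h.1.integrableOn_compact_subset hKΩ hK)
  set φ := reflectedBump η x Ω (hx.trans hKΩ)
  have hφ : (φ : EuclideanSpace ℝ (Fin N) → ℝ) = fun t => η.normed volume (x - t) := rfl
  have hout : ∀ t ∉ K, t ∉ tsupport φ := fun t ht h' =>
    ht (hx (hasCompactSupport_reflected_normed x h'))
  have h1 := h.2.2 φ e
  rw [setIntegral_mul_fderiv_testFunction] at h1
  simp_rw [mul_comm (φ _)] at h1
  rw [setIntegral_mul_testFunction] at h1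
  rw [fderiv_mollify_apply hu.locallyIntegrable, mollify_apply, ← hφ, neg_eq_iff_eq_neg]
  refine Eq.trans (integral_congr_ae (Eventually.of_forall fun t => ?_)) (h1.trans
    (congrArg _ (integral_congr_ae (Eventually.of_forall fun t => ?_))))
  · by_cases ht : t ∈ K
    · simp [ht]
    · have : fderiv ℝ φ t = 0 := image_eq_zero_of_notMem_tsupport
        fun h => hout t ht (tsupport_fderiv_subset ℝ h)
      simp [this]
  · by_cases ht : t ∈ K
    · simp [ht, hφ, mul_comm]
    · have : φ t = 0 := image_eq_zero_of_notMem_tsupport (hout t ht)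
      simp [this, ht]

theorem tendsto_integral_mul_sub_zero {X : Type*} [MeasurableSpace X] {μ : Measure X} {ι : Type*}
    {l : Filter ι} {g : ι → X → ℝ} (hg : Tendsto (fun i => eLpNorm (g i) 1 μ) l (𝓝 0))
    {b : ι → X → ℝ} {C : ℝ} (hb : ∀ᶠ i in l, ∀ x, |b i x| ≤ C) :
    Tendsto (fun i => ∫ x, b i x * g i x ∂μ) l (𝓝 0) := by
  have h1 : Tendsto (fun i => ENNReal.ofReal C * eLpNorm (g i) 1 μ) l (𝓝 0) := by
    simpa using ENNReal.Tendsto.const_mul hg (Or.inr ENNReal.ofReal_ne_top)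
  have h2 : Tendsto (fun i => ‖∫ x, b i x * g i x ∂μ‖ₑ) l (𝓝 0) := by
    refine tendsto_of_tendsto_of_tendsto_of_le_of_le' tendsto_const_nhds h1
      (Eventually.of_forall fun i => zero_le) (hb.mono fun i hi => ?_)
    refine (enorm_integral_le_lintegral_enorm _).trans ?_
    rw [eLpNorm_one_eq_lintegral_enorm, ← lintegral_const_mul' _ _ ENNReal.ofReal_ne_top]
    refine lintegral_mono fun x => ?_
    rw [enorm_mul]
    gcongr
    rw [← ofReal_norm]
    exact ENNReal.ofReal_le_ofReal (hi x)
  rw [tendsto_zero_iff_norm_tendsto_zero]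
  simpa [Function.comp_def] using (ENNReal.tendsto_toReal ENNReal.zero_ne_top).comp h2

theorem IsWeakGradient.locallyIntegrableOn_inner {u : EuclideanSpace ℝ (Fin N) → ℝ}
    {ξ : EuclideanSpace ℝ (Fin N) → EuclideanSpace ℝ (Fin N)} (h : IsWeakGradient Ω u ξ)
    (e : EuclideanSpace ℝ (Fin N)) :
    LocallyIntegrableOn (fun x => inner ℝ (ξ x) e) Ω := by
  intro x hx
  obtain ⟨U, hU, hUi⟩ := h.2.1 x hx
  exact ⟨U, hU, hUi.inner_const e⟩

/-- The chain rule for weak gradients of bounded functions. -/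
theorem IsWeakGradient.comp {u : EuclideanSpace ℝ (Fin N) → ℝ}
    {ξ : EuclideanSpace ℝ (Fin N) → EuclideanSpace ℝ (Fin N)} (hw : IsWeakGradient Ω u ξ)
    {B : ℝ} (hB : ∀ x ∈ Ω, |u x| ≤ B) {H h : ℝ → ℝ} (hH : ∀ s, HasDerivAt H (h s) s)
    (hh : Continuous h) (hh1 : ∀ s, |h s| ≤ 1) :
    IsWeakGradient Ω (fun x => H (u x)) (fun x => h (u x) • ξ x) := by
  have hHc : Continuous H := continuous_iff_continuousAt.2 fun s => (hH s).continuousAt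
  obtain ⟨C, hC⟩ : ∃ C, ∀ s, |s| ≤ |B| → |H s| ≤ C := by
    obtain ⟨C, hC⟩ := (isCompact_Icc (a := -|B|) (b := |B|)).exists_bound_of_continuousOn
      hHc.continuousOn
    exact ⟨C, fun s hs => hC s (abs_le.1 hs)⟩
  have hum := hw.1.aestronglyMeasurable
  have hξm := hw.2.1.aestronglyMeasurable
  refine ⟨?_, ?_, fun φ e => ?_⟩
  · rw [locallyIntegrableOn_iff Ω.isOpen.isLocallyClosed]
    intro K hKΩ hK
    refine IntegrableOn.of_bound hK.measure_lt_top
      (hHc.comp_aestronglyMeasurable (hum.mono_set hKΩ)) C ?_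
    filter_upwards [ae_restrict_mem hK.measurableSet] with x hx
    exact hC _ ((hB x (hKΩ hx)).trans (le_abs_self B))
  · rw [locallyIntegrableOn_iff Ω.isOpen.isLocallyClosed]
    intro K hKΩ hK
    have := hw.2.1.integrableOn_compact_subset hKΩ hK
    refine Integrable.mono this ((hh.comp_aestronglyMeasurable (hum.mono_set hKΩ)).smul this.1)
      (Eventually.of_forall fun x => ?_)
    rw [norm_smul]
    exact mul_le_of_le_one_left (norm_nonneg _) (hh1 _)
  set K₀ := tsupport φ
  have hK₀ : IsCompact K₀ := φ.hasCompactSupport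
  -- Mollification radii stay below `δ`, so at points of the support of `φ` the kernels see only
  -- values in `K ⊆ Ω`.
  obtain ⟨δ, hδ, hδΩ⟩ := hK₀.exists_cthickening_subset_open Ω.isOpen φ.tsupport_subset
  set K := Metric.cthickening δ K₀
  have hK : IsCompact K := hK₀.cthickening
  have hK₀K : K₀ ⊆ K := Metric.self_subset_cthickening _
  set u' := K.indicator u
  set g := K.indicator fun y => inner ℝ (ξ y) e
  have hu' : Integrable u' :=
    (integrable_indicator_iff hK.measurableSet).2 (hw.1.integrableOn_compact_subset hδΩ hK)
  have hg : Integrable g := (integrable_indicator_iff hK.measurableSet).2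
    ((hw.locallyIntegrableOn_inner e).integrableOn_compact_subset hδΩ hK)
  have hu'B : ∀ x, |u' x| ≤ |B| := fun x => by
    by_cases hx : x ∈ K
    · simp only [u', indicator_of_mem hx]
      exact (hB x (hδΩ hx)).trans (le_abs_self B)
    · simp [u', hx]
  let r : ℕ → ℝ := fun k => δ / ((k : ℝ) + 1)
  have hr : ∀ k, 0 < r k := fun k => by positivity
  let η : ℕ → ContDiffBump (0 : EuclideanSpace ℝ (Fin N)) := fun k => bumpOfRadius _ (r k) (hr k)
  have hrδ : ∀ k, r k ≤ δ := fun k => div_le_self hδ.le (by simp)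
  have hr0 : Tendsto (fun k => (η k).rOut) atTop (𝓝 0) := by
    simpa [η, bumpOfRadius, r, div_eq_mul_inv] using
      (tendsto_one_div_add_atTop_nhds_zero_nat (𝕜 := ℝ)).const_mul δ
  set U : ℕ → EuclideanSpace ℝ (Fin N) → ℝ := fun k => mollify (η k) u'
  set D : ℕ → EuclideanSpace ℝ (Fin N) → ℝ := fun k => mollify (η k) g
  have hUc : ∀ k, ContDiff ℝ ∞ (U k) := fun k => contDiff_mollify hu'.locallyIntegrable
  have hDc : ∀ k, Continuous (D k) := fun k => (contDiff_mollify hg.locallyIntegrable).continuous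
  have hUB : ∀ k x, |U k x| ≤ |B| := fun k x => abs_mollify_le hu'.locallyIntegrable hu'B x
  have hUD : ∀ k, ∀ x ∈ K₀, fderiv ℝ (U k) x e = D k x := fun k x hx =>
    fderiv_mollify_indicator hw hK hδΩ
      ((Metric.closedBall_subset_cthickening hx _).trans (Metric.cthickening_mono (hrδ k) _)) e
  -- The outer radius in `bumpOfRadius` is twice the inner one; this bounded ratio gives convergence
  -- almost everywhere.
  have hUlim : ∀ᵐ x, Tendsto (fun k => U k x) atTop (𝓝 (u' x)) :=
    ContDiffBump.ae_convolution_tendsto_right_of_locallyIntegrable (K := 2) hr0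
      (Eventually.of_forall fun k => by simp only [η, bumpOfRadius]; linarith)
      hu'.locallyIntegrable
  have hDlim : Tendsto (fun k => eLpNorm (fun x => D k x - g x) 1 volume) atTop (𝓝 0) := by
    have := tendsto_eLpNorm_convolution_comp_sub (μ := volume) le_rfl ENNReal.one_ne_top hr0
      (tendsto_const_nhds (x := (1 : ℝ)))
      (tendsto_const_nhds (x := (0 : EuclideanSpace ℝ (Fin N)))) (memLp_one_iff_integrable.2 hg)
    simp only [one_smul, add_zero] at this
    exact this
  have hφc := φ.continuous
  have hφs := φ.hasCompactSupport
  have hdφc : Continuous fun x => fderiv ℝ φ x e :=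
    (φ.contDiff.continuous_fderiv (by simp)).clm_apply continuous_const
  have hdφs : HasCompactSupport fun x => fderiv ℝ φ x e := hφs.fderiv_apply ℝ e
  obtain ⟨Cφ, hCφ⟩ := hφc.bounded_above_of_compact_support hφs
  have hHd : Differentiable ℝ H := fun s => (hH s).differentiableAt
  have hchain : ∀ k x, fderiv ℝ (fun x => H (U k x)) x e = h (U k x) * fderiv ℝ (U k) x e := by
    intro k x
    have h1 := (hH (U k x)).comp_hasFDerivAt x
      ((hUc k).differentiable (by simp) x).hasFDerivAt
    have h2 : (H ∘ U k) = fun x => H (U k x) := rfl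
    rw [← h2, h1.fderiv]
    simp
  -- For the smooth `U k` the classical chain rule applies. Its derivative is known to be `D k` only
  -- on the support of `φ`, which suffices because it is multiplied by `φ`.
  have hparts : ∀ k, ∫ x, H (U k x) * fderiv ℝ φ x e = -∫ x, h (U k x) * φ x * D k x := by
    intro k
    have hcU := (hUc k).continuous
    have hcdU : Continuous fun x => fderiv ℝ (U k) x e :=
      ((hUc k).continuous_fderiv (by simp)).clm_apply continuous_const
    rw [integral_mul_fderiv_eq_neg_fderiv_mul_of_integrable]
    · refine congrArg _ (integral_congr_ae (Eventually.of_forall fun x => ?_))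
      simp only [hchain]
      by_cases hx : x ∈ K₀
      · rw [hUD k x hx]; ring
      · rw [image_eq_zero_of_notMem_tsupport hx]; ring
    · simp only [hchain]
      exact Continuous.integrable_of_hasCompactSupport (by fun_prop) hφs.mul_left
    · exact Continuous.integrable_of_hasCompactSupport (by fun_prop) hdφs.mul_left
    · exact Continuous.integrable_of_hasCompactSupport (by fun_prop) hφs.mul_left
    · exact fun x _ => (hHd _).comp x ((hUc k).differentiable (by simp) x)
    · exact fun x _ => φ.contDiff.differentiable (by simp) x
  have hleft : Tendsto (fun k => ∫ x, H (U k x) * fderiv ℝ φ x e) atTop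
      (𝓝 (∫ x, H (u' x) * fderiv ℝ φ x e)) := by
    refine tendsto_integral_of_dominated_convergence (fun x => C * |fderiv ℝ φ x e|) ?_ ?_ ?_ ?_
    · exact fun k => ((hHc.comp (hUc k).continuous).mul hdφc).aestronglyMeasurable
    · exact ((hdφc.integrable_of_hasCompactSupport hdφs).abs).const_mul C
    · refine fun k => Eventually.of_forall fun x => ?_
      rw [norm_mul]
      exact mul_le_mul_of_nonneg_right (hC _ (hUB k x)) (abs_nonneg _)
    · filter_upwards [hUlim] with x hx
      exact ((hHc.tendsto _).comp hx).mul_const _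
  -- The factor `h (U k)` converges almost everywhere while `D k` converges in `L¹`. The product is
  -- therefore handled as dominated convergence against the fixed `g`, plus an error with bounded
  -- coefficient.
  have hright1 : Tendsto (fun k => ∫ x, h (U k x) * φ x * g x) atTop
      (𝓝 (∫ x, h (u' x) * φ x * g x)) := by
    refine tendsto_integral_of_dominated_convergence (fun x => Cφ * |g x|) ?_ ?_ ?_ ?_
    · exact fun k => ((hh.comp (hUc k).continuous).mul hφc).aestronglyMeasurable.mul hg.1
    · exact hg.abs.const_mul Cφ
    · refine fun k => Eventually.of_forall fun x => ?_
      rw [norm_mul, norm_mul]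
      refine mul_le_mul_of_nonneg_right ?_ (abs_nonneg _)
      exact (mul_le_of_le_one_left (norm_nonneg _) (hh1 _)).trans (hCφ x)
    · filter_upwards [hUlim] with x hx
      exact (((hh.tendsto _).comp hx).mul_const _).mul_const _
  have hbd : ∀ k x, |h (U k x) * φ x| ≤ Cφ := fun k x => by
    rw [abs_mul]
    exact (mul_le_of_le_one_left (abs_nonneg _) (hh1 _)).trans (hCφ x)
  have hright2 := tendsto_integral_mul_sub_zero hDlim
    (b := fun k x => h (U k x) * φ x) (Eventually.of_forall hbd)
  have hright : Tendsto (fun k => ∫ x, h (U k x) * φ x * D k x) atTop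
      (𝓝 (∫ x, h (u' x) * φ x * g x)) := by
    have := hright1.add hright2
    rw [add_zero] at this
    refine this.congr fun k => ?_
    have hm : AEStronglyMeasurable (fun x => h (U k x) * φ x) volume :=
      ((hh.comp (hUc k).continuous).mul hφc).aestronglyMeasurable
    have hi1 : Integrable fun x => h (U k x) * φ x * g x :=
      hg.bdd_mul hm (Eventually.of_forall (hbd k))
    have hi2 : Integrable fun x => h (U k x) * φ x * D k x := by
      have hcU := (hUc k).continuous
      have hcD := hDc k
      exact Continuous.integrable_of_hasCompactSupport (by fun_prop) (hφs.mul_left.mul_right)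
    rw [← integral_add hi1 ((hi2.sub hi1).congr
      (Eventually.of_forall fun x => (mul_sub _ _ _).symm))]
    exact integral_congr_ae (Eventually.of_forall fun x => by ring)
  have hlim := tendsto_nhds_unique hleft ((hright.neg).congr fun k => (hparts k).symm)
  rw [setIntegral_mul_fderiv_testFunction]
  simp_rw [mul_comm (φ _)]
  rw [setIntegral_mul_testFunction]
  refine Eq.trans (integral_congr_ae (Eventually.of_forall fun x => ?_)) (hlim.trans
    (congrArg _ (integral_congr_ae (Eventually.of_forall fun x => ?_))))
  · by_cases hx : x ∈ K
    · simp only [u', indicator_of_mem hx]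
    · have : fderiv ℝ φ x = 0 := image_eq_zero_of_notMem_tsupport
        fun h => hx (hK₀K (tsupport_fderiv_subset ℝ h))
      simp [this]
  · by_cases hx : x ∈ K
    · simp only [u', g, indicator_of_mem hx, inner_smul_left]
      simp
      ring
    · have : φ x = 0 := image_eq_zero_of_notMem_tsupport fun h => hx (hK₀K h)
      simp [this]

end WeakGradient

/-! ### Hölder's inequality for inner products -/

section Holder

open scoped ENNReal

variable {X H : Type*} [MeasurableSpace X] {μ : Measure X} [NormedAddCommGroup H]
  [InnerProductSpace ℝ H] {P Q : ℝ}

theorem eLpNorm_inner_le (hPQ : P.HolderConjugate Q) {f g : X → H}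
    (hf : AEStronglyMeasurable f μ) (hg : AEStronglyMeasurable g μ) :
    eLpNorm (fun x => inner ℝ (g x) (f x)) 1 μ ≤
      eLpNorm g (ENNReal.ofReal Q) μ * eLpNorm f (ENNReal.ofReal P) μ := by
  have := hPQ.symm.ennrealOfReal
  have h := eLpNorm_le_eLpNorm_mul_eLpNorm'_of_norm (p := ENNReal.ofReal Q)
    (q := ENNReal.ofReal P) (r := 1) hg hf (fun a b : H => inner ℝ a b) 1
    (Eventually.of_forall fun x => by simpa using norm_inner_le_norm (𝕜 := ℝ) (g x) (f x))
  simpa using h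

theorem integrable_inner_of_memLp (hPQ : P.HolderConjugate Q) {f g : X → H}
    (hf : MemLp f (ENNReal.ofReal P) μ) (hg : MemLp g (ENNReal.ofReal Q) μ) :
    Integrable (fun x => inner ℝ (g x) (f x)) μ :=
  memLp_one_iff_integrable.1 ⟨hg.1.inner hf.1, (eLpNorm_inner_le hPQ hf.1 hg.1).trans_lt
    (ENNReal.mul_lt_top hg.2 hf.2)⟩

theorem abs_integral_inner_le (hPQ : P.HolderConjugate Q) {f g : X → H}
    (hf : MemLp f (ENNReal.ofReal P) μ) (hg : MemLp g (ENNReal.ofReal Q) μ) :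
    |∫ x, inner ℝ (g x) (f x) ∂μ| ≤ (eLpNorm g (ENNReal.ofReal Q) μ).toReal *
      (eLpNorm f (ENNReal.ofReal P) μ).toReal := by
  rw [← ENNReal.toReal_mul, ← Real.norm_eq_abs, ← toReal_enorm]
  refine ENNReal.toReal_mono (ENNReal.mul_ne_top hg.2.ne hf.2.ne) ?_
  refine (enorm_integral_le_lintegral_enorm _).trans ?_
  rw [← eLpNorm_one_eq_lintegral_enorm]
  exact eLpNorm_inner_le hPQ hf.1 hg.1

theorem tendsto_integral_inner_of_eLpNorm (hPQ : P.HolderConjugate Q) {ι : Type*} {l : Filter ι}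
    {f : X → H} {F : ι → X → H} {g : X → H} (hf : MemLp f (ENNReal.ofReal P) μ)
    (hg : MemLp g (ENNReal.ofReal Q) μ) (hF : ∀ i, AEStronglyMeasurable (F i) μ)
    (hlim : Tendsto (fun i => eLpNorm (fun x => F i x - f x) (ENNReal.ofReal P) μ) l (𝓝 0)) :
    Tendsto (fun i => ∫ x, inner ℝ (g x) (F i x) ∂μ) l (𝓝 (∫ x, inner ℝ (g x) (f x) ∂μ)) := by
  have hmem : ∀ᶠ i in l, MemLp (fun x => F i x - f x) (ENNReal.ofReal P) μ :=
    (hlim.eventually (gt_mem_nhds one_pos)).mono fun i hi =>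
      ⟨(hF i).sub hf.1, hi.trans ENNReal.one_lt_top⟩
  refine tendsto_integral_of_L1' _ (integrable_inner_of_memLp hPQ hf hg).aestronglyMeasurable ?_ ?_
  · refine hmem.mono fun i hi => ?_
    refine ((integrable_inner_of_memLp hPQ hi hg).add
      (integrable_inner_of_memLp hPQ hf hg)).congr (Eventually.of_forall fun x => ?_)
    simp [inner_sub_right]
  · have h1 : Tendsto (fun i => eLpNorm g (ENNReal.ofReal Q) μ *
        eLpNorm (fun x => F i x - f x) (ENNReal.ofReal P) μ) l (𝓝 0) := by
      simpa using ENNReal.Tendsto.const_mul hlim (Or.inr hg.2.ne)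
    refine tendsto_of_tendsto_of_tendsto_of_le_of_le tendsto_const_nhds h1
      (fun i => zero_le) fun i => ?_
    refine le_trans (le_of_eq ?_) (eLpNorm_inner_le hPQ ((hF i).sub hf.1) hg.1)
    refine congrArg (fun F => eLpNorm F 1 μ) (funext fun x => ?_)
    simp [inner_sub_right]

end Holder

/-! ### Integration by parts up to the boundary of a convex set -/

section Boundary

open scoped ENNReal Pointwise

variable {N : ℕ} {Ω : Opens (EuclideanSpace ℝ (Fin N))}

/-- If `a x + (x₀ - a x₀) = z + y` with `y` in the closure of `Ω` and `‖z‖ ≤ r`, then `x = a⁻¹ y +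
(1 - a⁻¹)(x₀ + z/(a-1))`. This is a convex combination of a point of the closure and, since `r <
(a-1)R`, an interior point. Contraction towards `x₀` thus absorbs the enlargement of the support by
mollification. -/
theorem tsupport_comp_dilation_subset (hΩb : Bornology.IsBounded (Ω : Set (EuclideanSpace ℝ (Fin N))))
    (hΩc : Convex ℝ (Ω : Set (EuclideanSpace ℝ (Fin N)))) {x₀ : EuclideanSpace ℝ (Fin N)} {R : ℝ}
    (hR : Metric.ball x₀ R ⊆ Ω) {a r : ℝ} (ha : 1 < a) (hr : r < (a - 1) * R)
    {f : EuclideanSpace ℝ (Fin N) → ℝ}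
    (hf : Function.support f ⊆ Metric.ball (0 : EuclideanSpace ℝ (Fin N)) r + Ω) :
    tsupport (fun x => f (a • x + (x₀ - a • x₀))) ⊆ Ω ∧
      HasCompactSupport (fun x => f (a • x + (x₀ - a • x₀))) := by
  have hΩcl : IsCompact (closure (Ω : Set (EuclideanSpace ℝ (Fin N)))) :=
    hΩb.isCompact_closure
  set C : Set (EuclideanSpace ℝ (Fin N)) :=
    Metric.closedBall (0 : EuclideanSpace ℝ (Fin N)) r + closure Ω
  have hC : IsClosed C := ((isCompact_closedBall _ _).add hΩcl).isClosed
  have hsub : tsupport (fun x => f (a • x + (x₀ - a • x₀))) ⊆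
      (fun x => a • x + (x₀ - a • x₀)) ⁻¹' C := by
    refine closure_minimal (fun x hx => ?_) (hC.preimage (by fun_prop))
    exact add_subset_add Metric.ball_subset_closedBall subset_closure (hf hx)
  have hΩ : tsupport (fun x => f (a • x + (x₀ - a • x₀))) ⊆ Ω := by
    refine hsub.trans fun x hx => ?_
    obtain ⟨z, hz, y, hy, hzy⟩ := hx
    have ha0 : a ≠ 0 := by positivity
    have ha1 : a - 1 ≠ 0 := by linarith
    have hy' : x₀ + (a - 1)⁻¹ • z ∈ interior (Ω : Set (EuclideanSpace ℝ (Fin N))) := by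
      rw [Ω.isOpen.interior_eq]
      refine hR ?_
      rw [Metric.mem_ball, dist_eq_norm, add_sub_cancel_left, norm_smul, norm_inv,
        Real.norm_of_nonneg (by linarith), inv_mul_lt_iff₀ (by linarith)]
      exact (mem_closedBall_zero_iff.1 hz).trans_lt hr
    have hmem := hΩc.combo_closure_interior_mem_interior hy hy' (a := a⁻¹) (b := 1 - a⁻¹)
      (by positivity) (by rw [sub_pos]; exact inv_lt_one_of_one_lt₀ ha) (by ring)
    rw [Ω.isOpen.interior_eq] at hmem
    have hx : x = a⁻¹ • y + (1 - a⁻¹) • (x₀ + (a - 1)⁻¹ • z) := by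
      have h1 : a⁻¹ • (z + y) = a⁻¹ • (a • x + (x₀ - a • x₀)) := congrArg _ hzy
      have h2 : a⁻¹ • (a • x + (x₀ - a • x₀)) = x + a⁻¹ • x₀ - x₀ := by
        rw [smul_add, smul_sub, smul_smul, smul_smul, inv_mul_cancel₀ ha0, one_smul, one_smul]
        abel
      have h3 : (1 - a⁻¹) • (a - 1)⁻¹ • z = a⁻¹ • z := by
        rw [smul_smul]; congr 1; field_simp
      rw [h2] at h1
      rw [smul_add (1 - a⁻¹), h3, sub_smul, one_smul]
      have h4 : x = a⁻¹ • (z + y) - a⁻¹ • x₀ + x₀ := by rw [h1]; abel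
      rw [h4, smul_add]
      abel
    rw [hx]
    exact hmem
  exact ⟨hΩ, hΩcl.of_isClosed_subset (isClosed_tsupport _) (hΩ.trans subset_closure)⟩

/-- If `-div m = σ` on the whole space, with `m` and `σ` vanishing off the bounded convex set `Ω`,
then `∫ w σ = ∫ m · ∇w` for bounded `w` with a gradient in the dual space of `m`. -/
theorem integral_mul_eq_integral_inner_of_div
    (hΩb : Bornology.IsBounded (Ω : Set (EuclideanSpace ℝ (Fin N))))
    (hΩc : Convex ℝ (Ω : Set (EuclideanSpace ℝ (Fin N)))) (hne : (Ω : Set (EuclideanSpace ℝ (Fin N))).Nonempty)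
    {P Q : ℝ} (hPQ : P.HolderConjugate Q)
    {w : EuclideanSpace ℝ (Fin N) → ℝ} {ζ m : EuclideanSpace ℝ (Fin N) → EuclideanSpace ℝ (Fin N)}
    {σ : EuclideanSpace ℝ (Fin N) → ℝ} (hw : IsWeakGradient Ω w ζ) {B : ℝ}
    (hB : ∀ x ∈ Ω, |w x| ≤ B)
    (hζ : MemLp ζ (ENNReal.ofReal Q) (volume.restrict (Ω : Set (EuclideanSpace ℝ (Fin N)))))
    (hm : MemLp m (ENNReal.ofReal P)) (hm0 : ∀ x ∉ Ω, m x = 0)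
    (hσ : Integrable σ)
    (hdiv : ∀ φ : 𝓓((⊤ : Opens (EuclideanSpace ℝ (Fin N))), ℝ),
      ∫ x, fderiv ℝ φ x (m x) = ∫ x, σ x * φ x) :
    ∫ x in (Ω : Set (EuclideanSpace ℝ (Fin N))), w x * σ x =
      ∫ x in (Ω : Set (EuclideanSpace ℝ (Fin N))), inner ℝ (ζ x) (m x) := by
  obtain ⟨x₀, hx₀⟩ := hne
  obtain ⟨R, hR, hRΩ⟩ := Metric.isOpen_iff.1 Ω.isOpen x₀ hx₀
  have hP1 : 1 ≤ ENNReal.ofReal P := ENNReal.one_le_ofReal.2 hPQ.lt.le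
  -- Dilation by `a k` leaves a margin `(a k - 1) R`; mollification uses half of it.
  let a : ℕ → ℝ := fun k => 1 + 1 / ((k : ℝ) + 1)
  let r : ℕ → ℝ := fun k => (1 / ((k : ℝ) + 1)) * (R / 2)
  have ha : ∀ k, 1 < a k := fun k => lt_add_of_pos_right 1 (by positivity)
  have hr : ∀ k, 0 < r k := fun k => by positivity
  have hrR : ∀ k, r k < (a k - 1) * R := fun k => by
    simp only [r, a, add_sub_cancel_left]
    have : 0 < 1 / ((k : ℝ) + 1) := by positivity
    exact mul_lt_mul_of_pos_left (by linarith) this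
  let b : ℕ → EuclideanSpace ℝ (Fin N) := fun k => x₀ - a k • x₀
  let η : ℕ → ContDiffBump (0 : EuclideanSpace ℝ (Fin N)) := fun k => bumpOfRadius _ (r k) (hr k)
  have hη0 : Tendsto (fun k => (η k).rOut) atTop (𝓝 0) := by
    simpa [η, bumpOfRadius, r] using
      (tendsto_one_div_add_atTop_nhds_zero_nat (𝕜 := ℝ)).mul_const (R / 2)
  have ha1 : Tendsto a atTop (𝓝 1) := by
    simpa [a] using (tendsto_one_div_add_atTop_nhds_zero_nat (𝕜 := ℝ)).const_add 1
  have hb0 : Tendsto b atTop (𝓝 0) := by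
    simpa [b] using (ha1.smul_const x₀).const_sub x₀
  let e : Fin N → EuclideanSpace ℝ (Fin N) := fun i => EuclideanSpace.single i 1
  have hmi : ∀ i, MemLp (fun x => m x i) (ENNReal.ofReal P) := fun i =>
    hm.mono ((EuclideanSpace.proj (𝕜 := ℝ) i).continuous.comp_aestronglyMeasurable hm.1)
      (Eventually.of_forall fun x => PiLp.norm_apply_le (m x) i)
  have hmil : ∀ i, LocallyIntegrable (fun x => m x i) := fun i =>
    (hmi i).locallyIntegrable hP1
  have hζi : ∀ i, MemLp (fun x => ζ x i) (ENNReal.ofReal Q)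
      (volume.restrict (Ω : Set (EuclideanSpace ℝ (Fin N)))) := fun i =>
    hζ.mono ((EuclideanSpace.proj (𝕜 := ℝ) i).continuous.comp_aestronglyMeasurable hζ.1)
      (Eventually.of_forall fun x => PiLp.norm_apply_le (ζ x) i)
  let M : ℕ → Fin N → EuclideanSpace ℝ (Fin N) → ℝ := fun k i => mollify (η k) (fun x => m x i)
  let S : ℕ → EuclideanSpace ℝ (Fin N) → ℝ := fun k => mollify (η k) σ
  let T : ℕ → EuclideanSpace ℝ (Fin N) → EuclideanSpace ℝ (Fin N) := fun k x => a k • x + b k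
  have hMc : ∀ k i, ContDiff ℝ ∞ (M k i) := fun k i => contDiff_mollify (hmil i)
  have hTc : ∀ k, ContDiff ℝ ∞ (T k) := fun k => by fun_prop
  have hsupp : ∀ k i, tsupport (fun x => M k i (T k x)) ⊆ Ω ∧
      HasCompactSupport (fun x => M k i (T k x)) := fun k i => by
    refine tsupport_comp_dilation_subset hΩb hΩc hRΩ (ha k) (hrR k)
      (support_mollify_subset.trans (add_subset_add le_rfl fun x hx => ?_))
    by_contra h
    exact hx (by simp [hm0 x h])
  -- The components of the mollified, contracted momentum are admissible test functions in `Ω` for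
  -- the weak gradient `ζ`.
  let φ : ℕ → Fin N → 𝓓(Ω, ℝ) := fun k i =>
    { toFun := fun x => M k i (T k x)
      contDiff' := (hMc k i).comp (hTc k)
      hasCompactSupport' := (hsupp k i).2
      tsupport_subset' := (hsupp k i).1 }
  have hφ : ∀ k i x, φ k i x = M k i (T k x) := fun k i x => rfl
  have hdφ : ∀ k i x, fderiv ℝ (φ k i) x (e i) = a k * fderiv ℝ (M k i) (T k x) (e i) := by
    intro k i x
    have h1 : HasFDerivAt (T k) (a k • ContinuousLinearMap.id ℝ (EuclideanSpace ℝ (Fin N))) x :=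
      ((hasFDerivAt_id x).const_smul (a k)).add_const (b k)
    have h2 := (((hMc k i).differentiable (by simp) (T k x)).hasFDerivAt.comp x h1).fderiv
    have h3 : (φ k i : EuclideanSpace ℝ (Fin N) → ℝ) = M k i ∘ T k := rfl
    rw [h3, h2]
    simp
  -- The kernel centred at `X` may cross `∂Ω`, so the divergence identity is needed against test
  -- functions on the whole space; this is where the no-flux condition enters.
  have hdivM : ∀ k X, ∑ i, fderiv ℝ (M k i) X (e i) = -S k X := by
    intro k X
    set ψ := reflectedBump (η k) X ⊤ (subset_univ _)
    have hψ : (ψ : EuclideanSpace ℝ (Fin N) → ℝ) = fun t => (η k).normed volume (X - t) := rfl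
    have hi : ∀ i, Integrable fun t => m t i * fderiv ℝ ψ t (e i) := fun i => by
      have hc : Continuous fun t => fderiv ℝ ψ t (e i) :=
        (ψ.contDiff.continuous_fderiv (by simp)).clm_apply continuous_const
      exact (hmil i).integrable_smul_right_of_hasCompactSupport hc
        (ψ.hasCompactSupport.fderiv_apply ℝ (e i))
    have h1 : ∀ i, fderiv ℝ (M k i) X (e i) = -∫ t, m t i * fderiv ℝ ψ t (e i) := fun i => by
      rw [hψ]; exact fderiv_mollify_apply (hmil i) X (e i)
    simp_rw [h1]
    rw [Finset.sum_neg_distrib, ← integral_finsetSum _ fun i _ => hi i]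
    have h2 : ∀ t, ∑ i, m t i * fderiv ℝ ψ t (e i) = fderiv ℝ ψ t (m t) := fun t => by
      conv_rhs => rw [← (EuclideanSpace.basisFun (Fin N) ℝ).sum_repr (m t)]
      simp [e]
    simp_rw [h2]
    simp only [S, mollify_apply]
    rw [hdiv ψ, hψ]
    refine congrArg _ (integral_congr_ae (Eventually.of_forall fun t => ?_))
    simp only [mul_comm]
  have hwm := hw.1.aestronglyMeasurable
  have hwi : ∀ k i, IntegrableOn (fun x => w x * fderiv ℝ (φ k i) x (e i)) Ω := fun k i => by
    have hc : Continuous fun x => fderiv ℝ (φ k i) x (e i) :=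
      ((φ k i).contDiff.continuous_fderiv (by simp)).clm_apply continuous_const
    refine Integrable.bdd_mul (c := B) (hc.integrable_of_hasCompactSupport
      ((φ k i).hasCompactSupport.fderiv_apply ℝ (e i))).integrableOn hwm ?_
    filter_upwards [ae_restrict_mem Ω.isOpen.measurableSet] with x hx using hB x hx
  -- The weak gradient identity for each component is summed over the components; the factor `a k`
  -- comes from differentiating the dilation, and tends to `1`.
  have hid : ∀ k, a k * ∫ x in (Ω : Set (EuclideanSpace ℝ (Fin N))), w x * S k (T k x) =
      ∑ i, ∫ x in (Ω : Set (EuclideanSpace ℝ (Fin N))), inner ℝ (ζ x i) (M k i (T k x)) := by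
    intro k
    have h1 := Finset.sum_congr (rfl : (Finset.univ : Finset (Fin N)) = Finset.univ)
      fun i _ => hw.2.2 (φ k i) (e i)
    rw [← integral_finsetSum _ fun i _ => hwi k i, Finset.sum_neg_distrib] at h1
    have h2 : ∀ x, ∑ i, w x * fderiv ℝ (φ k i) x (e i) = -(a k * (w x * S k (T k x))) := by
      intro x
      rw [← Finset.mul_sum]
      simp_rw [hdφ]
      rw [← Finset.mul_sum, hdivM]
      ring
    simp_rw [h2] at h1
    rw [integral_neg, neg_inj, integral_const_mul] at h1
    rw [h1]
    refine Finset.sum_congr rfl fun i _ => integral_congr_ae (Eventually.of_forall fun x => ?_)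
    simp [e, hφ, EuclideanSpace.inner_single_right]
  have hSlim : Tendsto (fun k => eLpNorm (fun x => S k (T k x) - σ x) 1
      (volume.restrict (Ω : Set (EuclideanSpace ℝ (Fin N))))) atTop (𝓝 0) := by
    have := tendsto_eLpNorm_convolution_comp_sub (μ := volume) le_rfl ENNReal.one_ne_top hη0 ha1 hb0
      (memLp_one_iff_integrable.2 hσ)
    exact tendsto_of_tendsto_of_tendsto_of_le_of_le tendsto_const_nhds this (fun _ => zero_le)
      fun k => eLpNorm_mono_measure _ Measure.restrict_le_self
  have hMlim : ∀ i, Tendsto (fun k => eLpNorm (fun x => M k i (T k x) - m x i) (ENNReal.ofReal P)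
      (volume.restrict (Ω : Set (EuclideanSpace ℝ (Fin N))))) atTop (𝓝 0) := by
    intro i
    have := tendsto_eLpNorm_convolution_comp_sub (μ := volume) hP1 ENNReal.ofReal_ne_top hη0 ha1 hb0
      (hmi i)
    exact tendsto_of_tendsto_of_tendsto_of_le_of_le tendsto_const_nhds this (fun _ => zero_le)
      fun k => eLpNorm_mono_measure _ Measure.restrict_le_self
  have hright := tendsto_finsetSum Finset.univ fun i _ =>
    tendsto_integral_inner_of_eLpNorm hPQ ((hmi i).restrict _) (hζi i)
      (fun k => ((hMc k i).continuous.comp (hTc k).continuous).aestronglyMeasurable) (hMlim i)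
  have hwσ : IntegrableOn (fun x => w x * σ x) Ω := by
    refine Integrable.bdd_mul (c := B) hσ.integrableOn hwm ?_
    filter_upwards [ae_restrict_mem Ω.isOpen.measurableSet] with x hx using hB x hx
  have hSc : ∀ k, Continuous fun x => S k (T k x) := fun k =>
    (contDiff_mollify hσ.locallyIntegrable).continuous.comp (hTc k).continuous
  have hwS : ∀ k, IntegrableOn (fun x => w x * S k (T k x)) Ω := fun k => by
    refine Integrable.bdd_mul (c := B) ?_ hwm ?_
    · exact ((hSc k).continuousOn.integrableOn_compact hΩb.isCompact_closure).mono_set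
        subset_closure
    · filter_upwards [ae_restrict_mem Ω.isOpen.measurableSet] with x hx using hB x hx
  have hleft : Tendsto (fun k => a k * ∫ x in (Ω : Set (EuclideanSpace ℝ (Fin N))),
      w x * S k (T k x)) atTop
      (𝓝 (1 * ∫ x in (Ω : Set (EuclideanSpace ℝ (Fin N))), w x * σ x)) := by
    refine ha1.mul ?_
    have h1 := tendsto_integral_mul_sub_zero hSlim
      (b := fun _ => (Ω : Set (EuclideanSpace ℝ (Fin N))).indicator w) (C := |B|)
      (Eventually.of_forall fun _ x => by
        by_cases hx : x ∈ Ω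
        · simpa [indicator_of_mem (show x ∈ (Ω : Set (EuclideanSpace ℝ (Fin N))) from hx)] using
            (hB x hx).trans (le_abs_self B)
        · simp [indicator_of_notMem (show x ∉ (Ω : Set (EuclideanSpace ℝ (Fin N))) from hx)])
    rw [tendsto_iff_norm_sub_tendsto_zero]
    have h2 := h1.norm
    rw [norm_zero] at h2
    refine h2.congr fun k => ?_
    rw [← integral_sub (hwS k) hwσ]
    refine congrArg _ (setIntegral_congr_fun Ω.isOpen.measurableSet fun x hx => ?_)
    simp only [indicator_of_mem hx]
    ring
  have := tendsto_nhds_unique hleft (hright.congr fun k => (hid k).symm)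
  rw [one_mul] at this
  rw [this, ← integral_finsetSum]
  · refine integral_congr_ae (Eventually.of_forall fun x => ?_)
    simp [PiLp.inner_apply]
  · exact fun i _ => integrable_inner_of_memLp hPQ ((hmi i).restrict _) (hζi i)

end Boundary

/-! ### Densities as measures -/

section DensityMeasure

open scoped ENNReal

variable {N : ℕ} {Ω : Opens (EuclideanSpace ℝ (Fin N))}

theorem Density.measure_absolutelyContinuous (ρ : Density Ω) :
    ρ.measure ≪ volume.restrict (Ω : Set (EuclideanSpace ℝ (Fin N))) :=
  withDensity_absolutelyContinuous _ _

theorem Density.toNNReal_ae_eq (ρ : Density Ω) :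
    ∀ᵐ x ∂(volume.restrict (Ω : Set (EuclideanSpace ℝ (Fin N)))),
      ((ρ.toFun x).toNNReal : ℝ) = ρ.toFun x :=
  (ae_restrict_mem Ω.isOpen.measurableSet).mono fun x hx => Real.coe_toNNReal _ (ρ.nonneg x hx)

theorem Density.measure_eq (ρ : Density Ω) :
    ρ.measure = (volume.restrict (Ω : Set (EuclideanSpace ℝ (Fin N)))).withDensity
      fun x => ((ρ.toFun x).toNNReal : ℝ≥0∞) := rfl

theorem Density.integral_measure {F : Type*} [NormedAddCommGroup F] [NormedSpace ℝ F]
    (ρ : Density Ω) (f : EuclideanSpace ℝ (Fin N) → F) :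
    ∫ x, f x ∂ρ.measure =
      ∫ x in (Ω : Set (EuclideanSpace ℝ (Fin N))), ρ.toFun x • f x := by
  rw [ρ.measure_eq, integral_withDensity_eq_integral_smul ρ.measurable.real_toNNReal]
  exact integral_congr_ae (ρ.toNNReal_ae_eq.mono fun x hx => by simp only [NNReal.smul_def, hx])

theorem Density.integrable_measure_iff {F : Type*} [NormedAddCommGroup F] [NormedSpace ℝ F]
    (ρ : Density Ω) (f : EuclideanSpace ℝ (Fin N) → F) :
    Integrable f ρ.measure ↔ IntegrableOn (fun x => ρ.toFun x • f x) Ω := by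
  rw [ρ.measure_eq, integrable_withDensity_iff_integrable_smul ρ.measurable.real_toNNReal]
  exact integrable_congr (ρ.toNNReal_ae_eq.mono fun x hx => by simp only [NNReal.smul_def, hx])

theorem Density.aestronglyMeasurable_measure_iff {F : Type*} [NormedAddCommGroup F]
    [NormedSpace ℝ F] (ρ : Density Ω) (f : EuclideanSpace ℝ (Fin N) → F) :
    AEStronglyMeasurable f ρ.measure ↔ AEStronglyMeasurable (fun x => ρ.toFun x • f x)
      (volume.restrict (Ω : Set (EuclideanSpace ℝ (Fin N)))) := by
  rw [ρ.measure_eq, aestronglyMeasurable_withDensity_iff ρ.measurable.real_toNNReal]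
  exact aestronglyMeasurable_congr (ρ.toNNReal_ae_eq.mono fun x hx => by simp only [hx])

/-- The momentum `ρ v`, extended by zero outside `Ω`. -/
noncomputable def Density.momentum (ρ : Density Ω)
    (v : EuclideanSpace ℝ (Fin N) → EuclideanSpace ℝ (Fin N)) :
    EuclideanSpace ℝ (Fin N) → EuclideanSpace ℝ (Fin N) :=
  (Ω : Set (EuclideanSpace ℝ (Fin N))).indicator fun x => ρ.toFun x • v x

/-- Because `ρ ≤ M`, one has `ρ^P ≤ M^(P-1) ρ`, so a weighted bound on `v` becomes an unweighted
bound on `ρ v`. -/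
theorem Density.memLp_momentum (ρ : Density Ω) {P : ℝ} (hP : 1 ≤ P)
    {v : EuclideanSpace ℝ (Fin N) → EuclideanSpace ℝ (Fin N)}
    (hv : MemLp v (ENNReal.ofReal P) ρ.measure) :
    MemLp (ρ.momentum v) (ENNReal.ofReal P) := by
  have hP0 : 0 < P := by linarith
  obtain ⟨M, hM⟩ := ρ.bounded
  have hmeas := (ρ.aestronglyMeasurable_measure_iff v).1 hv.1
  rw [Density.momentum, memLp_indicator_iff_restrict Ω.isOpen.measurableSet,
    memLp_ofReal_iff_integrable hP0 hmeas]
  have hi := (ρ.integrable_measure_iff _).1 (integrable_norm_rpow_ofReal hP0 hv)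
  refine Integrable.mono' (hi.const_mul (M ^ (P - 1)))
    (hmeas.norm.aemeasurable.pow_const _).aestronglyMeasurable ?_
  filter_upwards [ae_restrict_mem Ω.isOpen.measurableSet] with x hx
  have h0 := ρ.nonneg x hx
  rw [Real.norm_of_nonneg (by positivity), norm_smul, Real.norm_of_nonneg h0,
    Real.mul_rpow h0 (norm_nonneg _), smul_eq_mul, ← mul_assoc]
  refine mul_le_mul_of_nonneg_right ?_ (by positivity)
  rcases h0.eq_or_lt with h | h
  · rw [← h, Real.zero_rpow hP0.ne', mul_zero]
  · calc ρ.toFun x ^ P = ρ.toFun x ^ (P - 1) * ρ.toFun x := by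
          rw [← Real.rpow_add_one h.ne', sub_add_cancel]
      _ ≤ M ^ (P - 1) * ρ.toFun x :=
          mul_le_mul_of_nonneg_right (Real.rpow_le_rpow h0 (hM x hx) (by linarith)) h0

end DensityMeasure

/-! ### Uniqueness of weak gradients, level sets -/

section LevelSet

variable {N : ℕ} {Ω : Opens (EuclideanSpace ℝ (Fin N))}

theorem IsWeakGradient.ae_eq {u : EuclideanSpace ℝ (Fin N) → ℝ}
    {ξ ξ' : EuclideanSpace ℝ (Fin N) → EuclideanSpace ℝ (Fin N)} (h : IsWeakGradient Ω u ξ)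
    (h' : IsWeakGradient Ω u ξ') :
    ∀ᵐ x ∂(volume.restrict (Ω : Set (EuclideanSpace ℝ (Fin N)))), ξ x = ξ' x := by
  rw [ae_restrict_iff' Ω.isOpen.measurableSet]
  have key : ∀ i : Fin N, ∀ᵐ x, x ∈ (Ω : Set (EuclideanSpace ℝ (Fin N))) →
      inner ℝ (ξ x) (EuclideanSpace.single i (1 : ℝ)) -
        inner ℝ (ξ' x) (EuclideanSpace.single i (1 : ℝ)) = 0 := by
    intro i
    set e : EuclideanSpace ℝ (Fin N) := EuclideanSpace.single i (1 : ℝ)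
    refine Ω.isOpen.ae_eq_zero_of_integral_contDiff_smul_eq_zero
      ((h.locallyIntegrableOn_inner e).sub (h'.locallyIntegrableOn_inner e)) fun g hg hgc hgΩ => ?_
    let φ : 𝓓(Ω, ℝ) := ⟨g, hg, hgc, hgΩ⟩
    have hφ : ∀ x, φ x = g x := fun x => rfl
    have hi : ∀ {ξ : EuclideanSpace ℝ (Fin N) → EuclideanSpace ℝ (Fin N)},
        IsWeakGradient Ω u ξ → Integrable fun x => g x * inner ℝ (ξ x) e := by
      intro ξ h
      have h1 : IntegrableOn (fun x => g x * inner ℝ (ξ x) e) (tsupport g) :=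
        ((h.locallyIntegrableOn_inner e).integrableOn_compact_subset hgΩ hgc).continuousOn_mul
          hg.continuous.continuousOn hgc
      refine h1.integrable_of_forall_notMem_eq_zero fun x hx => ?_
      rw [image_eq_zero_of_notMem_tsupport hx, zero_mul]
    have h1 := (h.2.2 φ e).symm.trans (h'.2.2 φ e)
    rw [neg_inj] at h1
    simp_rw [mul_comm (φ _)] at h1
    rw [setIntegral_mul_testFunction, setIntegral_mul_testFunction] at h1
    simp only [smul_eq_mul, mul_sub]
    rw [integral_sub (hi h) (hi h'), sub_eq_zero]
    simpa only [hφ, mul_comm] using h1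
  filter_upwards [ae_all_iff.2 key] with x hx hxΩ
  ext i
  have := hx i hxΩ
  simpa [EuclideanSpace.inner_single_right, sub_eq_zero] using this

/-- A continuous approximation of the indicator function of `(c, ∞)`. -/
noncomputable def ramp (c : ℝ) (n : ℕ) (s : ℝ) : ℝ := min 1 (max 0 ((n : ℝ) * (s - c) - 1))

/-- The primitive of the ramp with value `c` at `c`. -/
noncomputable def rampPrimitive (c : ℝ) (n : ℕ) (s : ℝ) : ℝ := c + ∫ t in c..s, ramp c n t

theorem continuous_ramp (c : ℝ) (n : ℕ) : Continuous (ramp c n) := by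
  unfold ramp; fun_prop

theorem ramp_nonneg (c : ℝ) (n : ℕ) (s : ℝ) : 0 ≤ ramp c n s :=
  le_min zero_le_one (le_max_left _ _)

theorem abs_ramp_le_one (c : ℝ) (n : ℕ) (s : ℝ) : |ramp c n s| ≤ 1 := by
  rw [abs_of_nonneg (ramp_nonneg c n s)]
  exact min_le_left _ _

theorem tendsto_ramp (c s : ℝ) :
    Tendsto (fun n => ramp c n s) atTop (𝓝 (if c < s then 1 else 0)) := by
  split_ifs with h
  · refine tendsto_const_nhds.congr' ?_
    obtain ⟨n₀, hn₀⟩ := exists_nat_gt (2 / (s - c))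
    filter_upwards [eventually_ge_atTop n₀] with n hn
    have h1 : 2 / (s - c) < n := hn₀.trans_le (by exact_mod_cast hn)
    rw [div_lt_iff₀ (by linarith)] at h1
    rw [ramp, max_eq_right (by linarith), min_eq_left (by linarith)]
  · refine tendsto_const_nhds.congr fun n => ?_
    have : (n : ℝ) * (s - c) ≤ 0 :=
      mul_nonpos_of_nonneg_of_nonpos (Nat.cast_nonneg n) (by linarith)
    rw [ramp, max_eq_left (by linarith), min_eq_right zero_le_one]

theorem hasDerivAt_rampPrimitive (c : ℝ) (n : ℕ) (s : ℝ) :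
    HasDerivAt (rampPrimitive c n) (ramp c n s) s :=
  ((continuous_ramp c n).integral_hasStrictDerivAt c s).hasDerivAt.const_add c

theorem abs_rampPrimitive_le (c : ℝ) (n : ℕ) (s : ℝ) :
    |rampPrimitive c n s| ≤ |c| + |s - c| := by
  refine (abs_add_le _ _).trans (add_le_add le_rfl ?_)
  have := intervalIntegral.norm_integral_le_of_norm_le_const (a := c) (b := s) (C := 1)
    (f := ramp c n) fun t _ => abs_ramp_le_one c n t
  simpa using this

theorem tendsto_rampPrimitive {c s : ℝ} (hs : c ≤ s) :
    Tendsto (fun n => rampPrimitive c n s) atTop (𝓝 s) := by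
  have h : Tendsto (fun n => ∫ t in c..s, ramp c n t) atTop (𝓝 (∫ _ in c..s, (1 : ℝ))) := by
    refine intervalIntegral.tendsto_integral_filter_of_dominated_convergence (fun _ => 1) ?_ ?_ ?_ ?_
    · exact Eventually.of_forall fun n => (continuous_ramp c n).aestronglyMeasurable
    · exact Eventually.of_forall fun n => Eventually.of_forall fun t _ => abs_ramp_le_one c n t
    · exact intervalIntegrable_const
    · refine Eventually.of_forall fun t ht => ?_
      rw [uIoc_of_le hs] at ht
      simpa [ht.1] using tendsto_ramp c t
  have := h.const_add c
  simpa [rampPrimitive] using this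

/-- The weak gradient vanishes almost everywhere on the lowest level set. -/
theorem IsWeakGradient.ae_eq_zero_of_eq_lower_bound {u : EuclideanSpace ℝ (Fin N) → ℝ}
    {ξ : EuclideanSpace ℝ (Fin N) → EuclideanSpace ℝ (Fin N)} (h : IsWeakGradient Ω u ξ)
    {B c : ℝ} (hB : ∀ x ∈ Ω, |u x| ≤ B) (hc : ∀ x ∈ Ω, c ≤ u x) :
    ∀ᵐ x ∂(volume.restrict (Ω : Set (EuclideanSpace ℝ (Fin N)))), u x = c → ξ x = 0 := by
  have hum := h.1.aestronglyMeasurable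
  have hξm := h.2.1.aestronglyMeasurable
  -- The primitives of the ramps converge to the identity on `[c, ∞)`, where `u` takes its values.
  -- Passing to the limit in the chain rule shows that `ξ` multiplied by the indicator of `{u > c}`
  -- is another weak gradient of `u`, and weak gradients are unique.
  have hgrad : IsWeakGradient Ω u fun x => (if c < u x then (1 : ℝ) else 0) • ξ x := by
    refine ⟨h.1, ?_, fun φ e => ?_⟩
    · rw [locallyIntegrableOn_iff Ω.isOpen.isLocallyClosed]
      intro K hKΩ hK
      have h1 := h.2.1.integrableOn_compact_subset hKΩ hK
      have h2 : Measurable fun s : ℝ => if c < s then (1 : ℝ) else 0 :=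
        Measurable.ite measurableSet_Ioi measurable_const measurable_const
      refine Integrable.mono h1 ((h2.comp_aemeasurable
        (hum.mono_set hKΩ).aemeasurable).aestronglyMeasurable.smul h1.1)
        (Eventually.of_forall fun x => ?_)
      rw [norm_smul]
      refine mul_le_of_le_one_left (norm_nonneg _) ?_
      split_ifs <;> simp
    · have hn : ∀ n, _ := fun n => (h.comp hB (hasDerivAt_rampPrimitive c n)
        (continuous_ramp c n) (abs_ramp_le_one c n)).2.2 φ e
      have hφc := φ.continuous
      have hdφ : Integrable fun x => fderiv ℝ φ x e :=
        ((φ.contDiff.continuous_fderiv (by simp)).clm_apply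
          continuous_const).integrable_of_hasCompactSupport (φ.hasCompactSupport.fderiv_apply ℝ e)
      have hHm : ∀ n, Continuous (rampPrimitive c n) := fun n =>
        continuous_iff_continuousAt.2 fun s => (hasDerivAt_rampPrimitive c n s).continuousAt
      have hleft : Tendsto (fun n => ∫ x in (Ω : Set (EuclideanSpace ℝ (Fin N))),
          rampPrimitive c n (u x) * fderiv ℝ φ x e) atTop
          (𝓝 (∫ x in (Ω : Set (EuclideanSpace ℝ (Fin N))), u x * fderiv ℝ φ x e)) := by
        refine tendsto_integral_of_dominated_convergence
          (fun x => (|c| + (B + |c|)) * |fderiv ℝ φ x e|) ?_ ?_ ?_ ?_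
        · exact fun n => ((hHm n).comp_aestronglyMeasurable hum).mul hdφ.integrableOn.1
        · exact (hdφ.integrableOn.abs).const_mul _
        · intro n
          filter_upwards [ae_restrict_mem Ω.isOpen.measurableSet] with x hx
          rw [norm_mul]
          refine mul_le_mul_of_nonneg_right ((abs_rampPrimitive_le _ _ _).trans ?_) (abs_nonneg _)
          gcongr
          exact (abs_sub _ _).trans (by linarith [hB x hx])
        · filter_upwards [ae_restrict_mem Ω.isOpen.measurableSet] with x hx
          exact (tendsto_rampPrimitive (hc x hx)).mul_const _
      have hi : IntegrableOn (fun x => φ x * inner ℝ (ξ x) e) Ω := by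
        have h1 : IntegrableOn (fun x => φ x * inner ℝ (ξ x) e) (tsupport φ) :=
          ((h.locallyIntegrableOn_inner e).integrableOn_compact_subset φ.tsupport_subset
            φ.hasCompactSupport).continuousOn_mul hφc.continuousOn φ.hasCompactSupport
        refine (h1.integrable_of_forall_notMem_eq_zero fun x hx => ?_).integrableOn
        rw [image_eq_zero_of_notMem_tsupport hx, zero_mul]
      have hright : Tendsto (fun n => ∫ x in (Ω : Set (EuclideanSpace ℝ (Fin N))),
          φ x * inner ℝ (ramp c n (u x) • ξ x) e) atTop
          (𝓝 (∫ x in (Ω : Set (EuclideanSpace ℝ (Fin N))),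
            φ x * inner ℝ ((if c < u x then (1 : ℝ) else 0) • ξ x) e)) := by
        refine tendsto_integral_of_dominated_convergence
          (fun x => |φ x * inner ℝ (ξ x) e|) ?_ hi.abs ?_ ?_
        · exact fun n => hφc.aestronglyMeasurable.mul
            ((((continuous_ramp c n).comp_aestronglyMeasurable hum).smul hξm).inner_const)
        · refine fun n => Eventually.of_forall fun x => ?_
          rw [real_inner_smul_left, mul_left_comm, norm_mul]
          exact mul_le_of_le_one_left (norm_nonneg _) (abs_ramp_le_one _ _ _)
        · refine Eventually.of_forall fun x => ?_
          simp only [real_inner_smul_left]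
          exact ((tendsto_ramp c (u x)).mul_const _).const_mul _
      exact tendsto_nhds_unique hleft (hright.neg.congr fun n => (hn n).symm)
  filter_upwards [h.ae_eq hgrad] with x hx hxc
  rw [hx]
  simp [hxc]

end LevelSet

/-! ### Integration by parts against the gradient of a monotone function of the density -/

section Parts

open scoped ENNReal

variable {N : ℕ} {Ω : Opens (EuclideanSpace ℝ (Fin N))}

theorem Density.exists_abs_comp_le (ρ : Density Ω) {g : ℝ → ℝ} (hg : MonotoneOn g (Ici 0)) :
    ∃ B, ∀ x ∈ Ω, |g (ρ.toFun x)| ≤ B := by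
  obtain ⟨M, hM⟩ := ρ.bounded
  refine ⟨max |g 0| |g M|, fun x hx => ?_⟩
  have h0 := ρ.nonneg x hx
  exact abs_le_max_abs_abs (hg self_mem_Ici h0 h0)
    (hg h0 (h0.trans (hM x hx)) (hM x hx))

/-- `∫ g(ρ) σ = ∫ ρ ∇g(ρ) · v` whenever `σ = -div(ρ v)`, for continuous increasing `g`. -/
theorem Density.integral_comp_mul_eq (ρ : Density Ω)
    (hΩb : Bornology.IsBounded (Ω : Set (EuclideanSpace ℝ (Fin N))))
    (hΩc : Convex ℝ (Ω : Set (EuclideanSpace ℝ (Fin N))))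
    {P Q : ℝ} (hPQ : P.HolderConjugate Q) {g : ℝ → ℝ} (hgc : ContinuousOn g (Ici 0))
    (hgm : MonotoneOn g (Ici 0)) {ξ v : EuclideanSpace ℝ (Fin N) → EuclideanSpace ℝ (Fin N)}
    (hξ : IsWeakGradient Ω (fun x => g (ρ.toFun x)) ξ)
    (hξQ : MemLp ξ (ENNReal.ofReal Q) ρ.measure) (hv : MemLp v (ENNReal.ofReal P) ρ.measure)
    {σ : EuclideanSpace ℝ (Fin N) → ℝ} (hσ : IntegrableOn σ Ω)
    (hdiv : ∀ φ : 𝓓((⊤ : Opens (EuclideanSpace ℝ (Fin N))), ℝ),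
      ∫ x, fderiv ℝ φ x (v x) ∂ρ.measure =
        ∫ x in (Ω : Set (EuclideanSpace ℝ (Fin N))), σ x * φ x) :
    ∫ x in (Ω : Set (EuclideanSpace ℝ (Fin N))), g (ρ.toFun x) * σ x =
      ∫ x, inner ℝ (ξ x) (v x) ∂ρ.measure := by
  have hne : (Ω : Set (EuclideanSpace ℝ (Fin N))).Nonempty := by
    by_contra h
    have := ρ.integral_eq_one
    rw [not_nonempty_iff_eq_empty.1 h] at this
    simp at this
  set u : EuclideanSpace ℝ (Fin N) → ℝ := fun x => g (ρ.toFun x)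
  obtain ⟨B, hB⟩ := ρ.exists_abs_comp_le hgm
  have hc : ∀ x ∈ Ω, g 0 ≤ u x := fun x hx => hgm self_mem_Ici (ρ.nonneg x hx) (ρ.nonneg x hx)
  have hum := hξ.1.aestronglyMeasurable
  have hξm := hξ.2.1.aestronglyMeasurable
  have hQ := hPQ.symm.pos
  have hΩm := Ω.isOpen.measurableSet
  -- Truncating `u = g(ρ)` at its minimum `g 0` removes the region of small `ρ`, where `ξ` need not
  -- be integrable for Lebesgue measure.
  have hw : ∀ n, IsWeakGradient Ω (fun x => rampPrimitive (g 0) n (u x))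
      (fun x => ramp (g 0) n (u x) • ξ x) := fun n =>
    hξ.comp hB (hasDerivAt_rampPrimitive _ n) (continuous_ramp _ n) (abs_ramp_le_one _ n)
  have hHc : ∀ n, Continuous (rampPrimitive (g 0) n) := fun n =>
    continuous_iff_continuousAt.2 fun s => (hasDerivAt_rampPrimitive _ n s).continuousAt
  have hwB : ∀ n, ∀ x ∈ Ω, |rampPrimitive (g 0) n (u x)| ≤ |g 0| + (B + |g 0|) := fun n x hx => by
    refine (abs_rampPrimitive_le _ _ _).trans ?_
    gcongr
    exact (abs_sub _ _).trans (by linarith [hB x hx])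
  have hξi := (ρ.integrable_measure_iff _).1 (integrable_norm_rpow_ofReal hQ hξQ)
  have hζ : ∀ n, MemLp (fun x => ramp (g 0) n (u x) • ξ x) (ENNReal.ofReal Q)
      (volume.restrict (Ω : Set (EuclideanSpace ℝ (Fin N)))) := by
    intro n
    have hmeas : AEStronglyMeasurable (fun x => ramp (g 0) n (u x) • ξ x)
        (volume.restrict (Ω : Set (EuclideanSpace ℝ (Fin N)))) :=
      ((continuous_ramp _ n).comp_aestronglyMeasurable hum).smul hξm
    -- The `- 1` in `ramp` makes it vanish on a neighbourhood of `g 0`, hence for all small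
    -- densities by continuity of `g`. Where it survives, `ρ ≥ ε`, so the `ρ`-weighted integral of
    -- `‖ξ‖^Q` controls the unweighted one.
    obtain ⟨ε, hε, hεg⟩ : ∃ ε > 0, ∀ s, 0 ≤ s → s < ε → ramp (g 0) n (g s) = 0 := by
      have h1 : ∀ᶠ s in 𝓝[Ici 0] (0 : ℝ), (n : ℝ) * (g s - g 0) < 1 := by
        have h2 : Tendsto (fun s => (n : ℝ) * (g s - g 0)) (𝓝[Ici 0] (0 : ℝ))
            (𝓝 ((n : ℝ) * (g 0 - g 0))) :=
          ((hgc 0 self_mem_Ici).sub tendsto_const_nhds).const_mul _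
        exact h2.eventually (gt_mem_nhds (by simp))
      obtain ⟨ε, hε, h2⟩ := Metric.mem_nhdsWithin_iff.1 h1
      refine ⟨ε, hε, fun s hs hsε => ?_⟩
      have h3 : (n : ℝ) * (g s - g 0) < 1 := h2 ⟨by simpa [abs_of_nonneg hs] using hsε, hs⟩
      rw [ramp, max_eq_left (by linarith), min_eq_right zero_le_one]
    rw [memLp_ofReal_iff_integrable hQ hmeas]
    refine Integrable.mono' (hξi.const_mul ε⁻¹)
      (hmeas.norm.aemeasurable.pow_const _).aestronglyMeasurable ?_
    filter_upwards [ae_restrict_mem hΩm] with x hx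
    have h0 := ρ.nonneg x hx
    rw [Real.norm_of_nonneg (by positivity), norm_smul]
    by_cases hxε : ρ.toFun x < ε
    · simp only [u, hεg _ h0 hxε, norm_zero, zero_mul, Real.zero_rpow hQ.ne']
      simp only [smul_eq_mul]
      positivity
    · rw [not_lt] at hxε
      calc (‖ramp (g 0) n (u x)‖ * ‖ξ x‖) ^ Q ≤ ‖ξ x‖ ^ Q := by
            refine Real.rpow_le_rpow (by positivity) ?_ hQ.le
            exact mul_le_of_le_one_left (norm_nonneg _) (abs_ramp_le_one _ _ _)
        _ ≤ ε⁻¹ * (ρ.toFun x • ‖ξ x‖ ^ Q) := by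
            rw [smul_eq_mul, ← mul_assoc]
            refine le_mul_of_one_le_left (by positivity) ?_
            rw [inv_mul_eq_div]
            exact (one_le_div hε).2 hxε
  have hm := ρ.memLp_momentum hPQ.lt.le hv
  have hσ' : Integrable ((Ω : Set (EuclideanSpace ℝ (Fin N))).indicator σ) :=
    (integrable_indicator_iff hΩm).2 hσ
  have hdiv' : ∀ φ : 𝓓((⊤ : Opens (EuclideanSpace ℝ (Fin N))), ℝ),
      ∫ x, fderiv ℝ φ x (ρ.momentum v x) =
        ∫ x, (Ω : Set (EuclideanSpace ℝ (Fin N))).indicator σ x * φ x := by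
    intro φ
    have h1 := hdiv φ
    rw [ρ.integral_measure, ← integral_indicator hΩm, ← integral_indicator hΩm] at h1
    refine Eq.trans (integral_congr_ae (Eventually.of_forall fun x => ?_)) (h1.trans
      (integral_congr_ae (Eventually.of_forall fun x => ?_)))
    · by_cases hx : x ∈ (Ω : Set (EuclideanSpace ℝ (Fin N)))
      · simp only [Density.momentum, indicator_of_mem hx, map_smul]
      · simp only [Density.momentum, indicator_of_notMem hx, map_zero]
    · by_cases hx : x ∈ (Ω : Set (EuclideanSpace ℝ (Fin N)))
      · simp only [indicator_of_mem hx]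
      · simp only [indicator_of_notMem hx, zero_mul]
  have hid : ∀ n, ∫ x in (Ω : Set (EuclideanSpace ℝ (Fin N))),
      rampPrimitive (g 0) n (u x) * σ x =
      ∫ x in (Ω : Set (EuclideanSpace ℝ (Fin N))),
        ramp (g 0) n (u x) * (ρ.toFun x • inner ℝ (ξ x) (v x)) := by
    intro n
    have h1 := integral_mul_eq_integral_inner_of_div hΩb hΩc hne hPQ (hw n) (hwB n) (hζ n) hm
      (fun x hx => indicator_of_notMem hx _) hσ' hdiv'
    refine Eq.trans (setIntegral_congr_fun hΩm fun x hx => ?_) (h1.trans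
      (setIntegral_congr_fun hΩm fun x hx => ?_))
    · simp only [indicator_of_mem hx]
    · simp only [Density.momentum, indicator_of_mem hx, real_inner_smul_left,
        real_inner_smul_right, smul_eq_mul]
      ring
  have hleft : Tendsto (fun n => ∫ x in (Ω : Set (EuclideanSpace ℝ (Fin N))),
      rampPrimitive (g 0) n (u x) * σ x) atTop
      (𝓝 (∫ x in (Ω : Set (EuclideanSpace ℝ (Fin N))), u x * σ x)) := by
    refine tendsto_integral_of_dominated_convergence
      (fun x => (|g 0| + (B + |g 0|)) * |σ x|) ?_ (hσ.abs.const_mul _) ?_ ?_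
    · exact fun n => ((hHc n).comp_aestronglyMeasurable hum).mul hσ.1
    · intro n
      filter_upwards [ae_restrict_mem hΩm] with x hx
      rw [norm_mul]
      exact mul_le_mul_of_nonneg_right (hwB n x hx) (abs_nonneg _)
    · filter_upwards [ae_restrict_mem hΩm] with x hx
      exact (tendsto_rampPrimitive (hc x hx)).mul_const _
  have hin := (ρ.integrable_measure_iff _).1 (integrable_inner_of_memLp hPQ hv hξQ)
  have hright : Tendsto (fun n => ∫ x in (Ω : Set (EuclideanSpace ℝ (Fin N))),
      ramp (g 0) n (u x) * (ρ.toFun x • inner ℝ (ξ x) (v x))) atTop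
      (𝓝 (∫ x in (Ω : Set (EuclideanSpace ℝ (Fin N))), ρ.toFun x • inner ℝ (ξ x) (v x))) := by
    refine tendsto_integral_of_dominated_convergence
      (fun x => |ρ.toFun x • inner ℝ (ξ x) (v x)|) ?_ hin.abs ?_ ?_
    · exact fun n => ((continuous_ramp _ n).comp_aestronglyMeasurable hum).mul hin.1
    · refine fun n => Eventually.of_forall fun x => ?_
      rw [norm_mul]
      exact mul_le_of_le_one_left (norm_nonneg _) (abs_ramp_le_one _ _ _)
    -- The ramps tend to the indicator of `{u > g 0}`; nothing is lost on the complement because `ξ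
    -- = 0` almost everywhere there.
    · filter_upwards [ae_restrict_mem hΩm, hξ.ae_eq_zero_of_eq_lower_bound hB hc] with x hx hx0
      rcases (hc x hx).eq_or_lt with h | h
      · simp [hx0 h.symm]
      · have := (tendsto_ramp (g 0) (u x)).mul_const (ρ.toFun x • inner ℝ (ξ x) (v x))
        simpa only [h, if_true, one_mul] using this
  rw [ρ.integral_measure]
  exact tendsto_nhds_unique hleft (hright.congr fun n => (hid n).symm)

end Parts

/-! ### Differentiability of the energy along curves -/

section EnergyDerivative

open scoped ENNReal

variable {N : ℕ} {Ω : Opens (EuclideanSpace ℝ (Fin N))}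

/-- For a convex function the secant slope lies between the derivatives at the two endpoints. This
bounds the Taylor remainder by the oscillation of the first derivative. -/
theorem ConvexOn.abs_sub_sub_derivOnIci_mul_le {G : ℝ → ℝ} (hG : ConvexOn ℝ (Ici 0) G)
    (hd : DifferentiableOn ℝ G (Ici 0)) {a b : ℝ} (ha : 0 ≤ a) (hb : 0 ≤ b) :
    |G b - G a - derivOnIci G a * (b - a)| ≤ |derivOnIci G b - derivOnIci G a| * |b - a| := by
  have key : ∀ {a b : ℝ}, 0 ≤ a → 0 ≤ b → a < b →
      derivOnIci G a * (b - a) ≤ G b - G a ∧ G b - G a ≤ derivOnIci G b * (b - a) := by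
    intro a b ha hb hab
    have h1 := hG.derivWithin_le_slope ha hb hab (hd a ha)
    have h2 := hG.slope_le_derivWithin ha hb hab (hd b hb)
    rw [slope_def_field, le_div_iff₀ (sub_pos.2 hab)] at h1
    rw [slope_def_field, div_le_iff₀ (sub_pos.2 hab)] at h2
    exact ⟨h1, h2⟩
  rw [← abs_mul, abs_le]
  rcases lt_trichotomy a b with h | rfl | h
  · obtain ⟨h1, h2⟩ := key ha hb h
    have h3 : (derivOnIci G b - derivOnIci G a) * (b - a) ≤
        |(derivOnIci G b - derivOnIci G a) * (b - a)| := le_abs_self _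
    constructor <;> nlinarith
  · simp
  · obtain ⟨h1, h2⟩ := key hb ha h
    have h3 : (derivOnIci G b - derivOnIci G a) * (b - a) ≤
        |(derivOnIci G b - derivOnIci G a) * (b - a)| := le_abs_self _
    constructor <;> nlinarith

theorem Density.integrableOn_comp (ρ : Density Ω)
    (hΩb : Bornology.IsBounded (Ω : Set (EuclideanSpace ℝ (Fin N)))) {g : ℝ → ℝ}
    (hg : ContinuousOn g (Ici 0)) : IntegrableOn (fun x => g (ρ.toFun x)) Ω := by
  obtain ⟨M, hM⟩ := ρ.bounded
  obtain ⟨C, hC⟩ := (isCompact_Icc (a := (0 : ℝ)) (b := M)).exists_bound_of_continuousOn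
    (hg.mono Icc_subset_Ici_self)
  have hmeas : AEStronglyMeasurable (fun x => g (ρ.toFun x))
      (volume.restrict (Ω : Set (EuclideanSpace ℝ (Fin N)))) := by
    have h1 : ContinuousOn g (Ici 0) := hg
    have h2 : Measurable (fun s => g (max 0 s)) :=
      (hg.comp_continuous (continuous_const.max continuous_id)
        fun s => le_max_left 0 s).measurable
    refine ((h2.comp ρ.measurable).aestronglyMeasurable).congr ?_
    filter_upwards [ae_restrict_mem Ω.isOpen.measurableSet] with x hx
    simp only [Function.comp_apply, max_eq_right (ρ.nonneg x hx)]
  refine IntegrableOn.of_bound hΩb.measure_lt_top hmeas C ?_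
  filter_upwards [ae_restrict_mem Ω.isOpen.measurableSet] with x hx
  exact hC _ ⟨ρ.nonneg x hx, hM x hx⟩

theorem Density.integrableOn_toFun (ρ : Density Ω)
    (hΩb : Bornology.IsBounded (Ω : Set (EuclideanSpace ℝ (Fin N)))) :
    IntegrableOn ρ.toFun Ω :=
  ρ.integrableOn_comp (g := id) hΩb continuousOn_id

/-- If densities converge in `L^1`, then `∫ |g(γ_t) - g(ρ)| |σ| → 0` for bounded continuous `g`. -/
theorem tendsto_integral_abs_comp_sub_mul
    (hΩb : Bornology.IsBounded (Ω : Set (EuclideanSpace ℝ (Fin N)))) {g : ℝ → ℝ}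
    (hgc : ContinuousOn g (Ici 0)) {γ : ℝ → Density Ω} {ρ : Density Ω} {B : ℝ}
    (hB : ∀ t ∈ Icc (0 : ℝ) 1, ∀ x ∈ Ω, |g ((γ t).toFun x)| ≤ B) (hBρ : ∀ x ∈ Ω, |g (ρ.toFun x)| ≤ B)
    {σ : EuclideanSpace ℝ (Fin N) → ℝ} (hσ : IntegrableOn σ Ω)
    (hlim : Tendsto (fun t : ℝ => ∫ x in (Ω : Set (EuclideanSpace ℝ (Fin N))),
      |(γ t).toFun x - ρ.toFun x|) (𝓝[>] 0) (𝓝 0)) :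
    Tendsto (fun t : ℝ => ∫ x in (Ω : Set (EuclideanSpace ℝ (Fin N))),
      |g ((γ t).toFun x) - g (ρ.toFun x)| * |σ x|) (𝓝[>] 0) (𝓝 0) := by
  have hΩm := Ω.isOpen.measurableSet
  -- `L¹` convergence gives almost everywhere convergence only along subsequences, which is enough
  -- for a limit along every sequence.
  refine tendsto_of_subseq_tendsto fun s hs => ?_
  have hi : ∀ t, IntegrableOn (fun x => (γ t).toFun x - ρ.toFun x) Ω := fun t =>
    ((γ t).integrableOn_toFun hΩb).sub (ρ.integrableOn_toFun hΩb)
  have hmeas : TendstoInMeasure (volume.restrict (Ω : Set (EuclideanSpace ℝ (Fin N))))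
      (fun n => (γ (s n)).toFun) atTop ρ.toFun := by
    refine tendstoInMeasure_of_tendsto_eLpNorm one_ne_zero
      (fun n => ((γ (s n)).integrableOn_toFun hΩb).1) (ρ.integrableOn_toFun hΩb).1 ?_
    have h1 := (ENNReal.tendsto_ofReal (hlim.comp hs))
    rw [ENNReal.ofReal_zero] at h1
    refine h1.congr fun n => ?_
    rw [eLpNorm_one_eq_lintegral_enorm]
    exact ofReal_integral_norm_eq_lintegral_enorm (hi (s n))
  obtain ⟨ns, hns, hae⟩ := hmeas.exists_seq_tendsto_ae
  refine ⟨ns, ?_⟩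
  have hs' : ∀ᶠ n in atTop, s (ns n) ∈ Icc (0 : ℝ) 1 := by
    refine (hs.comp hns.tendsto_atTop).eventually ?_
    filter_upwards [Ioc_mem_nhdsGT (zero_lt_one (α := ℝ))] with t ht using ⟨ht.1.le, ht.2⟩
  have h0 : (0 : ℝ) = ∫ _ in (Ω : Set (EuclideanSpace ℝ (Fin N))), (0 : ℝ) := by simp
  rw [h0]
  refine tendsto_integral_filter_of_dominated_convergence (fun x => (B + B) * |σ x|) ?_ ?_
    (hσ.abs.const_mul _) ?_
  · exact Eventually.of_forall fun n => (((γ _).integrableOn_comp hΩb hgc).1.sub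
      (ρ.integrableOn_comp hΩb hgc).1).norm.mul hσ.norm.1
  · filter_upwards [hs'] with n hn
    filter_upwards [ae_restrict_mem hΩm] with x hx
    rw [norm_mul, Real.norm_of_nonneg (abs_nonneg _), Real.norm_of_nonneg (abs_nonneg (σ x))]
    refine mul_le_mul_of_nonneg_right ((abs_sub _ _).trans ?_) (abs_nonneg _)
    exact add_le_add (hB _ hn x hx) (hBρ x hx)
  · filter_upwards [ae_restrict_mem hΩm, hae] with x hx hlim
    have h1 : Tendsto (fun n => g ((γ (s (ns n))).toFun x)) atTop (𝓝 (g (ρ.toFun x))) := by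
      refine (hgc _ (ρ.nonneg x hx)).tendsto.comp (tendsto_nhdsWithin_iff.2 ⟨hlim, ?_⟩)
      exact Eventually.of_forall fun n => (γ _).nonneg x hx
    have h2 := ((h1.sub_const (g (ρ.toFun x))).abs).mul_const |σ x|
    simpa using h2

/-- The derivative of the energy along a curve with initial velocity `σ ∈ L^1`. -/
theorem hasDerivWithinAt_energy
    (hΩb : Bornology.IsBounded (Ω : Set (EuclideanSpace ℝ (Fin N)))) {G : ℝ → ℝ}
    (hG : ConvexOn ℝ (Ici 0) G) (hd : DifferentiableOn ℝ G (Ici 0))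
    (hgc : ContinuousOn (derivOnIci G) (Ici 0)) {γ : ℝ → Density Ω} {ρ : Density Ω}
    (h0 : γ 0 = ρ) {M : ℝ} (hM : ∀ t ∈ Icc (0 : ℝ) 1, ∀ x ∈ Ω, (γ t).toFun x ≤ M)
    {σ : EuclideanSpace ℝ (Fin N) → ℝ} (hσ : IntegrableOn σ Ω)
    (hlim : Tendsto (fun t : ℝ => ∫ x in (Ω : Set (EuclideanSpace ℝ (Fin N))),
      |((γ t).toFun x - ρ.toFun x) / t - σ x|) (𝓝[>] 0) (𝓝 0)) :
    HasDerivWithinAt (fun t => energy G (γ t))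
      (∫ x in (Ω : Set (EuclideanSpace ℝ (Fin N))), derivOnIci G (ρ.toFun x) * σ x)
      (Icc 0 1) 0 := by
  set g := derivOnIci G
  have hΩm := Ω.isOpen.measurableSet
  obtain ⟨B, hB⟩ : ∃ B, ∀ s ∈ Icc (0 : ℝ) M, |g s| ≤ B :=
    (isCompact_Icc (a := (0 : ℝ)) (b := M)).exists_bound_of_continuousOn
      (hgc.mono Icc_subset_Ici_self)
  have hBγ : ∀ t ∈ Icc (0 : ℝ) 1, ∀ x ∈ Ω, |g ((γ t).toFun x)| ≤ B := fun t ht x hx =>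
    hB _ ⟨(γ t).nonneg x hx, hM t ht x hx⟩
  have hBρ : ∀ x ∈ Ω, |g (ρ.toFun x)| ≤ B := fun x hx => by
    have := hBγ 0 ⟨le_rfl, zero_le_one⟩ x hx
    rwa [h0] at this
  have hI : Ioc (0 : ℝ) 1 ∈ 𝓝[>] (0 : ℝ) := Ioc_mem_nhdsGT zero_lt_one
  have hDi : ∀ t, IntegrableOn (fun x => ((γ t).toFun x - ρ.toFun x) / t) Ω := fun t =>
    (((γ t).integrableOn_toFun hΩb).sub (ρ.integrableOn_toFun hΩb)).div_const t
  -- Since the difference quotients stay bounded in `L¹`, multiplying by `t` gives `γ t → ρ` in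
  -- `L¹`.
  have hL1 : Tendsto (fun t : ℝ => ∫ x in (Ω : Set (EuclideanSpace ℝ (Fin N))),
      |(γ t).toFun x - ρ.toFun x|) (𝓝[>] 0) (𝓝 0) := by
    have h1 : Tendsto (fun t : ℝ => t * ((∫ x in (Ω : Set (EuclideanSpace ℝ (Fin N))),
        |((γ t).toFun x - ρ.toFun x) / t - σ x|) +
        ∫ x in (Ω : Set (EuclideanSpace ℝ (Fin N))), |σ x|)) (𝓝[>] 0) (𝓝 0) := by
      have h2 : Tendsto (fun t : ℝ => t) (𝓝[>] 0) (𝓝 0) := nhdsWithin_le_nhds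
      simpa using h2.mul (hlim.add_const (∫ x in (Ω : Set (EuclideanSpace ℝ (Fin N))), |σ x|))
    refine squeeze_zero' (Eventually.of_forall fun t => integral_nonneg fun x => abs_nonneg _)
      ?_ h1
    filter_upwards [self_mem_nhdsWithin] with t ht
    have ht' : (0 : ℝ) < t := ht
    have hdiff : IntegrableOn (fun x => |((γ t).toFun x - ρ.toFun x) / t - σ x|) Ω :=
      ((hDi t).sub hσ).abs
    rw [← integral_add hdiff hσ.abs, ← integral_const_mul]
    refine integral_mono (((γ t).integrableOn_toFun hΩb).sub (ρ.integrableOn_toFun hΩb)).abs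
      ((hdiff.add hσ.abs).const_mul t) fun x => ?_
    have h3 : (γ t).toFun x - ρ.toFun x = t * (((γ t).toFun x - ρ.toFun x) / t) := by
      field_simp
    calc |(γ t).toFun x - ρ.toFun x| = t * |((γ t).toFun x - ρ.toFun x) / t| := by
          rw [← abs_of_pos ht', ← abs_mul, abs_of_pos ht', ← h3]
      _ ≤ t * (|((γ t).toFun x - ρ.toFun x) / t - σ x| + |σ x|) := by
          refine mul_le_mul_of_nonneg_left ?_ ht'.le
          simpa using abs_add_le (((γ t).toFun x - ρ.toFun x) / t - σ x) (σ x)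
  have hrem := tendsto_integral_abs_comp_sub_mul hΩb hgc hBγ hBρ hσ hL1
  -- Of the constant `3 * B`, one `B` bounds `g(ρ)` in the linear term, and `2 * B` bounds `|g(γ t)
  -- - g(ρ)|` where it multiplies the error of the difference quotient.
  have hbound : Tendsto (fun t : ℝ => 3 * B * (∫ x in (Ω : Set (EuclideanSpace ℝ (Fin N))),
      |((γ t).toFun x - ρ.toFun x) / t - σ x|) + ∫ x in (Ω : Set (EuclideanSpace ℝ (Fin N))),
      |g ((γ t).toFun x) - g (ρ.toFun x)| * |σ x|) (𝓝[>] 0) (𝓝 0) := by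
    simpa using (hlim.const_mul (3 * B)).add hrem
  rw [hasDerivWithinAt_iff_tendsto_slope]
  have hfilter : 𝓝[Icc (0 : ℝ) 1 \ {0}] 0 ≤ 𝓝[>] 0 :=
    nhdsWithin_mono _ fun t ht => lt_of_le_of_ne ht.1.1 (Ne.symm ht.2)
  refine Tendsto.mono_left ?_ hfilter
  rw [tendsto_iff_norm_sub_tendsto_zero]
  refine squeeze_zero' (Eventually.of_forall fun t => norm_nonneg _) ?_ hbound
  filter_upwards [hI] with t ht
  have ht' : 0 < t := ht.1
  have htI : t ∈ Icc (0 : ℝ) 1 := ⟨ht.1.le, ht.2⟩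
  have hGi : ∀ ρ : Density Ω, IntegrableOn (fun x => G (ρ.toFun x)) Ω := fun ρ =>
    ρ.integrableOn_comp hΩb hd.continuousOn
  have hgσ : IntegrableOn (fun x => g (ρ.toFun x) * σ x) Ω := by
    refine Integrable.bdd_mul (c := B) hσ (ρ.integrableOn_comp hΩb hgc).1 ?_
    filter_upwards [ae_restrict_mem hΩm] with x hx using hBρ x hx
  have hdiff : IntegrableOn (fun x => |((γ t).toFun x - ρ.toFun x) / t - σ x|) Ω :=
    ((hDi t).sub hσ).abs
  have hremi : IntegrableOn (fun x => |g ((γ t).toFun x) - g (ρ.toFun x)| * |σ x|) Ω := by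
    refine Integrable.bdd_mul (c := B + B) hσ.abs
      (((γ t).integrableOn_comp hΩb hgc).1.sub (ρ.integrableOn_comp hΩb hgc).1).norm ?_
    filter_upwards [ae_restrict_mem hΩm] with x hx
    rw [Real.norm_of_nonneg (abs_nonneg _)]
    exact (abs_sub _ _).trans (add_le_add (hBγ t htI x hx) (hBρ x hx))
  have hGd : IntegrableOn (fun x => (G ((γ t).toFun x) - G (ρ.toFun x)) / t) Ω :=
    ((hGi _).sub (hGi _)).div_const t
  have hslope : slope (fun t => energy G (γ t)) 0 t -
      ∫ x in (Ω : Set (EuclideanSpace ℝ (Fin N))), g (ρ.toFun x) * σ x =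
      ∫ x in (Ω : Set (EuclideanSpace ℝ (Fin N))),
        ((G ((γ t).toFun x) - G (ρ.toFun x)) / t - g (ρ.toFun x) * σ x) := by
    rw [integral_sub hGd hgσ, integral_div,
      integral_sub (hGi _) (hGi _), slope_def_field, sub_zero, h0]
    rfl
  rw [hslope, ← integral_const_mul, ← integral_add (hdiff.const_mul _) hremi]
  refine (norm_integral_le_integral_norm _).trans (integral_mono_ae
    (hGd.sub hgσ).norm ((hdiff.const_mul _).add hremi) ?_)
  filter_upwards [ae_restrict_mem hΩm] with x hx
  have hb := (γ t).nonneg x hx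
  have ha := ρ.nonneg x hx
  have h1 := hG.abs_sub_sub_derivOnIci_mul_le hd ha hb
  set b := (γ t).toFun x
  set a := ρ.toFun x
  have hga : |g a| ≤ B := hBρ x hx
  have hgb : |g b| ≤ B := hBγ t htI x hx
  have hgab : |g b - g a| ≤ 2 * B := (abs_sub _ _).trans (by linarith)
  have e1 : (G b - G a) / t - g a * σ x =
      (G b - G a - g a * (b - a)) / t + g a * ((b - a) / t - σ x) := by
    field_simp; ring
  have e2 : |(G b - G a - g a * (b - a)) / t| ≤ |g b - g a| * |(b - a) / t| := by
    rw [abs_div, abs_div, abs_of_pos ht', ← mul_div_assoc]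
    gcongr
  have e3 : |(b - a) / t| ≤ |(b - a) / t - σ x| + |σ x| := by
    simpa using abs_add_le ((b - a) / t - σ x) (σ x)
  have e4 := abs_nonneg ((b - a) / t - σ x)
  calc |(G b - G a) / t - g a * σ x|
      ≤ |(G b - G a - g a * (b - a)) / t| + |g a * ((b - a) / t - σ x)| := by
        rw [e1]; exact abs_add_le _ _
    _ ≤ |g b - g a| * (|(b - a) / t - σ x| + |σ x|) + B * |(b - a) / t - σ x| := by
        rw [abs_mul]
        gcongr
        exact e2.trans (by gcongr)
    _ ≤ 3 * B * |(b - a) / t - σ x| + |g b - g a| * |σ x| := by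
        have := mul_le_mul_of_nonneg_right hgab e4
        linarith

end EnergyDerivative

/-! ### The pointwise duality map `ξ ↦ |ξ|^{Q-2} ξ` -/

section PointwiseDuality

variable {H : Type*} [NormedAddCommGroup H] [InnerProductSpace ℝ H] {P Q : ℝ}

/-- The map `z ↦ |z|^{r-2} z`. -/
noncomputable def powMap (r : ℝ) (z : H) : H := ‖z‖ ^ (r - 2) • z

theorem norm_powMap {r : ℝ} (hr : 1 < r) (z : H) : ‖powMap r z‖ = ‖z‖ ^ (r - 1) := by
  rcases eq_or_ne z 0 with rfl | hz
  · simp [powMap, Real.zero_rpow (sub_pos.2 hr).ne']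
  · have : 0 < ‖z‖ := norm_pos_iff.2 hz
    rw [powMap, norm_smul, Real.norm_of_nonneg (by positivity), ← Real.rpow_add_one this.ne']
    ring_nf

theorem inner_powMap_self {r : ℝ} (hr : 1 < r) (z : H) : inner ℝ (powMap r z) z = ‖z‖ ^ r := by
  rcases eq_or_ne z 0 with rfl | hz
  · simp [powMap, Real.zero_rpow (by linarith : r ≠ 0)]
  · have : 0 < ‖z‖ := norm_pos_iff.2 hz
    rw [powMap, real_inner_smul_left, real_inner_self_eq_norm_sq, ← Real.rpow_natCast,
      ← Real.rpow_add this]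
    norm_num

theorem norm_powMap_rpow (hPQ : P.HolderConjugate Q) (z : H) : ‖powMap P z‖ ^ Q = ‖z‖ ^ P := by
  rw [norm_powMap hPQ.lt, ← Real.rpow_mul (norm_nonneg _), hPQ.sub_one_mul_conj]

theorem powMap_powMap (hPQ : P.HolderConjugate Q) (z : H) : powMap P (powMap Q z) = z := by
  rcases eq_or_ne z 0 with rfl | hz
  · simp [powMap]
  · have : 0 < ‖z‖ := norm_pos_iff.2 hz
    rw [powMap, norm_powMap hPQ.symm.lt, powMap, smul_smul, ← Real.rpow_mul this.le,
      ← Real.rpow_add this]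
    have h : (Q - 1) * (P - 2) + (Q - 2) = 0 := by
      have := hPQ.mul_eq_add
      nlinarith
    rw [h, Real.rpow_zero, one_smul]

theorem hasFDerivAt_norm_rpow_div {r : ℝ} (hr : 1 < r) (z : H) :
    HasFDerivAt (fun z : H => ‖z‖ ^ r / r) (innerSL ℝ (powMap r z)) z := by
  have h := (hasFDerivAt_norm_rpow z hr).mul_const r⁻¹
  have hr0 : r ≠ 0 := by linarith
  simp only [← div_eq_mul_inv] at h
  convert! h using 1
  rw [powMap, map_smul, smul_smul, ← mul_assoc, inv_mul_cancel₀ hr0, one_mul]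

/-- For `r < 2` the formula is singular at the origin; continuity comes from recognising the map as
the gradient of the `C¹` function `‖z‖^r / r`. -/
theorem continuous_powMap [CompleteSpace H] {r : ℝ} (hr : 1 < r) :
    Continuous (powMap r : H → H) := by
  have h1 : Continuous fun z : H => fderiv ℝ (fun z : H => ‖z‖ ^ r / r) z :=
    (((contDiff_norm_rpow (E := H) hr).div_const r)).continuous_fderiv one_ne_zero
  have h2 : (powMap r : H → H) = fun z =>
      (InnerProductSpace.toDual ℝ H).symm (fderiv ℝ (fun z : H => ‖z‖ ^ r / r) z) := by
    ext z
    rw [(hasFDerivAt_norm_rpow_div hr z).fderiv, eq_comm, LinearIsometryEquiv.symm_apply_eq]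
    rfl
  rw [h2]
  exact (LinearIsometryEquiv.continuous _).comp h1

theorem inner_le_young (hPQ : P.HolderConjugate Q) (ξ z : H) :
    inner ℝ ξ z ≤ ‖z‖ ^ P / P + ‖ξ‖ ^ Q / Q :=
  (real_inner_le_norm ξ z).trans ((mul_comm _ _).trans_le
    (Real.young_inequality_of_nonneg (norm_nonneg _) (norm_nonneg _) hPQ))

/-- The Young gap is nonnegative, so a zero is a minimum in `z`. The first order condition there is
`powMap P z = ξ`, which is inverted by `powMap Q`. -/
theorem eq_powMap_of_young_eq (hPQ : P.HolderConjugate Q) {ξ z : H}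
    (h : ‖z‖ ^ P / P + ‖ξ‖ ^ Q / Q - inner ℝ ξ z = 0) : z = powMap Q ξ := by
  have hmin : IsLocalMin (fun y : H => ‖y‖ ^ P / P - innerSL ℝ ξ y) z := by
    refine Eventually.of_forall fun y => ?_
    have := inner_le_young hPQ ξ y
    simp only [innerSL_apply_apply]
    linarith
  have h1 := hmin.hasFDerivAt_eq_zero
    ((hasFDerivAt_norm_rpow_div hPQ.lt z).sub (innerSL ℝ ξ).hasFDerivAt)
  rw [← map_sub] at h1
  have h2 : inner ℝ (powMap P z - ξ) (powMap P z - ξ) = 0 := by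
    rw [← innerSL_apply_apply (𝕜 := ℝ), h1]
    rfl
  rw [← sub_eq_zero.1 (inner_self_eq_zero.1 h2), powMap_powMap hPQ.symm]

/-- The gradient inequality of the convex function `‖·‖^P / P`, read off from Young's inequality
with `ξ = powMap P a`. -/
theorem norm_rpow_sub_le_inner_powMap (hPQ : P.HolderConjugate Q) (a b : H) :
    ‖a‖ ^ P / P - ‖b‖ ^ P / P ≤ inner ℝ (powMap P a) (a - b) := by
  have h := inner_le_young hPQ (powMap P a) b
  have h2 : ‖a‖ ^ P / P + ‖a‖ ^ P / Q = ‖a‖ ^ P := by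
    rw [div_eq_mul_inv, div_eq_mul_inv, ← mul_add, hPQ.inv_add_inv_eq_one, mul_one]
  rw [norm_powMap_rpow hPQ] at h
  rw [inner_sub_right, inner_powMap_self hPQ.lt]
  linarith

end PointwiseDuality

/-! ### The Finsler structure for a constant exponent -/

section FinslerFacts

variable {N : ℕ} {μ : Measure (EuclideanSpace ℝ (Fin N))}
  {p : EuclideanSpace ℝ (Fin N) → Ioi (1 : ℝ)} {hp : Measurable p} {P Q : ℝ}

/-- The `L^P` norm as a real number. -/
noncomputable def lpNormR (μ : Measure (EuclideanSpace ℝ (Fin N))) (P : ℝ)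
    (v : EuclideanSpace ℝ (Fin N) → EuclideanSpace ℝ (Fin N)) : ℝ :=
  (eLpNorm v (ENNReal.ofReal P) μ).toReal

theorem lpNormR_nonneg (v : EuclideanSpace ℝ (Fin N) → EuclideanSpace ℝ (Fin N)) :
    0 ≤ lpNormR μ P v := ENNReal.toReal_nonneg

theorem mem_varLp_iff (hP : 0 < P) (hpc : ∀ᵐ x ∂μ, (p x : ℝ) = P)
    (v : EuclideanSpace ℝ (Fin N) → EuclideanSpace ℝ (Fin N)) :
    v ∈ varLp μ p hp ↔ MemLp v (ENNReal.ofReal P) μ :=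
  memVarLp_iff_memLp hP hpc v

theorem varNorm_eq_lpNormR (hP : 0 < P) (hpc : ∀ᵐ x ∂μ, (p x : ℝ) = P) (v : varLp μ p hp) :
    varNorm μ (fun x => (p x : ℝ)) v.1 = lpNormR μ P v.1 :=
  varNorm_eq_toReal_eLpNorm hP hpc ((mem_varLp_iff hP hpc v.1).1 v.2)

variable [IsFiniteMeasure μ]

theorem varNorm_nonneg {X F : Type*} [MeasurableSpace X] [NormedAddCommGroup F] (μ : Measure X)
    (r : X → ℝ) (u : X → F) : 0 ≤ varNorm μ r u :=
  Real.sInf_nonneg fun _ hc => hc.1.le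

theorem tangentOf_apply (v : varLp μ p hp) (φ : 𝓓((⊤ : Opens (EuclideanSpace ℝ (Fin N))), ℝ)) :
    (tangentOf μ p hp v).1 φ = ∫ x, fderiv ℝ φ x (v.1 x) ∂μ :=
  negDiv_apply (MemVarLp.integrable (p := p) v.2) φ

theorem tangentOf_add (v w : varLp μ p hp) :
    tangentOf μ p hp (v + w) = tangentOf μ p hp v + tangentOf μ p hp w :=
  map_add (velocityMap μ p hp).rangeRestrict v w

theorem tangentOf_smul (c : ℝ) (v : varLp μ p hp) :
    tangentOf μ p hp (c • v) = c • tangentOf μ p hp v :=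
  map_smul (velocityMap μ p hp).rangeRestrict c v

theorem tangentOf_zero : tangentOf μ p hp 0 = 0 :=
  map_zero (velocityMap μ p hp).rangeRestrict

theorem exists_tangentOf_eq (ν : TangentSp μ p hp) : ∃ v, tangentOf μ p hp v = ν :=
  (velocityMap μ p hp).surjective_rangeRestrict ν

theorem tangentOf_congr_ae {v w : varLp μ p hp} (h : v.1 =ᵐ[μ] w.1) :
    tangentOf μ p hp v = tangentOf μ p hp w := by
  ext φ
  rw [tangentOf_apply, tangentOf_apply]
  exact integral_congr_ae (h.mono fun x hx => by simp only [hx])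

theorem exists_linearMap_tangentOf (L : varLp μ p hp →ₗ[ℝ] ℝ)
    (hL : ∀ v, tangentOf μ p hp v = 0 → L v = 0) :
    ∃ l : TangentSp μ p hp →ₗ[ℝ] ℝ, ∀ v, l (tangentOf μ p hp v) = L v := by
  have hker : LinearMap.ker (velocityMap μ p hp) ≤ LinearMap.ker L := fun v hv =>
    hL v (Subtype.ext hv)
  refine ⟨((LinearMap.ker (velocityMap μ p hp)).liftQ L hker).comp
    (velocityMap μ p hp).quotKerEquivRange.symm.toLinearMap, fun v => ?_⟩
  have h := (velocityMap μ p hp).quotKerEquivRange_symm_apply_image v (LinearMap.mem_range_self _ v)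
  have h' : (velocityMap μ p hp).quotKerEquivRange.symm (tangentOf μ p hp v) =
      (LinearMap.ker (velocityMap μ p hp)).mkQ v := h
  rw [LinearMap.comp_apply, LinearEquiv.coe_coe, h']
  rfl

theorem finslerMetric_nonneg (ν : TangentSp μ p hp) : 0 ≤ finslerMetric μ p hp ν :=
  Real.sInf_nonneg fun _ ⟨_, _, hr⟩ => hr ▸ varNorm_nonneg _ _ _

theorem finslerMetric_tangentOf_le (v : varLp μ p hp) :
    finslerMetric μ p hp (tangentOf μ p hp v) ≤ varNorm μ (fun x => (p x : ℝ)) v.1 :=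
  csInf_le ⟨0, fun _ ⟨_, _, hr⟩ => hr ▸ varNorm_nonneg _ _ _⟩ ⟨v, rfl, rfl⟩

theorem abs_le_mul_finslerMetric {l : TangentSp μ p hp →ₗ[ℝ] ℝ} {C : ℝ} (hC : 0 ≤ C)
    (h : ∀ v, |l (tangentOf μ p hp v)| ≤ C * varNorm μ (fun x => (p x : ℝ)) v.1)
    (ν : TangentSp μ p hp) : |l ν| ≤ C * finslerMetric μ p hp ν := by
  obtain ⟨v, rfl⟩ := exists_tangentOf_eq ν
  rcases hC.eq_or_lt with rfl | hC
  · simpa using h v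
  · rw [← div_le_iff₀' hC]
    refine le_csInf ⟨_, v, rfl, rfl⟩ ?_
    rintro r ⟨w, hw, rfl⟩
    rw [div_le_iff₀' hC, ← hw]
    exact h w

theorem IsCotangent.abs_le {l : TangentSp μ p hp →ₗ[ℝ] ℝ} (hl : IsCotangent μ p hp l)
    (ν : TangentSp μ p hp) : |l ν| ≤ cotangentNorm μ p hp l * finslerMetric μ p hp ν := by
  obtain ⟨C, hC⟩ := hl
  have hmem : |C| ∈ {C : ℝ | 0 ≤ C ∧ ∀ ν, |l ν| ≤ C * finslerMetric μ p hp ν} :=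
    ⟨abs_nonneg C, fun ν => (hC ν).trans
      (mul_le_mul_of_nonneg_right (le_abs_self C) (finslerMetric_nonneg ν))⟩
  rcases (finslerMetric_nonneg ν).eq_or_lt with h | h
  · have := hC ν
    rw [← h, mul_zero] at this ⊢
    exact this
  · rw [← div_le_iff₀ h]
    exact le_csInf ⟨_, hmem⟩ fun C' hC' => (div_le_iff₀ h).2 (hC'.2 ν)

/-- For a constant exponent the minimized integral is `‖W‖^P / P`, an increasing function of the
norm. -/
theorem isOptimalVelocity_iff (hP : 0 < P) (hpc : ∀ᵐ x ∂μ, (p x : ℝ) = P) (ν : TangentSp μ p hp)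
    (V : varLp μ p hp) :
    IsOptimalVelocity μ p hp ν V ↔ tangentOf μ p hp V = ν ∧ ∀ W : varLp μ p hp,
      tangentOf μ p hp W = ν → lpNormR μ P V.1 ≤ lpNormR μ P W.1 := by
  have key : ∀ W : varLp μ p hp,
      ∫⁻ x, ENNReal.ofReal (‖W.1 x‖ ^ (p x : ℝ) / (p x : ℝ)) ∂μ =
        ENNReal.ofReal (lpNormR μ P W.1 ^ P / P) := by
    intro W
    have hW := (mem_varLp_iff hP hpc W.1).1 W.2
    have h1 : ∫⁻ x, ENNReal.ofReal (‖W.1 x‖ ^ (p x : ℝ) / (p x : ℝ)) ∂μ =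
        ∫⁻ x, ENNReal.ofReal (‖W.1 x‖ ^ P / P) ∂μ :=
      lintegral_congr_ae (hpc.mono fun x hx => by simp only [hx])
    rw [h1, ← ofReal_integral_eq_lintegral_ofReal
      ((integrable_norm_rpow_ofReal hP hW).div_const P)
      (Eventually.of_forall fun x => by positivity), integral_div, lpNormR,
      eLpNorm_toReal_rpow_eq_integral hP hW]
  refine and_congr_right fun _ => forall_congr' fun W => imp_congr_right fun _ => ?_
  have hV0 := lpNormR_nonneg (μ := μ) (P := P) V.1
  have hW0 := lpNormR_nonneg (μ := μ) (P := P) W.1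
  rw [key, key, ENNReal.ofReal_le_ofReal_iff (by positivity), div_le_div_iff_of_pos_right hP,
    Real.rpow_le_rpow_iff hV0 hW0 hP]

/-- The duality map when the normalization function is compatible with the constant exponent. -/
theorem mem_dualityMap_iff (hPQ : P.HolderConjugate Q) (hpc : ∀ᵐ x ∂μ, (p x : ℝ) = P) {θ : ℝ → ℝ}
    (hθ : ∀ V : EuclideanSpace ℝ (Fin N) → EuclideanSpace ℝ (Fin N),
      MemVarLp μ (fun x => (p x : ℝ)) V → θ (varNorm μ (fun x => (p x : ℝ)) V) =
        varNorm μ (conjExp p) (fun x => ‖V x‖ ^ ((p x : ℝ) - 1)))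
    (ν : TangentSp μ p hp) (l : TangentSp μ p hp →ₗ[ℝ] ℝ) :
    l ∈ dualityMap μ p hp θ ν ↔ IsCotangent μ p hp l ∧ ((ν = 0 ∧ l = 0) ∨
      (ν ≠ 0 ∧ ∃ V : varLp μ p hp, IsOptimalVelocity μ p hp ν V ∧
        l ν = lpNormR μ P V.1 ^ (P - 1) * lpNormR μ P V.1 ∧
        cotangentNorm μ p hp l = lpNormR μ P V.1 ^ (P - 1))) := by
  have key : ∀ V : varLp μ p hp,
      θ (varNorm μ (fun x => (p x : ℝ)) V.1) = lpNormR μ P V.1 ^ (P - 1) := fun V => by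
    rw [hθ V.1 V.2]
    exact varNorm_conjExp_rpow hPQ hpc ((mem_varLp_iff hPQ.pos hpc V.1).1 V.2)
  rw [dualityMap, Set.mem_ofPred_eq]
  refine and_congr_right fun _ => or_congr_right (and_congr_right fun _ =>
    exists_congr fun V => and_congr_right fun _ => ?_)
  -- Compatibility of `θ` makes the last condition in the definition of the duality map automatic.
  rw [← hθ V.1 V.2, key, varNorm_eq_lpNormR hPQ.pos hpc]
  simp

end FinslerFacts

/-! ### The duality map at the gradient -/

section Duality

variable {N : ℕ} {μ : Measure (EuclideanSpace ℝ (Fin N))}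
  {p : EuclideanSpace ℝ (Fin N) → Ioi (1 : ℝ)} {hp : Measurable p} {P Q : ℝ}
  {ξ : EuclideanSpace ℝ (Fin N) → EuclideanSpace ℝ (Fin N)}

theorem qFlux_ae_eq (hPQ : P.HolderConjugate Q) (hpc : ∀ᵐ x ∂μ, (p x : ℝ) = P) :
    qFlux p ξ =ᵐ[μ] fun x => powMap Q (ξ x) :=
  (conjExp_ae_eq hPQ hpc).mono fun x hx => by simp only [qFlux, powMap, hx]

theorem memLp_powMap (hPQ : P.HolderConjugate Q) (hξ : MemLp ξ (ENNReal.ofReal Q) μ) :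
    MemLp (fun x => powMap Q (ξ x)) (ENNReal.ofReal P) μ := by
  rw [memLp_ofReal_iff_integrable hPQ.pos
    ((continuous_powMap hPQ.symm.lt).comp_aestronglyMeasurable hξ.1)]
  simpa only [norm_powMap_rpow hPQ.symm] using integrable_norm_rpow_ofReal hPQ.symm.pos hξ

theorem qFlux_mem_varLp (hPQ : P.HolderConjugate Q) (hpc : ∀ᵐ x ∂μ, (p x : ℝ) = P)
    (hξ : MemLp ξ (ENNReal.ofReal Q) μ) : qFlux p ξ ∈ varLp μ p hp :=
  (mem_varLp_iff hPQ.pos hpc _).2 ((memLp_powMap hPQ hξ).ae_eq (qFlux_ae_eq hPQ hpc).symm)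

theorem lpNormR_rpow_eq (hPQ : P.HolderConjugate Q) (hpc : ∀ᵐ x ∂μ, (p x : ℝ) = P)
    (hξ : MemLp ξ (ENNReal.ofReal Q) μ) :
    lpNormR μ P (qFlux p ξ) ^ P = ∫ x, inner ℝ (ξ x) (qFlux p ξ x) ∂μ := by
  have hV := (memLp_powMap hPQ hξ).ae_eq (qFlux_ae_eq hPQ hpc).symm
  rw [lpNormR, eLpNorm_toReal_rpow_eq_integral hPQ.pos hV]
  refine integral_congr_ae ((qFlux_ae_eq (ξ := ξ) hPQ hpc).mono fun x hx => ?_)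
  simp only [hx]
  rw [norm_powMap_rpow hPQ.symm, real_inner_comm, inner_powMap_self hPQ.symm.lt]

/-- For `V = |ξ|^(Q-2) ξ` one has `|ξ|^Q = |V|^P` pointwise; integrating and using `(P-1)Q = P`
gives the relation between the norms. -/
theorem lpNormR_gradient_eq (hPQ : P.HolderConjugate Q) (hpc : ∀ᵐ x ∂μ, (p x : ℝ) = P)
    (hξ : MemLp ξ (ENNReal.ofReal Q) μ) :
    lpNormR μ Q ξ = lpNormR μ P (qFlux p ξ) ^ (P - 1) := by
  have hQ := hPQ.symm.pos
  have h0 := lpNormR_nonneg (μ := μ) (P := P) (qFlux p ξ)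
  refine Real.rpow_left_injOn hQ.ne' (lpNormR_nonneg ξ) (Real.rpow_nonneg h0 _) ?_
  simp only
  rw [← Real.rpow_mul h0, hPQ.sub_one_mul_conj, lpNormR_rpow_eq hPQ hpc hξ, lpNormR,
    eLpNorm_toReal_rpow_eq_integral hQ hξ]
  refine integral_congr_ae ((qFlux_ae_eq (ξ := ξ) hPQ hpc).mono fun x hx => ?_)
  simp only [hx]
  rw [real_inner_comm, inner_powMap_self hPQ.symm.lt]

variable [IsFiniteMeasure μ] {l : TangentSp μ p hp →ₗ[ℝ] ℝ}

theorem abs_apply_tangentOf_le (hPQ : P.HolderConjugate Q) (hpc : ∀ᵐ x ∂μ, (p x : ℝ) = P)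
    (hξ : MemLp ξ (ENNReal.ofReal Q) μ)
    (hl : ∀ v, l (tangentOf μ p hp v) = ∫ x, inner ℝ (ξ x) (v.1 x) ∂μ) (ν : TangentSp μ p hp) :
    |l ν| ≤ lpNormR μ Q ξ * finslerMetric μ p hp ν := by
  refine abs_le_mul_finslerMetric (lpNormR_nonneg ξ) (fun v => ?_) ν
  rw [hl, varNorm_eq_lpNormR hPQ.pos hpc]
  exact abs_integral_inner_le hPQ ((mem_varLp_iff hPQ.pos hpc v.1).1 v.2) hξ

theorem isCotangent_of_integral_inner (hPQ : P.HolderConjugate Q) (hpc : ∀ᵐ x ∂μ, (p x : ℝ) = P)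
    (hξ : MemLp ξ (ENNReal.ofReal Q) μ)
    (hl : ∀ v, l (tangentOf μ p hp v) = ∫ x, inner ℝ (ξ x) (v.1 x) ∂μ) : IsCotangent μ p hp l :=
  ⟨_, abs_apply_tangentOf_le hPQ hpc hξ hl⟩

/-- The form `l` calibrates `V = |ξ|^(Q-2) ξ`: any competitor `W` satisfies `‖V‖^P = l(ν) = ∫ ξ·W ≤
‖ξ‖_Q ‖W‖ = ‖V‖^(P-1) ‖W‖`. -/
theorem isOptimalVelocity_qFlux (hPQ : P.HolderConjugate Q) (hpc : ∀ᵐ x ∂μ, (p x : ℝ) = P)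
    (hξ : MemLp ξ (ENNReal.ofReal Q) μ)
    (hl : ∀ v, l (tangentOf μ p hp v) = ∫ x, inner ℝ (ξ x) (v.1 x) ∂μ)
    (hV : qFlux p ξ ∈ varLp μ p hp) :
    IsOptimalVelocity μ p hp (tangentOf μ p hp ⟨qFlux p ξ, hV⟩) ⟨qFlux p ξ, hV⟩ := by
  rw [isOptimalVelocity_iff hPQ.pos hpc]
  refine ⟨rfl, fun W hW => ?_⟩
  have h1 : lpNormR μ P (qFlux p ξ) ^ P = ∫ x, inner ℝ (ξ x) (W.1 x) ∂μ := by
    rw [lpNormR_rpow_eq hPQ hpc hξ, ← hl W, hW, hl]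
  have h2 := (le_abs_self _).trans
    (abs_integral_inner_le hPQ ((mem_varLp_iff hPQ.pos hpc W.1).1 W.2) hξ)
  rw [← h1] at h2
  change _ ≤ lpNormR μ Q ξ * lpNormR μ P W.1 at h2
  rw [lpNormR_gradient_eq hPQ hpc hξ] at h2
  rcases (lpNormR_nonneg (μ := μ) (P := P) (qFlux p ξ)).eq_or_lt with h | h
  · change lpNormR μ P (qFlux p ξ) ≤ _
    rw [← h]
    exact lpNormR_nonneg _
  · have h3 : lpNormR μ P (qFlux p ξ) ^ P =
        lpNormR μ P (qFlux p ξ) ^ (P - 1) * lpNormR μ P (qFlux p ξ) := by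
      rw [← Real.rpow_add_one h.ne', sub_add_cancel]
    rw [h3] at h2
    exact le_of_mul_le_mul_left h2 (Real.rpow_pos_of_pos h _)

theorem apply_tangentOf_qFlux (hPQ : P.HolderConjugate Q) (hpc : ∀ᵐ x ∂μ, (p x : ℝ) = P)
    (hξ : MemLp ξ (ENNReal.ofReal Q) μ)
    (hl : ∀ v, l (tangentOf μ p hp v) = ∫ x, inner ℝ (ξ x) (v.1 x) ∂μ)
    (hV : qFlux p ξ ∈ varLp μ p hp) :
    l (tangentOf μ p hp ⟨qFlux p ξ, hV⟩) = lpNormR μ P (qFlux p ξ) ^ P := by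
  rw [hl, lpNormR_rpow_eq hPQ hpc hξ]

/-- Hölder gives the upper bound. Evaluating at `V = |ξ|^(Q-2) ξ`, whose Finsler length is at most
`‖V‖` while `l` takes the value `‖V‖^P`, gives the lower bound. -/
theorem cotangentNorm_eq (hPQ : P.HolderConjugate Q) (hpc : ∀ᵐ x ∂μ, (p x : ℝ) = P)
    (hξ : MemLp ξ (ENNReal.ofReal Q) μ)
    (hl : ∀ v, l (tangentOf μ p hp v) = ∫ x, inner ℝ (ξ x) (v.1 x) ∂μ) :
    cotangentNorm μ p hp l = lpNormR μ P (qFlux p ξ) ^ (P - 1) := by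
  have hV : qFlux p ξ ∈ varLp μ p hp := qFlux_mem_varLp hPQ hpc hξ
  have hmem : lpNormR μ Q ξ ∈ {C : ℝ | 0 ≤ C ∧ ∀ ν, |l ν| ≤ C * finslerMetric μ p hp ν} :=
    ⟨lpNormR_nonneg ξ, abs_apply_tangentOf_le hPQ hpc hξ hl⟩
  rw [lpNormR_gradient_eq hPQ hpc hξ] at hmem
  refine le_antisymm (csInf_le ⟨0, fun _ hC => hC.1⟩ hmem) (le_csInf ⟨_, hmem⟩ ?_)
  rintro C ⟨hC0, hC⟩
  rcases (lpNormR_nonneg (μ := μ) (P := P) (qFlux p ξ)).eq_or_lt with h | h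
  · rw [← h, Real.zero_rpow (sub_pos.2 hPQ.lt).ne']
    exact hC0
  · have h1 := (le_abs_self _).trans (hC (tangentOf μ p hp ⟨qFlux p ξ, hV⟩))
    rw [apply_tangentOf_qFlux hPQ hpc hξ hl] at h1
    have h2 := finslerMetric_tangentOf_le (hp := hp) (μ := μ) ⟨qFlux p ξ, hV⟩
    rw [varNorm_eq_lpNormR hPQ.pos hpc] at h2
    have h3 := h1.trans (mul_le_mul_of_nonneg_left h2 hC0)
    have h4 : lpNormR μ P (qFlux p ξ) ^ P =
        lpNormR μ P (qFlux p ξ) ^ (P - 1) * lpNormR μ P (qFlux p ξ) := by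
      rw [← Real.rpow_add_one h.ne', sub_add_cancel]
    rw [h4] at h3
    exact le_of_mul_le_mul_right h3 h

/-- A linear form dominated by the norm and touching it at `V` is the derivative of the norm. -/
theorem le_integral_inner_of_touching (hPQ : P.HolderConjugate Q) (hpc : ∀ᵐ x ∂μ, (p x : ℝ) = P)
    (V w : varLp μ p hp)
    (hl : l (tangentOf μ p hp V) = lpNormR μ P V.1 ^ P)
    (hle : ∀ ν, l ν ≤ lpNormR μ P V.1 ^ (P - 1) * finslerMetric μ p hp ν) :
    l (tangentOf μ p hp w) ≤ ∫ x, inner ℝ (powMap P (V.1 x)) (w.1 x) ∂μ := by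
  have hP := hPQ.pos
  have hQ := hPQ.symm.pos
  have hV := (mem_varLp_iff hP hpc V.1).1 V.2
  have hw := (mem_varLp_iff hP hpc w.1).1 w.2
  have hcont := continuous_powMap (H := EuclideanSpace ℝ (Fin N)) hPQ.lt
  have hmem : ∀ t : ℝ, MemLp (fun x => V.1 x + t • w.1 x) (ENNReal.ofReal P) μ := fun t =>
    hV.add (hw.const_smul t)
  have hint : ∀ t : ℝ, Integrable
      (fun x => inner ℝ (powMap P (V.1 x + t • w.1 x)) (w.1 x)) μ := fun t =>
    integrable_inner_of_memLp hPQ hw (memLp_powMap hPQ.symm (hmem t))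
  -- Domination at `V + t w`, equality at `V` and Young's inequality give `t l(w) ≤ ‖V + t w‖^P / P
  -- - ‖V‖^P / P`. The gradient inequality at `V + t w` bounds the right side by `t` times an
  -- integral, and `t` cancels.
  have hstep : ∀ t : ℝ, 0 < t →
      l (tangentOf μ p hp w) ≤ ∫ x, inner ℝ (powMap P (V.1 x + t • w.1 x)) (w.1 x) ∂μ := by
    intro t ht
    set A := lpNormR μ P V.1
    set D := lpNormR μ P (fun x => V.1 x + t • w.1 x)
    have hA : 0 ≤ A := lpNormR_nonneg _
    have hD : 0 ≤ D := lpNormR_nonneg _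
    have h1 : l (tangentOf μ p hp (V + t • w)) = A ^ P + t * l (tangentOf μ p hp w) := by
      rw [tangentOf_add, tangentOf_smul, map_add, map_smul, hl, smul_eq_mul]
    have h2 := finslerMetric_tangentOf_le (V + t • w)
    rw [varNorm_eq_lpNormR hP hpc] at h2
    have h3 : l (tangentOf μ p hp (V + t • w)) ≤ A ^ (P - 1) * D :=
      (hle _).trans (mul_le_mul_of_nonneg_left h2 (Real.rpow_nonneg hA _))
    have h4 : A ^ (P - 1) * D ≤ A ^ P / Q + D ^ P / P := by
      have := Real.young_inequality_of_nonneg (Real.rpow_nonneg hA (P - 1)) hD hPQ.symm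
      rwa [← Real.rpow_mul hA, hPQ.sub_one_mul_conj] at this
    have h5 : A ^ P / P + A ^ P / Q = A ^ P := by
      rw [div_eq_mul_inv, div_eq_mul_inv, ← mul_add, hPQ.inv_add_inv_eq_one, mul_one]
    have h6 : t * l (tangentOf μ p hp w) ≤ D ^ P / P - A ^ P / P := by linarith
    have h7 : D ^ P / P - A ^ P / P =
        ∫ x, (‖V.1 x + t • w.1 x‖ ^ P / P - ‖V.1 x‖ ^ P / P) ∂μ := by
      rw [integral_sub ((integrable_norm_rpow_ofReal hP (hmem t)).div_const P)
        ((integrable_norm_rpow_ofReal hP hV).div_const P), integral_div, integral_div,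
        ← eLpNorm_toReal_rpow_eq_integral hP (hmem t), ← eLpNorm_toReal_rpow_eq_integral hP hV]
      rfl
    have h8 : ∫ x, (‖V.1 x + t • w.1 x‖ ^ P / P - ‖V.1 x‖ ^ P / P) ∂μ ≤
        ∫ x, t * inner ℝ (powMap P (V.1 x + t • w.1 x)) (w.1 x) ∂μ := by
      refine integral_mono (((integrable_norm_rpow_ofReal hP (hmem t)).div_const P).sub
        ((integrable_norm_rpow_ofReal hP hV).div_const P)) ((hint t).const_mul t) fun x => ?_
      have := norm_rpow_sub_le_inner_powMap hPQ (V.1 x + t • w.1 x) (V.1 x)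
      rwa [add_sub_cancel_left, real_inner_smul_right] at this
    rw [integral_const_mul] at h8
    exact le_of_mul_le_mul_left (by linarith) ht
  -- As `t = 1/(n+1)` tends to zero the integrands are dominated by `(‖V‖ + ‖w‖)^P`.
  have hlim : Tendsto (fun n : ℕ => ∫ x, inner ℝ
      (powMap P (V.1 x + (1 / ((n : ℝ) + 1)) • w.1 x)) (w.1 x) ∂μ) atTop
      (𝓝 (∫ x, inner ℝ (powMap P (V.1 x)) (w.1 x) ∂μ)) := by
    have hdom : MemLp (fun x => ‖V.1 x‖ + ‖w.1 x‖) (ENNReal.ofReal P) μ := hV.norm.add hw.norm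
    refine tendsto_integral_of_dominated_convergence (fun x => ‖‖V.1 x‖ + ‖w.1 x‖‖ ^ P)
      (fun n => (hint _).1) (integrable_norm_rpow_ofReal hP hdom) (fun n => ?_) ?_
    · refine Eventually.of_forall fun x => ?_
      set a := V.1 x
      set b := w.1 x
      set t : ℝ := 1 / ((n : ℝ) + 1)
      have ht0 : 0 ≤ t := by positivity
      have ht1 : t ≤ 1 := by
        rw [div_le_one (by positivity)]
        linarith [Nat.cast_nonneg (α := ℝ) n]
      have hs : 0 ≤ ‖a‖ + ‖b‖ := by positivity
      rw [Real.norm_of_nonneg hs]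
      have h1 : ‖a + t • b‖ ≤ ‖a‖ + ‖b‖ := by
        refine (norm_add_le _ _).trans ?_
        rw [norm_smul, Real.norm_of_nonneg ht0]
        gcongr
        exact mul_le_of_le_one_left (norm_nonneg _) ht1
      calc ‖inner ℝ (powMap P (a + t • b)) b‖ ≤ ‖powMap P (a + t • b)‖ * ‖b‖ :=
            norm_inner_le_norm _ _
        _ ≤ (‖a‖ + ‖b‖) ^ (P - 1) * (‖a‖ + ‖b‖) := by
            rw [norm_powMap hPQ.lt]
            gcongr
            · exact (sub_pos.2 hPQ.lt).le
            · linarith [norm_nonneg a]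
        _ = (‖a‖ + ‖b‖) ^ P := by
            rcases hs.eq_or_lt with h | h
            · rw [← h, mul_zero, Real.zero_rpow hP.ne']
            · rw [← Real.rpow_add_one h.ne', sub_add_cancel]
    · refine Eventually.of_forall fun x => ?_
      have h1 : Tendsto (fun n : ℕ => V.1 x + (1 / ((n : ℝ) + 1)) • w.1 x) atTop
          (𝓝 (V.1 x)) := by
        simpa using ((tendsto_one_div_add_atTop_nhds_zero_nat (𝕜 := ℝ)).smul_const
          (w.1 x)).const_add (V.1 x)
      exact ((hcont.tendsto _).comp h1).inner tendsto_const_nhds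
  exact ge_of_tendsto hlim (Eventually.of_forall fun n => hstep _ (by positivity))

/-- If `l = ∫ ξ · v dμ`, then `J_θ(ν) = {l}` exactly for `ν = -div(μ |ξ|^{q-2} ξ)`. -/
theorem dualityMap_eq_singleton_iff (hPQ : P.HolderConjugate Q) (hpc : ∀ᵐ x ∂μ, (p x : ℝ) = P)
    {θ : ℝ → ℝ} (hθ : ∀ V : EuclideanSpace ℝ (Fin N) → EuclideanSpace ℝ (Fin N),
      MemVarLp μ (fun x => (p x : ℝ)) V → θ (varNorm μ (fun x => (p x : ℝ)) V) =
        varNorm μ (conjExp p) (fun x => ‖V x‖ ^ ((p x : ℝ) - 1)))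
    (hξ : MemLp ξ (ENNReal.ofReal Q) μ)
    (hl : ∀ v, l (tangentOf μ p hp v) = ∫ x, inner ℝ (ξ x) (v.1 x) ∂μ)
    (hV : qFlux p ξ ∈ varLp μ p hp) (ν : TangentSp μ p hp) :
    dualityMap μ p hp θ ν = {l} ↔ ν = tangentOf μ p hp ⟨qFlux p ξ, hV⟩ := by
  have hP := hPQ.pos
  have hN0 := lpNormR_nonneg (μ := μ) (P := P) (qFlux p ξ)
  have hlV := apply_tangentOf_qFlux hPQ hpc hξ hl hV
  have hlP : MemLp (qFlux p ξ) (ENNReal.ofReal P) μ := (mem_varLp_iff hP hpc _).1 hV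
  have hcot := isCotangent_of_integral_inner hPQ hpc hξ hl
  have hrpow : ∀ s : ℝ, 0 ≤ s → s ^ (P - 1) * s = s ^ P := fun s hs => by
    rcases hs.eq_or_lt with h | h
    · rw [← h, mul_zero, Real.zero_rpow hP.ne']
    · rw [← Real.rpow_add_one h.ne', sub_add_cancel]
  -- The degenerate case: `l(ν) = ‖V‖^P = 0` makes `V`, hence `ν`, and by the norm bound also `l`,
  -- vanish. This matches the zero branch of the duality map with the nonzero one.
  have hzero : l (tangentOf μ p hp ⟨qFlux p ξ, hV⟩) = 0 →
      l = 0 ∧ tangentOf μ p hp ⟨qFlux p ξ, hV⟩ = 0 := by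
    intro h0
    have hN : lpNormR μ P (qFlux p ξ) = 0 := by
      rw [hlV] at h0
      exact (Real.rpow_eq_zero hN0 hP.ne').1 h0
    constructor
    · ext ν
      have h1 := abs_apply_tangentOf_le hPQ hpc hξ hl ν
      rw [lpNormR_gradient_eq hPQ hpc hξ, hN, Real.zero_rpow (sub_pos.2 hPQ.lt).ne', zero_mul] at h1
      exact abs_nonpos_iff.1 h1
    · rw [← tangentOf_zero]
      refine tangentOf_congr_ae ?_
      have h1 : eLpNorm (qFlux p ξ) (ENNReal.ofReal P) μ = 0 :=
        ((ENNReal.toReal_eq_zero_iff _).1 hN).resolve_right hlP.2.ne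
      exact (eLpNorm_eq_zero_iff hlP.1 (by simpa using hP)).1 h1
  constructor
  · intro h
    have hmem : l ∈ dualityMap μ p hp θ ν := by rw [h]; exact mem_singleton l
    rw [mem_dualityMap_iff hPQ hpc hθ] at hmem
    rcases hmem.2 with ⟨hν, hl0⟩ | ⟨hν, V, hVopt, hlν, hnorm⟩
    · rw [hν, (hzero (by rw [hl0]; rfl)).2]
    · have hVP := (mem_varLp_iff hP hpc V.1).1 V.2
      have hVν := hVopt.1
      have hS := lpNormR_nonneg (μ := μ) (P := P) V.1
      rw [hrpow _ hS, ← hVν, hl] at hlν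
      rw [cotangentNorm_eq hPQ hpc hξ hl, ← lpNormR_gradient_eq hPQ hpc hξ] at hnorm
      have hQn : ∫ x, ‖ξ x‖ ^ Q ∂μ = lpNormR μ P V.1 ^ P := by
        rw [← eLpNorm_toReal_rpow_eq_integral hPQ.symm.pos hξ]
        change lpNormR μ Q ξ ^ Q = _
        rw [hnorm, ← Real.rpow_mul hS, hPQ.sub_one_mul_conj]
      have hi1 := (integrable_norm_rpow_ofReal hP hVP).div_const P
      have hi2 := (integrable_norm_rpow_ofReal hPQ.symm.pos hξ).div_const Q
      have hi3 := integrable_inner_of_memLp hPQ hVP hξ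
      -- The duality conditions say `∫ ξ·V = ‖V‖^P` and `‖ξ‖_Q = ‖V‖^(P-1)`, so the nonnegative
      -- Young gap has zero integral and vanishes almost everywhere.
      have hint : ∫ x, (‖V.1 x‖ ^ P / P + ‖ξ x‖ ^ Q / Q - inner ℝ (ξ x) (V.1 x)) ∂μ = 0 := by
        have h12 : Integrable (fun x => ‖V.1 x‖ ^ P / P + ‖ξ x‖ ^ Q / Q) μ := hi1.add hi2
        rw [integral_sub h12 hi3, integral_add hi1 hi2, integral_div, integral_div,
          hQn, hlν, ← eLpNorm_toReal_rpow_eq_integral hP hVP]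
        change lpNormR μ P V.1 ^ P / P + lpNormR μ P V.1 ^ P / Q - lpNormR μ P V.1 ^ P = 0
        rw [div_eq_mul_inv, div_eq_mul_inv, ← mul_add, hPQ.inv_add_inv_eq_one, mul_one, sub_self]
      rw [integral_eq_zero_iff_of_nonneg (fun x => sub_nonneg.2 (inner_le_young hPQ _ _))
        ((hi1.add hi2).sub hi3)] at hint
      rw [← hVν]
      refine tangentOf_congr_ae ?_
      filter_upwards [hint, qFlux_ae_eq (ξ := ξ) hPQ hpc] with x hx hx'
      rw [hx']
      exact eq_powMap_of_young_eq hPQ hx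
  · rintro rfl
    have hself : l ∈ dualityMap μ p hp θ (tangentOf μ p hp ⟨qFlux p ξ, hV⟩) := by
      rw [mem_dualityMap_iff hPQ hpc hθ]
      refine ⟨hcot, ?_⟩
      by_cases h0 : tangentOf μ p hp ⟨qFlux p ξ, hV⟩ = 0
      · exact Or.inl ⟨h0, (hzero (by rw [h0, map_zero])).1⟩
      · refine Or.inr ⟨h0, _, isOptimalVelocity_qFlux hPQ hpc hξ hl hV, ?_,
          cotangentNorm_eq hPQ hpc hξ hl⟩
        rw [hlV, hrpow _ hN0]
    refine Subset.antisymm (fun l' hl' => ?_) (singleton_subset_iff.2 hself)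
    rw [mem_dualityMap_iff hPQ hpc hθ] at hl'
    obtain ⟨hcot', ⟨h0, hl0⟩ | ⟨h0, V, hVopt, hlν, hnorm⟩⟩ := hl'
    · rw [mem_singleton_iff, hl0, (hzero (by rw [h0, map_zero])).1]
    have hopt := (isOptimalVelocity_iff hP hpc _ _).1 (isOptimalVelocity_qFlux hPQ hpc hξ hl hV)
    have hVopt' := (isOptimalVelocity_iff hP hpc _ _).1 hVopt
    -- Both fields are optimal for the same tangent vector, so their norms agree; the touching
    -- argument can then be run at `qFlux p ξ` itself.
    have hNV : lpNormR μ P V.1 = lpNormR μ P (qFlux p ξ) :=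
      le_antisymm (hVopt'.2 ⟨qFlux p ξ, hV⟩ rfl) (hopt.2 V hVopt'.1)
    rw [hNV] at hlν hnorm
    have hle : ∀ ν, l' ν ≤ lpNormR μ P (qFlux p ξ) ^ (P - 1) * finslerMetric μ p hp ν := fun ν => by
      rw [← hnorm]
      exact (le_abs_self _).trans (hcot'.abs_le ν)
    have hinner : ∀ w : varLp μ p hp, ∫ x, inner ℝ (powMap P (qFlux p ξ x)) (w.1 x) ∂μ =
        l (tangentOf μ p hp w) := fun w => by
      rw [hl]
      refine integral_congr_ae ((qFlux_ae_eq (ξ := ξ) hPQ hpc).mono fun x hx => ?_)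
      simp only [hx, powMap_powMap hPQ]
    have hone : ∀ w : varLp μ p hp, l' (tangentOf μ p hp w) ≤ l (tangentOf μ p hp w) := fun w => by
      rw [← hinner w]
      exact le_integral_inner_of_touching hPQ hpc ⟨qFlux p ξ, hV⟩ w
        (by rw [hlν, hrpow _ hN0]) hle
    rw [mem_singleton_iff]
    ext ν
    obtain ⟨w, rfl⟩ := exists_tangentOf_eq ν
    -- A linear form bounded by another one everywhere equals it: the inequality is applied to `-w`.
    refine le_antisymm (hone w) ?_
    have := hone ((-1 : ℝ) • w)
    rw [tangentOf_smul, map_smul, map_smul] at this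
    simpa using this

end Duality

/-! ### Existence of a differential -/

section Differential

variable {N : ℕ} {Ω : Opens (EuclideanSpace ℝ (Fin N))}
  {p : EuclideanSpace ℝ (Fin N) → Ioi (1 : ℝ)} {hp : Measurable p} {P Q : ℝ}

/-- Integration by parts is used twice: with `σ = 0` it shows that `v ↦ ∫ ξ·v` kills fields with
zero divergence and so descends to the tangent space, and with the velocity of a curve it turns `∫
G'(ρ) σ` into the value of the form. -/
theorem exists_isDifferential_energy
    (hΩb : Bornology.IsBounded (Ω : Set (EuclideanSpace ℝ (Fin N))))
    (hΩc : Convex ℝ (Ω : Set (EuclideanSpace ℝ (Fin N)))) {G : ℝ → ℝ}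
    (hG : ConvexOn ℝ (Ici 0) G) (hG2 : ContDiffOn ℝ 2 G (Ici 0)) (ρ : Density Ω)
    (hPQ : P.HolderConjugate Q) (hpc : ∀ᵐ x ∂ρ.measure, (p x : ℝ) = P)
    {ξ : EuclideanSpace ℝ (Fin N) → EuclideanSpace ℝ (Fin N)}
    (hξ : IsWeakGradient Ω (fun x => derivOnIci G (ρ.toFun x)) ξ)
    (hξQ : MemLp ξ (ENNReal.ofReal Q) ρ.measure) :
    ∃ l, IsDifferential p hp (energy G) ρ l ∧ ∀ v : varLp ρ.measure p hp,
      l (tangentOf ρ.measure p hp v) = ∫ x, inner ℝ (ξ x) (v.1 x) ∂ρ.measure := by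
  have hd : DifferentiableOn ℝ G (Ici 0) := hG2.differentiableOn two_ne_zero
  have hgc : ContinuousOn (derivOnIci G) (Ici 0) :=
    hG2.continuousOn_derivWithin (uniqueDiffOn_Ici 0) one_le_two
  have hgm : MonotoneOn (derivOnIci G) (Ici 0) := hG.monotoneOn_derivWithin hd
  have hmem : ∀ v : varLp ρ.measure p hp, MemLp v.1 (ENNReal.ofReal P) ρ.measure := fun v =>
    (mem_varLp_iff hPQ.pos hpc v.1).1 v.2
  let L : varLp ρ.measure p hp →ₗ[ℝ] ℝ :=
    { toFun := fun v => ∫ x, inner ℝ (ξ x) (v.1 x) ∂ρ.measure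
      map_add' := fun v w => by
        rw [← integral_add (integrable_inner_of_memLp hPQ (hmem v) hξQ)
          (integrable_inner_of_memLp hPQ (hmem w) hξQ)]
        simp [inner_add_right]
      map_smul' := fun c v => by
        rw [RingHom.id_apply, smul_eq_mul, ← integral_const_mul]
        simp [real_inner_smul_right] }
  obtain ⟨l, hl⟩ := exists_linearMap_tangentOf L fun v hv => by
    have h := ρ.integral_comp_mul_eq hΩb hΩc hPQ hgc hgm hξ hξQ (hmem v) (σ := 0)
      integrableOn_zero fun φ => by
        rw [← tangentOf_apply (hp := hp), hv]
        simp
    change ∫ x, inner ℝ (ξ x) (v.1 x) ∂ρ.measure = 0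
    rw [← h]
    simp
  refine ⟨l, ⟨isCotangent_of_integral_inner hPQ hpc hξQ hl, fun ν γ hγ => ?_⟩, hl⟩
  obtain ⟨h0, ⟨M, hM⟩, σ, hσ, hlim, hν⟩ := hγ
  obtain ⟨v, rfl⟩ := exists_tangentOf_eq ν
  rw [hl]
  change HasDerivWithinAt _ (∫ x, inner ℝ (ξ x) (v.1 x) ∂ρ.measure) _ _
  rw [← ρ.integral_comp_mul_eq hΩb hΩc hPQ hgc hgm hξ hξQ (hmem v) hσ fun φ => by
    rw [← tangentOf_apply (hp := hp), hν]]
  exact hasDerivWithinAt_energy hΩb hG hd hgc h0 hM hσ hlim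

end Differential

/-! ### Uniqueness of the differential at lower semicontinuous densities -/

section Uniqueness

variable {N : ℕ} {Ω : Opens (EuclideanSpace ℝ (Fin N))}

/-- Integration by parts: a smooth compactly supported field has a distributional divergence
which is a continuous function. -/
theorem exists_integral_fderiv_apply_eq
    {m : EuclideanSpace ℝ (Fin N) → EuclideanSpace ℝ (Fin N)} (hm : ContDiff ℝ ∞ m)
    (hmc : HasCompactSupport m) :
    ∃ σ : EuclideanSpace ℝ (Fin N) → ℝ, Continuous σ ∧ (∀ x ∉ tsupport m, σ x = 0) ∧
      ∀ φ : EuclideanSpace ℝ (Fin N) → ℝ, ContDiff ℝ ∞ φ →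
        ∫ x, fderiv ℝ φ x (m x) = ∫ x, σ x * φ x := by
  set e : Fin N → EuclideanSpace ℝ (Fin N) := fun i => EuclideanSpace.single i (1 : ℝ)
  have hmi : ∀ i, ContDiff ℝ ∞ fun x => m x i := fun i =>
    (EuclideanSpace.proj (𝕜 := ℝ) i).contDiff.comp hm
  have hsupp : ∀ x ∉ tsupport m, ∀ i, fderiv ℝ (fun x => m x i) x = 0 := fun x hx i => by
    have h : (fun x => m x i) =ᶠ[𝓝 x] fun _ => 0 := by
      filter_upwards [(isClosed_tsupport m).isOpen_compl.mem_nhds hx] with y hy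
      rw [image_eq_zero_of_notMem_tsupport hy, PiLp.zero_apply]
    rw [h.fderiv_eq]
    simp
  have hdc : ∀ i, Continuous fun x => fderiv ℝ (fun x => m x i) x (e i) := fun i =>
    ((hmi i).continuous_fderiv (by simp)).clm_apply continuous_const
  refine ⟨fun x => -∑ i, fderiv ℝ (fun x => m x i) x (e i), ?_, fun x hx => ?_, fun φ hφ => ?_⟩
  · exact (continuous_finsetSum _ fun i _ => hdc i).neg
  · simp [hsupp x hx]
  · have hφc := hφ.continuous
    have hint : ∀ f : EuclideanSpace ℝ (Fin N) → ℝ, Continuous f → (∀ x ∉ tsupport m, f x = 0) →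
        Integrable f := fun f hf h0 =>
      (hf.continuousOn.integrableOn_compact hmc).integrable_of_forall_notMem_eq_zero h0
    have hcoord : ∀ i, ∀ x ∉ tsupport m, m x i = 0 := fun i x hx => by
      rw [image_eq_zero_of_notMem_tsupport hx, PiLp.zero_apply]
    have hdφ : ∀ i, Continuous fun x => fderiv ℝ φ x (e i) := fun i =>
      (hφ.continuous_fderiv (by simp)).clm_apply continuous_const
    have h1 : ∀ i, Integrable fun x => m x i * fderiv ℝ φ x (e i) := fun i =>
      hint _ ((hmi i).continuous.mul (hdφ i)) fun x hx => by rw [hcoord i x hx, zero_mul]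
    have h2 : ∀ i, Integrable fun x => fderiv ℝ (fun x => m x i) x (e i) * φ x := fun i =>
      hint _ ((hdc i).mul hφc) fun x hx => by rw [hsupp x hx i]; simp
    have hparts : ∀ i, ∫ x, m x i * fderiv ℝ φ x (e i) =
        -∫ x, fderiv ℝ (fun x => m x i) x (e i) * φ x := fun i =>
      integral_mul_fderiv_eq_neg_fderiv_mul_of_integrable (h2 i) (h1 i)
        (hint _ ((hmi i).continuous.mul hφc) fun x hx => by rw [hcoord i x hx, zero_mul])
        (fun x _ => (hmi i).differentiable (by simp) x)
        (fun x _ => hφ.differentiable (by simp) x)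
    have hexp : ∀ x, fderiv ℝ φ x (m x) = ∑ i, m x i * fderiv ℝ φ x (e i) := fun x => by
      conv_lhs => rw [← (EuclideanSpace.basisFun (Fin N) ℝ).sum_repr (m x)]
      simp [e]
    simp_rw [hexp, neg_mul, Finset.sum_mul]
    rw [integral_finsetSum _ fun i _ => h1 i, integral_neg, integral_finsetSum _ fun i _ => h2 i,
      ← Finset.sum_neg_distrib]
    exact Finset.sum_congr rfl fun i _ => hparts i

theorem Density.eq_of_toFun_eq {ρ ρ' : Density Ω} (h : ρ.toFun = ρ'.toFun) : ρ = ρ' := by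
  cases ρ
  cases ρ'
  cases h
  rfl

/-- The segment `ρ + t σ`, `0 ≤ t ≤ 1`, in the space of densities. -/
theorem Density.exists_segment (ρ : Density Ω) {σ : EuclideanSpace ℝ (Fin N) → ℝ}
    (hσm : Measurable σ) (hσ : IntegrableOn σ Ω) (hσρ : ∀ x ∈ Ω, |σ x| ≤ ρ.toFun x)
    (hσ0 : ∫ x in (Ω : Set (EuclideanSpace ℝ (Fin N))), σ x = 0) :
    ∃ γ : ℝ → Density Ω, γ 0 = ρ ∧
      ∀ t ∈ Icc (0 : ℝ) 1, ∀ x, (γ t).toFun x = ρ.toFun x + t * σ x := by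
  have hρ : IntegrableOn ρ.toFun Ω := by
    by_contra h
    have := ρ.integral_eq_one
    rw [integral_undef h] at this
    exact zero_ne_one this
  obtain ⟨M, hM⟩ := ρ.bounded
  have hle : ∀ (t : Icc (0 : ℝ) 1), ∀ x ∈ Ω, |(t : ℝ) * σ x| ≤ ρ.toFun x := fun t x hx => by
    rw [abs_mul, abs_of_nonneg t.2.1]
    exact (mul_le_of_le_one_left (abs_nonneg _) t.2.2).trans (hσρ x hx)
  let γ : Icc (0 : ℝ) 1 → Density Ω := fun t =>
    { toFun := fun x => ρ.toFun x + t * σ x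
      measurable := ρ.measurable.add (hσm.const_mul _)
      nonneg := fun x hx => by linarith [(abs_le.1 (hle t x hx)).1]
      bounded := ⟨M + M, fun x hx => by linarith [(abs_le.1 (hle t x hx)).2, hM x hx]⟩
      integral_eq_one := by
        rw [integral_add hρ (hσ.const_mul _), integral_const_mul, hσ0, ρ.integral_eq_one]
        simp }
  have hγ : ∀ t ∈ Icc (0 : ℝ) 1, ∀ x,
      (γ (projIcc 0 1 zero_le_one t)).toFun x = ρ.toFun x + t * σ x := fun t ht x => by
    rw [projIcc_of_mem zero_le_one ht]
  refine ⟨fun t => γ (projIcc 0 1 zero_le_one t), Density.eq_of_toFun_eq ?_, hγ⟩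
  funext x
  rw [hγ 0 ⟨le_rfl, zero_le_one⟩, zero_mul, add_zero]

variable {p : EuclideanSpace ℝ (Fin N) → Ioi (1 : ℝ)} {hp : Measurable p} {P : ℝ}

/-- Two differentials agree on the tangent vector `-div m`, when `m` is smooth with compact
support in a region where the density is bounded below. -/
theorem IsDifferential.apply_tangentOf_eq {E : Density Ω → ℝ} {ρ : Density Ω}
    {l l' : TangentSp ρ.measure p hp →ₗ[ℝ] ℝ} (hl : IsDifferential p hp E ρ l)
    (hl' : IsDifferential p hp E ρ l')
    {m : EuclideanSpace ℝ (Fin N) → EuclideanSpace ℝ (Fin N)} (hm : ContDiff ℝ ∞ m)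
    (hmc : HasCompactSupport m) (hmΩ : tsupport m ⊆ Ω) {c : ℝ} (hc : 0 < c)
    (hρc : ∀ x ∈ tsupport m, c ≤ ρ.toFun x) {w : varLp ρ.measure p hp}
    (hw : ∀ x ∈ Ω, ρ.toFun x • w.1 x = m x) :
    l (tangentOf ρ.measure p hp w) = l' (tangentOf ρ.measure p hp w) := by
  obtain ⟨σ, hσc, hσ0, hσ⟩ := exists_integral_fderiv_apply_eq hm hmc
  have hσi : Integrable σ :=
    (hσc.continuousOn.integrableOn_compact hmc).integrable_of_forall_notMem_eq_zero hσ0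
  have hσΩ : ∀ f : EuclideanSpace ℝ (Fin N) → ℝ,
      ∫ x in (Ω : Set (EuclideanSpace ℝ (Fin N))), σ x * f x = ∫ x, σ x * f x := fun f =>
    setIntegral_eq_integral_of_forall_compl_eq_zero fun x hx => by
      rw [hσ0 x fun h => hx (hmΩ h), zero_mul]
  have hint : ∫ x in (Ω : Set (EuclideanSpace ℝ (Fin N))), σ x = 0 := by
    -- Testing with the constant `1` shows that the perturbation has zero mass, so total mass is
    -- preserved along the segment.
    have h := hσ (fun _ => 1) contDiff_const
    have h2 := hσΩ fun _ => 1
    simp only [mul_one] at h h2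
    rw [h2, ← h]
    simp
  obtain ⟨B, hB⟩ := hσc.bounded_above_of_compact_support
    (HasCompactSupport.intro hmc hσ0)
  -- This scaling gives `s |σ| ≤ c ≤ ρ` on the support of `m`, so `ρ + t s σ` remains nonnegative
  -- for `t ∈ [0,1]`; linearity removes `s` at the end.
  set s : ℝ := c / (|B| + 1)
  have hs : 0 < s := by positivity
  have hsσ : ∀ x ∈ Ω, |s * σ x| ≤ ρ.toFun x := fun x hx => by
    by_cases hxm : x ∈ tsupport m
    · refine le_trans ?_ (hρc x hxm)
      rw [abs_mul, abs_of_pos hs, div_mul_eq_mul_div, div_le_iff₀ (by positivity)]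
      refine mul_le_mul_of_nonneg_left ?_ hc.le
      exact (hB x).trans ((le_abs_self B).trans (by linarith))
    · rw [hσ0 x hxm, mul_zero, abs_zero]
      exact ρ.nonneg x hx
  have hsi : IntegrableOn (fun x => s * σ x) Ω := (hσi.const_mul s).integrableOn
  obtain ⟨γ, hγ0, hγ⟩ := ρ.exists_segment (hσc.measurable.const_mul s) hsi hsσ
    (by rw [integral_const_mul, hint, mul_zero])
  obtain ⟨M, hM⟩ := ρ.bounded
  have hvel : HasInitialVelocity γ ρ (tangentOf ρ.measure p hp (s • w)).1 := by
    refine ⟨hγ0, ⟨M + M, fun t ht x hx => ?_⟩, _, hsi, ?_, fun φ => ?_⟩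
    · have h1 : t * (s * σ x) ≤ ρ.toFun x := by
        refine (le_abs_self _).trans ?_
        rw [abs_mul, abs_of_nonneg ht.1]
        exact (mul_le_of_le_one_left (abs_nonneg _) ht.2).trans (hsσ x hx)
      rw [hγ t ht]
      linarith [hM x hx]
    · refine tendsto_const_nhds.congr' ?_
      filter_upwards [Ioc_mem_nhdsGT (zero_lt_one' ℝ)] with t ht
      rw [eq_comm]
      have : ∀ x, |((γ t).toFun x - ρ.toFun x) / t - s * σ x| = 0 := fun x => by
        rw [hγ t ⟨ht.1.le, ht.2⟩, add_sub_cancel_left, mul_div_cancel_left₀ _ ht.1.ne', sub_self,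
          abs_zero]
      simp [this]
    · rw [tangentOf_apply, ρ.integral_measure]
      have h1 : ∫ x in (Ω : Set (EuclideanSpace ℝ (Fin N))),
          ρ.toFun x • fderiv ℝ φ x ((s • w).1 x) =
          ∫ x in (Ω : Set (EuclideanSpace ℝ (Fin N))), s * fderiv ℝ φ x (m x) := by
        refine setIntegral_congr_fun Ω.isOpen.measurableSet fun x hx => ?_
        change ρ.toFun x • fderiv ℝ φ x (s • w.1 x) = s * fderiv ℝ φ x (m x)
        rw [← hw x hx, map_smul, map_smul, smul_eq_mul, smul_eq_mul, smul_eq_mul]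
        ring
      have h2 : ∫ x in (Ω : Set (EuclideanSpace ℝ (Fin N))), fderiv ℝ φ x (m x) =
          ∫ x, fderiv ℝ φ x (m x) :=
        setIntegral_eq_integral_of_forall_compl_eq_zero fun x hx => by
          rw [image_eq_zero_of_notMem_tsupport fun h => hx (hmΩ h), map_zero]
      simp_rw [h1, mul_assoc]
      rw [integral_const_mul, integral_const_mul, h2, hσ φ φ.contDiff, hσΩ]
  -- Both differentials compute the same one-sided derivative of `E` along the segment, and that
  -- derivative is unique.
  have h := (uniqueDiffOn_Icc zero_lt_one 0 ⟨le_rfl, zero_le_one⟩).eq_deriv _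
    (hl.2 _ γ hvel) (hl'.2 _ γ hvel)
  rw [tangentOf_smul, map_smul, map_smul] at h
  exact smul_right_injective ℝ hs.ne' h

theorem exists_contDiff_cutoff {K L : Set (EuclideanSpace ℝ (Fin N))} (hK : IsClosed K)
    (hL : IsClosed L) (hKL : K ⊆ interior L) :
    ∃ χ : EuclideanSpace ℝ (Fin N) → ℝ, ContDiff ℝ ∞ χ ∧ (∀ x ∈ K, χ x = 1) ∧
      tsupport χ ⊆ L ∧ ∀ x, χ x ∈ Icc (0 : ℝ) 1 := by
  obtain ⟨f, h1, h0, hf⟩ := exists_contMDiffMap_one_nhds_of_subset_interior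
    (modelWithCornersSelf ℝ (EuclideanSpace ℝ (Fin N))) hK hKL (n := (⊤ : ℕ∞))
  refine ⟨f, contMDiff_iff_contDiff.1 f.contMDiff, fun x hx => h1.self_of_nhdsSet x hx, ?_, hf⟩
  exact closure_minimal (fun x hx => by_contra fun h => hx (h0 x h)) hL

theorem Density.measure_le (ρ : Density Ω) {M : ℝ} (hM : ∀ x ∈ Ω, ρ.toFun x ≤ M) :
    ρ.measure ≤ ENNReal.ofReal M • volume.restrict (Ω : Set (EuclideanSpace ℝ (Fin N))) := by
  rw [← withDensity_const]
  refine withDensity_mono ?_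
  filter_upwards [ae_restrict_mem Ω.isOpen.measurableSet] with x hx
  exact ENNReal.ofReal_le_ofReal (hM x hx)

/-- Approximation of velocity fields by fields with smooth, compactly supported momentum. -/
theorem Density.exists_smooth_momentum (ρ : Density Ω)
    (hlsc : LowerSemicontinuousOn ρ.toFun Ω) (hP : 1 ≤ P)
    {v : EuclideanSpace ℝ (Fin N) → EuclideanSpace ℝ (Fin N)}
    (hv : MemLp v (ENNReal.ofReal P) ρ.measure) {ε : ℝ} (hε : 0 < ε) :
    ∃ (m w : EuclideanSpace ℝ (Fin N) → EuclideanSpace ℝ (Fin N)) (c : ℝ), ContDiff ℝ ∞ m ∧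
      HasCompactSupport m ∧ tsupport m ⊆ Ω ∧ 0 < c ∧ (∀ x ∈ tsupport m, c ≤ ρ.toFun x) ∧
      (∀ x ∈ Ω, ρ.toFun x • w x = m x) ∧ MemLp w (ENNReal.ofReal P) ρ.measure ∧
      eLpNorm (v - w) (ENNReal.ofReal P) ρ.measure ≤ ENNReal.ofReal ε := by
  have hP1 : 1 ≤ ENNReal.ofReal P := by simpa using hP
  obtain ⟨M, hM⟩ := ρ.bounded
  -- Lower semicontinuity makes the positivity set of `ρ` in `Ω` open; its complement is null for `ρ
  -- dx`.
  obtain ⟨u, hu, hUu⟩ := lowerSemicontinuousOn_iff_preimage_Ioi.1 hlsc 0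
  set U : Set (EuclideanSpace ℝ (Fin N)) := Ω ∩ u
  have hU : IsOpen U := Ω.isOpen.inter hu
  have hUpos : ∀ x ∈ U, 0 < ρ.toFun x := fun x hx => by
    rw [← hUu] at hx
    exact hx.2
  have hUc : ρ.measure Uᶜ = 0 := by
    rw [Density.measure, withDensity_apply _ hU.measurableSet.compl,
      lintegral_eq_zero_iff ρ.measurable.ennreal_ofReal]
    rw [Filter.EventuallyEq, ae_restrict_iff' hU.measurableSet.compl]
    filter_upwards [ae_restrict_mem Ω.isOpen.measurableSet] with x hx hxU
    refine ENNReal.ofReal_eq_zero.2 (not_lt.1 fun h => hxU ?_)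
    rw [← hUu]
    exact ⟨hx, h⟩
  -- Absolute continuity of the integral lets `v` be discarded outside a compact `K` in the
  -- positivity set, at cost `ε/2`.
  obtain ⟨δ, hδ, hδv⟩ := hv.eLpNorm_indicator_le hP1 ENNReal.ofReal_ne_top (half_pos hε)
  obtain ⟨K, hKU, hK, hKδ⟩ := hU.measurableSet.exists_isCompact_sdiff_lt
    (measure_ne_top ρ.measure U) (ENNReal.ofReal_pos.2 hδ).ne'
  have hKc : ρ.measure Kᶜ ≤ ENNReal.ofReal δ := by
    have h : Kᶜ ⊆ Uᶜ ∪ U \ K := fun x hx => by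
      by_cases hxU : x ∈ U
      · exact Or.inr ⟨hxU, hx⟩
      · exact Or.inl hxU
    refine (measure_mono h).trans ((measure_union_le _ _).trans ?_)
    rw [hUc, zero_add]
    exact hKδ.le
  -- The intermediate compact `L` gives room for a cutoff equal to `1` on `K`. A lower
  -- semicontinuous positive function has a positive minimum on `L`, which provides `c`.
  obtain ⟨L, hL, hLcl, hKL, hLU⟩ := exists_compact_closed_between hK hU hKU
  obtain ⟨c, hc, hρc⟩ : ∃ c : ℝ, 0 < c ∧ ∀ x ∈ L, c ≤ ρ.toFun x := by
    rcases L.eq_empty_or_nonempty with rfl | hne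
    · exact ⟨1, one_pos, by simp⟩
    · obtain ⟨a, ha, hmin⟩ := LowerSemicontinuousOn.exists_isMinOn hne hL
        (hlsc.mono (hLU.trans inter_subset_left))
      exact ⟨_, hUpos a (hLU ha), fun x hx => hmin hx⟩
  obtain ⟨χ, hχ, hχK, hχL, hχ01⟩ := exists_contDiff_cutoff hK.isClosed hLcl hKL
  have hmom := (ρ.memLp_momentum hP hv).indicator hK.measurableSet
  -- `R` is the cost of converting an unweighted `L^P` error in the momentum into a weighted error
  -- in the velocity: dividing by `ρ ≥ c`, then using `ρ dx ≤ M dx`.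
  set R : ℝ := c⁻¹ * (ENNReal.ofReal M ^ (1 / P)).toReal
  have hR : 0 ≤ R := by positivity
  obtain ⟨g, hgc, hg, hgε⟩ := hmom.exist_eLpNorm_sub_le ENNReal.ofReal_ne_top hP1
    (by positivity : 0 < ε / 2 / (R + 1))
  set m : EuclideanSpace ℝ (Fin N) → EuclideanSpace ℝ (Fin N) := fun x => χ x • g x
  have hmL : tsupport m ⊆ L := (tsupport_smul_subset_left χ g).trans hχL
  have hm : ContDiff ℝ ∞ m := hχ.smul hg
  have hmc : HasCompactSupport m := hL.of_isClosed_subset (isClosed_tsupport m) hmL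
  set w : EuclideanSpace ℝ (Fin N) → EuclideanSpace ℝ (Fin N) := fun x => (ρ.toFun x)⁻¹ • m x
  have hmoff : ∀ x ∉ L, m x = 0 := fun x hx => image_eq_zero_of_notMem_tsupport fun h => hx (hmL h)
  have hwm : Measurable w := ρ.measurable.inv.smul hm.continuous.measurable
  have hinv : ∀ x ∈ L, (ρ.toFun x)⁻¹ ≤ c⁻¹ := fun x hx => inv_anti₀ hc (hρc x hx)
  refine ⟨m, w, c, hm, hmc, hmL.trans (hLU.trans inter_subset_left), hc,
    fun x hx => hρc x (hmL hx), fun x _ => ?_, ?_, ?_⟩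
  · by_cases hxL : x ∈ L
    · exact smul_inv_smul₀ (hc.trans_le (hρc x hxL)).ne' _
    · simp only [w, hmoff x hxL, smul_zero]
  · obtain ⟨B, hB⟩ := hm.continuous.bounded_above_of_compact_support hmc
    refine MemLp.of_bound hwm.aestronglyMeasurable (c⁻¹ * B) (Eventually.of_forall fun x => ?_)
    have hB0 : 0 ≤ B := (norm_nonneg _).trans (hB x)
    by_cases hxL : x ∈ L
    · have hρ0 := hc.trans_le (hρc x hxL)
      simp only [w, norm_smul, norm_inv, Real.norm_of_nonneg hρ0.le]
      exact mul_le_mul (hinv x hxL) (hB x) (norm_nonneg _) (by positivity)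
    · simp only [w, hmoff x hxL, smul_zero, norm_zero]
      positivity
  · have hsplit : v - w = Kᶜ.indicator v + (K.indicator v - w) := by
      funext x
      by_cases hx : x ∈ K <;> simp [hx, sub_eq_add_neg]
    rw [hsplit]
    have hvm := hv.1
    refine (eLpNorm_add_le (hvm.indicator hK.measurableSet.compl)
      ((hvm.indicator hK.measurableSet).sub hwm.aestronglyMeasurable) hP1).trans ?_
    rw [← add_halves ε, ENNReal.ofReal_add (half_pos hε).le (half_pos hε).le]
    refine add_le_add (hδv _ hK.measurableSet.compl hKc) ?_
    have hpt : ∀ᵐ x ∂ρ.measure, ‖(K.indicator v - w) x‖ ≤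
        c⁻¹ * ‖(K.indicator (ρ.momentum v) - g) x‖ := by
      refine ρ.measure_absolutelyContinuous.ae_le ?_
      filter_upwards [ae_restrict_mem Ω.isOpen.measurableSet] with x hx
      by_cases hxL : x ∈ L
      · have hρ0 := hc.trans_le (hρc x hxL)
        have h1 : (K.indicator v - w) x =
            (ρ.toFun x)⁻¹ • χ x • (K.indicator (ρ.momentum v) - g) x := by
          by_cases hxK : x ∈ K
          · have hxΩ : x ∈ (Ω : Set (EuclideanSpace ℝ (Fin N))) := hx
            simp only [Pi.sub_apply, indicator_of_mem hxK, w, m, hχK x hxK, one_smul,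
              Density.momentum, indicator_of_mem hxΩ, smul_sub, inv_smul_smul₀ hρ0.ne']
          · simp [indicator_of_notMem hxK, w, m]
        rw [h1, norm_smul, norm_smul, norm_inv, Real.norm_of_nonneg hρ0.le,
          Real.norm_of_nonneg (hχ01 x).1]
        refine mul_le_mul (hinv x hxL) ?_ (mul_nonneg (hχ01 x).1 (norm_nonneg _)) (by positivity)
        exact mul_le_of_le_one_left (norm_nonneg _) (hχ01 x).2
      · have hxK : x ∉ K := fun h => hxL (interior_subset (hKL h))
        simp only [Pi.sub_apply, indicator_of_notMem hxK, w, hmoff x hxL, smul_zero, sub_zero,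
          norm_zero]
        positivity
    refine (eLpNorm_le_mul_eLpNorm_of_ae_le_mul hpt _).trans ?_
    have hle : eLpNorm (K.indicator (ρ.momentum v) - g) (ENNReal.ofReal P) ρ.measure ≤
        ENNReal.ofReal M ^ (1 / P) * ENNReal.ofReal (ε / 2 / (R + 1)) := by
      refine (eLpNorm_mono_measure _ (ρ.measure_le hM)).trans ?_
      rw [eLpNorm_smul_measure_of_ne_top ENNReal.ofReal_ne_top,
        ENNReal.toReal_div, ENNReal.toReal_one, ENNReal.toReal_ofReal (by linarith), smul_eq_mul]
      gcongr
      exact (eLpNorm_mono_measure _ Measure.restrict_le_self).trans hgε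
    have hMt : ENNReal.ofReal M ^ (1 / P) ≠ ⊤ :=
      ENNReal.rpow_ne_top_of_nonneg (by positivity) ENNReal.ofReal_ne_top
    calc _ ≤ ENNReal.ofReal c⁻¹ *
          (ENNReal.ofReal M ^ (1 / P) * ENNReal.ofReal (ε / 2 / (R + 1))) := by gcongr
      _ = ENNReal.ofReal (R * (ε / 2 / (R + 1))) := by
          rw [← mul_assoc, ENNReal.ofReal_mul hR, ENNReal.ofReal_mul (by positivity),
            ENNReal.ofReal_toReal hMt]
      _ ≤ ENNReal.ofReal (ε / 2) := by
          refine ENNReal.ofReal_le_ofReal ?_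
          rw [← mul_div_assoc, div_le_iff₀ (by positivity)]
          nlinarith

/-- Differentials agree on fields with smooth momentum supported where `ρ` is bounded below. These
are dense in `L^P_ρ`, and both forms are bounded by the Finsler metric. -/
theorem IsDifferential.unique {E : Density Ω → ℝ} {ρ : Density Ω} (hP : 1 ≤ P)
    (hpc : ∀ᵐ x ∂ρ.measure, (p x : ℝ) = P) (hlsc : LowerSemicontinuousOn ρ.toFun Ω)
    {l l' : TangentSp ρ.measure p hp →ₗ[ℝ] ℝ} (hl : IsDifferential p hp E ρ l)
    (hl' : IsDifferential p hp E ρ l') : l = l' := by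
  have hP0 : 0 < P := by linarith
  obtain ⟨C, hC⟩ := hl.1
  obtain ⟨C', hC'⟩ := hl'.1
  ext ν
  obtain ⟨v, rfl⟩ := exists_tangentOf_eq ν
  rw [← sub_eq_zero, ← abs_nonpos_iff]
  refine le_of_forall_pos_le_add fun ε hε => ?_
  set D := |C| + |C'| + 1
  have hD : 0 < D := by positivity
  obtain ⟨m, w, c, hm, hmc, hmΩ, hc, hρc, hw, hwP, hvw⟩ := ρ.exists_smooth_momentum hlsc hP
    ((mem_varLp_iff hP0 hpc v.1).1 v.2) (by positivity : 0 < ε / D)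
  let W : varLp ρ.measure p hp := ⟨w, (mem_varLp_iff hP0 hpc w).2 hwP⟩
  have hW : l (tangentOf ρ.measure p hp W) = l' (tangentOf ρ.measure p hp W) :=
    hl.apply_tangentOf_eq hl' hm hmc hmΩ hc hρc hw
  have hF : finslerMetric ρ.measure p hp (tangentOf ρ.measure p hp (v - W)) ≤ ε / D := by
    refine (finslerMetric_tangentOf_le _).trans ?_
    rw [varNorm_eq_lpNormR hP0 hpc]
    exact ENNReal.toReal_le_of_le_ofReal (by positivity) hvw
  have hsub : tangentOf ρ.measure p hp (v - W) =
      tangentOf ρ.measure p hp v - tangentOf ρ.measure p hp W :=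
    map_sub (velocityMap ρ.measure p hp).rangeRestrict v W
  have h1 : l (tangentOf ρ.measure p hp v) - l' (tangentOf ρ.measure p hp v) =
      l (tangentOf ρ.measure p hp (v - W)) - l' (tangentOf ρ.measure p hp (v - W)) := by
    rw [hsub, map_sub, map_sub, hW]
    ring
  set F := finslerMetric ρ.measure p hp (tangentOf ρ.measure p hp (v - W))
  have hF0 : 0 ≤ F := finslerMetric_nonneg _
  rw [h1, zero_add]
  calc _ ≤ C * F + C' * F := (abs_sub _ _).trans (add_le_add (hC _) (hC' _))
    _ ≤ D * F := by
        rw [← add_mul]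
        exact mul_le_mul_of_nonneg_right (by linarith [le_abs_self C, le_abs_self C']) hF0
    _ ≤ D * (ε / D) := mul_le_mul_of_nonneg_left hF hD.le
    _ = ε := by field_simp

end Uniqueness

/-! ### Gradients and gradient flows -/

section GradientFlow

variable {N : ℕ} {Ω : Opens (EuclideanSpace ℝ (Fin N))}
  {p : EuclideanSpace ℝ (Fin N) → Ioi (1 : ℝ)} {hp : Measurable p} {P Q : ℝ}

theorem isNormalization_rpow (hP : 1 < P) : IsNormalization fun t : ℝ => t ^ (P - 1) where
  continuousOn := (Real.continuous_rpow_const (sub_pos.2 hP).le).continuousOn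
  strictMonoOn := Real.strictMonoOn_rpow_Ici_of_exponent_pos (sub_pos.2 hP)
  map_zero := Real.zero_rpow (sub_pos.2 hP).ne'
  tendsto := tendsto_rpow_atTop (sub_pos.2 hP)

theorem isCompatible_rpow (hPQ : P.HolderConjugate Q) (ρ : Density Ω)
    (hpc : ∀ᵐ x ∂ρ.measure, (p x : ℝ) = P) : IsCompatible p (fun t => t ^ (P - 1)) ρ := by
  intro V hV
  have hV' := (memVarLp_iff_memLp hPQ.pos hpc V).1 hV
  rw [varNorm_conjExp_rpow hPQ hpc hV', varNorm_eq_toReal_eLpNorm hPQ.pos hpc hV']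

theorem IsFinslerGradient.eq_tangentOf (hPQ : P.HolderConjugate Q) {ρ : Density Ω}
    (hpc : ∀ᵐ x ∂ρ.measure, (p x : ℝ) = P) (hlsc : LowerSemicontinuousOn ρ.toFun Ω) {θ : ℝ → ℝ}
    (hθ : IsCompatible p θ ρ) {E : Density Ω → ℝ}
    {ξ : EuclideanSpace ℝ (Fin N) → EuclideanSpace ℝ (Fin N)}
    (hξ : MemLp ξ (ENNReal.ofReal Q) ρ.measure) {l : TangentSp ρ.measure p hp →ₗ[ℝ] ℝ}
    (hl : IsDifferential p hp E ρ l)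
    (hlξ : ∀ v, l (tangentOf ρ.measure p hp v) = ∫ x, inner ℝ (ξ x) (v.1 x) ∂ρ.measure)
    (hV : qFlux p ξ ∈ varLp ρ.measure p hp) {ν : TangentSp ρ.measure p hp}
    (hν : IsFinslerGradient p hp θ E ρ ν) : ν = tangentOf ρ.measure p hp ⟨qFlux p ξ, hV⟩ := by
  obtain ⟨l', hl', hJ⟩ := hν
  rw [hl'.unique hPQ.lt.le hpc hlsc hl] at hJ
  exact (dualityMap_eq_singleton_iff hPQ hpc hθ hξ hlξ hV ν).1 hJ

theorem HasTimeDerivative.congr_ae {ρ : ℝ → Density Ω} {ρ₀ : Density Ω}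
    {η η' : ℝ → 𝓓'((⊤ : Opens (EuclideanSpace ℝ (Fin N))), ℝ)}
    (h : ∀ᵐ t ∂(volume.restrict (Ioi (0 : ℝ))), η t = η' t) (hη : HasTimeDerivative ρ ρ₀ η) :
    HasTimeDerivative ρ ρ₀ η' := by
  intro ψ
  have hψ : (fun t => η t (timeSlice ψ t)) =ᵐ[volume.restrict (Ioi (0 : ℝ))]
      fun t => η' t (timeSlice ψ t) := h.mono fun t ht => by simp only [ht]
  obtain ⟨h1, h2, h3⟩ := hη ψ
  exact ⟨h1, Integrable.congr h2 hψ, by rwa [← integral_congr_ae hψ]⟩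

end GradientFlow

/-! ### Assembly of the theorem. -/

theorem mainTheorem3 {N : ℕ} (hN : 1 ≤ N)
    (Ω : TopologicalSpace.Opens (EuclideanSpace ℝ (Fin N)))
    (hΩb : Bornology.IsBounded (Ω : Set (EuclideanSpace ℝ (Fin N))))
    (hΩc : Convex ℝ (Ω : Set (EuclideanSpace ℝ (Fin N))))
    (p : EuclideanSpace ℝ (Fin N) → Set.Ioi (1 : ℝ)) (hp : Measurable p)
    (hp_lower : 1 < essInf (fun x => (p x : ℝ))
      (volume.restrict (Ω : Set (EuclideanSpace ℝ (Fin N)))))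
    (hp_upper : ∃ M : ℝ, ∀ᵐ x ∂(volume.restrict (Ω : Set (EuclideanSpace ℝ (Fin N)))),
      (p x : ℝ) ≤ M)
    (hpq : 1 / essInf (fun x => (p x : ℝ))
          (volume.restrict (Ω : Set (EuclideanSpace ℝ (Fin N)))) +
        1 / essInf (conjExp p) (volume.restrict (Ω : Set (EuclideanSpace ℝ (Fin N)))) ≤ 1)
    (G : ℝ → ℝ) (hG_convex : ConvexOn ℝ (Set.Ici 0) G) (hG_smooth : ContDiffOn ℝ 2 G (Set.Ici 0)) :
    (∃ θ : ℝ → ℝ, IsNormalization θ ∧ ∀ ρ : Density Ω, IsCompatible p θ ρ) ∧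
    ∀ θ : ℝ → ℝ, IsNormalization θ → (∀ ρ : Density Ω, IsCompatible p θ ρ) →
      (∀ (ρ : Density Ω) (ξ : EuclideanSpace ℝ (Fin N) → EuclideanSpace ℝ (Fin N)),
        IsWeakGradient Ω (fun x => derivOnIci G (ρ.toFun x)) ξ →
        MemVarLp ρ.measure (conjExp p) ξ →
        ∃ hV : qFlux p ξ ∈ varLp ρ.measure p hp,
          IsFinslerGradient p hp θ (energy G) ρ (tangentOf ρ.measure p hp ⟨qFlux p ξ, hV⟩) ∧
          (∃ l, IsDifferential p hp (energy G) ρ l ∧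
            (∀ v : varLp ρ.measure p hp,
              l (tangentOf ρ.measure p hp v) = ∫ x, inner ℝ (ξ x) (v.1 x) ∂ρ.measure) ∧
            ∀ ν, dualityMap ρ.measure p hp θ ν = {l} ↔
              ν = tangentOf ρ.measure p hp ⟨qFlux p ξ, hV⟩) ∧
          (LowerSemicontinuousOn ρ.toFun Ω →
            (∃! l, IsDifferential p hp (energy G) ρ l) ∧
            ∀ ν, IsFinslerGradient p hp θ (energy G) ρ ν →
              ν = tangentOf ρ.measure p hp ⟨qFlux p ξ, hV⟩)) ∧
      (∀ (ρ : ℝ → Density Ω) (ρ₀ : Density Ω)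
        (ξ : ℝ → EuclideanSpace ℝ (Fin N) → EuclideanSpace ℝ (Fin N)),
        (∀ᵐ t ∂(volume.restrict (Set.Ioi (0 : ℝ))),
          IsWeakGradient Ω (fun x => derivOnIci G ((ρ t).toFun x)) (ξ t) ∧
          MemVarLp (ρ t).measure (conjExp p) (ξ t)) →
        (IsWeakSolution p ρ ρ₀ ξ → IsGradientFlow p hp θ (energy G) ρ ρ₀) ∧
        ((∀ᵐ t ∂(volume.restrict (Set.Ioi (0 : ℝ))), LowerSemicontinuousOn (ρ t).toFun Ω) →
          IsGradientFlow p hp θ (energy G) ρ ρ₀ → IsWeakSolution p ρ ρ₀ ξ)) := by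
  obtain ⟨P, hP, hpΩ⟩ := exists_ae_eq_const_of_essInf hp_lower hpq
  obtain ⟨Q, hPQ⟩ : ∃ Q, P.HolderConjugate Q := ⟨_, Real.HolderConjugate.conjExponent hP⟩
  have hpc : ∀ ρ : Density Ω, ∀ᵐ x ∂ρ.measure, (p x : ℝ) = P := fun ρ =>
    ρ.measure_absolutelyContinuous.ae_le hpΩ
  have hmem : ∀ (ρ : Density Ω) (ξ : EuclideanSpace ℝ (Fin N) → EuclideanSpace ℝ (Fin N)),
      MemVarLp ρ.measure (conjExp p) ξ → MemLp ξ (ENNReal.ofReal Q) ρ.measure := fun ρ ξ h =>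
    (memVarLp_iff_memLp hPQ.symm.pos (conjExp_ae_eq hPQ (hpc ρ)) ξ).1 h
  refine ⟨⟨_, isNormalization_rpow hP, fun ρ => isCompatible_rpow hPQ ρ (hpc ρ)⟩,
    fun θ _ hθ => ?_⟩
  have hgrad : ∀ (ρ : Density Ω) (ξ : EuclideanSpace ℝ (Fin N) → EuclideanSpace ℝ (Fin N)),
      IsWeakGradient Ω (fun x => derivOnIci G (ρ.toFun x)) ξ →
      MemVarLp ρ.measure (conjExp p) ξ →
      ∃ hV : qFlux p ξ ∈ varLp ρ.measure p hp,
        IsFinslerGradient p hp θ (energy G) ρ (tangentOf ρ.measure p hp ⟨qFlux p ξ, hV⟩) ∧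
        (∃ l, IsDifferential p hp (energy G) ρ l ∧
          (∀ v : varLp ρ.measure p hp,
            l (tangentOf ρ.measure p hp v) = ∫ x, inner ℝ (ξ x) (v.1 x) ∂ρ.measure) ∧
          ∀ ν, dualityMap ρ.measure p hp θ ν = {l} ↔
            ν = tangentOf ρ.measure p hp ⟨qFlux p ξ, hV⟩) ∧
        (LowerSemicontinuousOn ρ.toFun Ω →
          (∃! l, IsDifferential p hp (energy G) ρ l) ∧
          ∀ ν, IsFinslerGradient p hp θ (energy G) ρ ν →
            ν = tangentOf ρ.measure p hp ⟨qFlux p ξ, hV⟩) := by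
    intro ρ ξ hξ hξq
    have hξQ := hmem ρ ξ hξq
    have hV : qFlux p ξ ∈ varLp ρ.measure p hp := qFlux_mem_varLp hPQ (hpc ρ) hξQ
    obtain ⟨l, hl, hlξ⟩ := exists_isDifferential_energy (hp := hp) hΩb hΩc hG_convex hG_smooth ρ
      hPQ (hpc ρ) hξ hξQ
    have hJ := dualityMap_eq_singleton_iff hPQ (hpc ρ) (hθ ρ) hξQ hlξ hV
    exact ⟨hV, ⟨l, hl, (hJ _).2 rfl⟩, ⟨l, hl, hlξ, hJ⟩, fun hlsc =>
      ⟨⟨l, hl, fun l' hl' => hl'.unique hP.le (hpc ρ) hlsc hl⟩,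
        fun ν hν => hν.eq_tangentOf hPQ (hpc ρ) hlsc (hθ ρ) hξQ hl hlξ hV⟩⟩
  refine ⟨hgrad, fun ρ ρ₀ ξ hξ => ⟨fun hsol => ?_, ?_⟩⟩
  · classical
    -- The flux lies in the velocity space only for almost every `t`; the value `0` at the remaining
    -- times is a filler.
    refine ⟨fun t => if hV : qFlux p (ξ t) ∈ varLp (ρ t).measure p hp then
      tangentOf (ρ t).measure p hp ⟨qFlux p (ξ t), hV⟩ else 0, ?_, ?_⟩
    · filter_upwards [hξ] with t ht
      obtain ⟨hV, hF, -⟩ := hgrad (ρ t) (ξ t) ht.1 ht.2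
      rwa [dif_pos hV]
    · refine HasTimeDerivative.congr_ae ?_ hsol
      filter_upwards [hξ] with t ht
      obtain ⟨hV, -⟩ := hgrad (ρ t) (ξ t) ht.1 ht.2
      rw [dif_pos hV]
      rfl
  · rintro hlsc ⟨g, hg, hgρ⟩
    refine HasTimeDerivative.congr_ae ?_ hgρ
    -- At almost every time lower semicontinuity makes the Finsler gradient unique, so the given `g
    -- t` must be the tangent vector of the flux.
    filter_upwards [hξ, hlsc, hg] with t ht hlt hgt
    obtain ⟨hV, -, -, h⟩ := hgrad (ρ t) (ξ t) ht.1 ht.2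
    rw [(h hlt).2 _ hgt]
    rfl
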